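/- Let $q\ge 2$ be an integer and let $C_n$ denote the cyclic group of order $n$. For $k\ge 0$ put $G_k=(C_q)^k$ and $H_k=C_{q-1}\times (C_q)^k$, with the inclusions $G_k\subset G_{k+1}$ and $H_k\subset H_{k+1}$ as the first coordinates. For $N\ge 1$ let $\mathbf{X}_N$ be the following graph of groups. Its vertices are $c_1$ with group $H_0$, $a_k$ and $b_k$ with group $H_k$ ($1\le k\le N$), and $c_{k+1}$ with group $G_k$ ($k\ge 1$). Its edges are: $\{c_1,a_1\}$ and $\{c_1,b_1\}$ with group $H_0$; $\{a_k,a_{k+1}\}$ and $\{b_k,b_{k+1}\}$ with group $H_k$ ($1\le k<N$); $\{a_N,b_N\}$ with group $H_N$; $\{c_1,c_2\}$ with trivial group; and $\{c_{k+1},c_{k+2}\}$ with group $G_k$ ($k\ge 1$). All edge-to-vertex maps are the inclusions. Let $T$ be a maximal subtree of the underlying graph and let $\Gamma=\pi_1(\mathbf{X}_N,T)$ be the fundamental group, i.e. the group generated by the vertex groups and by letters $g_e$ for the oriented edges $e$, with the relations $g_e\varphi_e(a)g_e^{-1}=\varphi_{\bar e}(a)$ for $a$ in the edge group of $e$ (where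 $\varphi_e$ is the map from the edge group of $e$ to the vertex group of the target of $e$, and $\bar e$ is $e$ reversed), $g_{\bar e}=g_e^{-1}$, and $g_e=1$ for $e\in T$. It acts on the universal covering tree $\mathcal{T}$ of $\mathbf{X}_N$, whose vertices are the cosets in $\Gamma$ of the vertex groups and in which each $\gamma\in\Gamma$ and each edge $e$ from $x$ to $y$ give an edge from $\gamma G_x$ to $\gamma g_eG_y$ (here $G_x$, $G_y$ are the vertex groups at $x$, $y$). An element $\gamma\in\Gamma$ is hyperbolic if it fixes no vertex of $\mathcal{T}$; $\ell(\gamma)=\min_x d(x,\gamma x)$ is its translation length, $\mathrm{Axis}(\gamma)=\{x: d(x,\gamma x)=\ell(\gamma)\}$, and $\Gamma_{\mathrm{Axis}(\gamma)}$ is the pointwise stabilizer of the axis. A hyperbolic element is primitive if it is not of the form $h^r$ with $h\in\Gamma$, $r>1$. For hyperbolic $\gamma$ let $\gamma_0$ be a primitive hyperbolic element with $\gamma=\gamma_0^k$ for some $k\ge1$ (one of least translation length, if there are several). Put $$N_m(\mathbf{X}_N)=\sum_{[\gamma]:\ \ell(\gamma)=m}\frac{\ell(\gamma_0)}{|\mathrm{Cent}(\gamma,\Gamma_{\mathrm{Axis}(\gamma)})|},$$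 where the sum is over the conjugacy classes of hyperbolic elements of $\Gamma$ with translation length $m$, and $\mathrm{Cent}(\gamma,\Gamma_{\mathrm{Axis}(\gamma)})$ is the set of elements of $\Gamma_{\mathrm{Axis}(\gamma)}$ that commute with $\gamma$. Then for every real $\epsilon$ with $0<\epsilon\le q$ there is $N\ge 1$ such that, for every choice of $T$, each of the sums $N_m(\mathbf{X}_N)$ has only finitely many terms, $$\lim_{m\to\infty}\frac{N_m(\mathbf{X}_N)}{q^m}=1,\qquad |N_m(\mathbf{X}_N)-q^m|\notin O\big((q-\epsilon)^m\big)\quad (m\to\infty),$$ and $|N_m(\mathbf{X}_N)-q^m|>(q-\epsilon)^m$ for arbitrarily large $m$. -/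

import Mathlib

open Filter Topology Asymptotics

noncomputable section

/-! ## Automorphisms of a tree -/

namespace TreeAction

section

variable {Γ V : Type} [Group Γ] [MulAction Γ V] (G : SimpleGraph V)

/-- `g` has no fixed vertex (for an action without inversions on a tree: `g` is hyperbolic). -/
def IsHyperbolic (Γ V : Type) [Group Γ] [MulAction Γ V] (g : Γ) : Prop :=
  ∀ x : V, g • x ≠ x

/-- The translation length `ℓ(g) = min_x d(x, g x)`. -/
def translationLength (g : Γ) : ℕ :=
  sInf (Set.range fun x : V => G.dist x (g • x))

/-- The axis of `g`: the vertices that are moved by the minimal distance `ℓ(g)`. -/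
def axis (g : Γ) : Set V :=
  {x | G.dist x (g • x) = translationLength G g}

/-- A hyperbolic element that is not a proper power. -/
def IsPrimitiveHyperbolic (Γ V : Type) [Group Γ] [MulAction Γ V] (g : Γ) : Prop :=
  IsHyperbolic Γ V g ∧ ∀ (h : Γ) (r : ℕ), 1 < r → g ≠ h ^ r

/-- `ℓ(γ₀)`, where `γ₀` is a primitive hyperbolic element of which `γ` is a power. If there are
several such `γ₀`, the shortest one is taken. -/
def primitiveLength (γ : Γ) : ℕ :=
  sInf {n | ∃ γ₀ : Γ, IsPrimitiveHyperbolic Γ V γ₀ ∧ (∃ k : ℕ, 1 ≤ k ∧ γ = γ₀ ^ k) ∧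
    translationLength G γ₀ = n}

/-- `Cent(γ, Γ_Axis(γ))`: the elements of `Γ` that commute with `γ` and fix its axis pointwise. -/
def axisCentralizer (γ : Γ) : Subgroup Γ :=
  Subgroup.centralizer {γ} ⊓ fixingSubgroup Γ (axis G γ)

/-- The weight `ℓ(γ₀) / |Cent(γ, Γ_Axis(γ))|` of `γ`. -/
def weight (γ : Γ) : ℝ :=
  (primitiveLength G γ : ℝ) / (Nat.card (axisCentralizer G γ) : ℝ)

/-! The translation length and the weight are invariant under conjugation. -/

variable {G}

theorem dist_smul (hG : ∀ (g : Γ) (x y : V), G.Adj x y → G.Adj (g • x) (g • y))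
    (g : Γ) (x y : V) : G.dist (g • x) (g • y) = G.dist x y := by
  have key : ∀ (g : Γ) (x y : V), G.edist (g • x) (g • y) ≤ G.edist x y := by
    intro g x y
    refine le_iInf fun p => ?_
    let f : G →g G := ⟨fun z => g • z, fun {a b} h => hG g a b h⟩
    have := SimpleGraph.edist_le (p.map f)
    rwa [SimpleGraph.Walk.length_map] at this
  have h : G.edist (g • x) (g • y) = G.edist x y := by
    refine le_antisymm (key g x y) ?_
    have := key g⁻¹ (g • x) (g • y)
    rwa [inv_smul_smul, inv_smul_smul] at this
  unfold SimpleGraph.dist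
  rw [h]

theorem isHyperbolic_conj (h g : Γ) (hg : IsHyperbolic Γ V g) :
    IsHyperbolic Γ V (h * g * h⁻¹) := by
  intro x hx
  apply hg (h⁻¹ • x)
  rw [mul_smul, mul_smul] at hx
  rw [eq_inv_smul_iff]
  exact hx

theorem dist_conj (hG : ∀ (g : Γ) (x y : V), G.Adj x y → G.Adj (g • x) (g • y))
    (h g : Γ) (x : V) :
    G.dist (h • x) ((h * g * h⁻¹) • h • x) = G.dist x (g • x) := by
  rw [mul_smul, mul_smul, inv_smul_smul, dist_smul hG]

theorem translationLength_conj (hG : ∀ (g : Γ) (x y : V), G.Adj x y → G.Adj (g • x) (g • y))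
    (h g : Γ) : translationLength G (h * g * h⁻¹) = translationLength G g := by
  unfold translationLength
  congr 1
  ext n
  constructor
  · rintro ⟨x, rfl⟩
    refine ⟨h⁻¹ • x, ?_⟩
    have := dist_conj hG h g (h⁻¹ • x)
    rw [smul_inv_smul] at this
    exact this.symm
  · rintro ⟨x, rfl⟩
    exact ⟨h • x, dist_conj hG h g x⟩

theorem smul_mem_axis (hG : ∀ (g : Γ) (x y : V), G.Adj x y → G.Adj (g • x) (g • y))
    (h g : Γ) (x : V) (hx : x ∈ axis G g) : h • x ∈ axis G (h * g * h⁻¹) := by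
  unfold axis at *
  rw [Set.mem_ofPred_eq] at *
  rw [dist_conj hG, translationLength_conj hG, hx]

theorem primitiveLength_conj (hG : ∀ (g : Γ) (x y : V), G.Adj x y → G.Adj (g • x) (g • y))
    (h g : Γ) : primitiveLength G (h * g * h⁻¹) = primitiveLength G g := by
  have hprim : ∀ (h γ₀ : Γ), IsPrimitiveHyperbolic Γ V γ₀ →
      IsPrimitiveHyperbolic Γ V (h * γ₀ * h⁻¹) := by
    rintro h γ₀ ⟨h1, h2⟩
    refine ⟨isHyperbolic_conj h γ₀ h1, fun d r hr he => h2 (h⁻¹ * d * h⁻¹⁻¹) r hr ?_⟩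
    rw [conj_pow, ← he]
    group
  have sub : ∀ (h g : Γ) (n : ℕ),
      (∃ γ₀ : Γ, IsPrimitiveHyperbolic Γ V γ₀ ∧ (∃ k : ℕ, 1 ≤ k ∧ g = γ₀ ^ k) ∧
        translationLength G γ₀ = n) →
      ∃ γ₀ : Γ, IsPrimitiveHyperbolic Γ V γ₀ ∧ (∃ k : ℕ, 1 ≤ k ∧ h * g * h⁻¹ = γ₀ ^ k) ∧
        translationLength G γ₀ = n := by
    rintro h g n ⟨γ₀, h1, ⟨k, hk, rfl⟩, h3⟩
    exact ⟨h * γ₀ * h⁻¹, hprim h γ₀ h1, ⟨k, hk, conj_pow.symm⟩,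
      (translationLength_conj hG h γ₀).trans h3⟩
  unfold primitiveLength
  congr 1
  ext n
  refine ⟨fun hn => ?_, sub h g n⟩
  have := sub h⁻¹ _ n hn
  have e : h⁻¹ * (h * g * h⁻¹) * h⁻¹⁻¹ = g := by group
  rwa [e] at this

theorem conj_mem_axisCentralizer
    (hG : ∀ (g : Γ) (x y : V), G.Adj x y → G.Adj (g • x) (g • y))
    (h g d : Γ) (hd : d ∈ axisCentralizer G g) :
    h * d * h⁻¹ ∈ axisCentralizer G (h * g * h⁻¹) := by
  obtain ⟨h1, h2⟩ := Subgroup.mem_inf.1 hd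
  rw [Subgroup.mem_centralizer_singleton_iff] at h1
  rw [mem_fixingSubgroup_iff] at h2
  refine Subgroup.mem_inf.2 ⟨?_, ?_⟩
  · rw [Subgroup.mem_centralizer_singleton_iff]
    calc h * d * h⁻¹ * (h * g * h⁻¹) = h * (d * g) * h⁻¹ := by group
      _ = h * (g * d) * h⁻¹ := by rw [h1]
      _ = h * g * h⁻¹ * (h * d * h⁻¹) := by group
  · rw [mem_fixingSubgroup_iff]
    intro y hy
    have := smul_mem_axis hG h⁻¹ _ y hy
    have e : h⁻¹ * (h * g * h⁻¹) * h⁻¹⁻¹ = g := by group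
    rw [e] at this
    rw [mul_smul, mul_smul, h2 _ this, smul_inv_smul]

theorem weight_conj (hG : ∀ (g : Γ) (x y : V), G.Adj x y → G.Adj (g • x) (g • y))
    (h g : Γ) : weight G (h * g * h⁻¹) = weight G g := by
  have hc : Nat.card (axisCentralizer G (h * g * h⁻¹)) = Nat.card (axisCentralizer G g) := by
    have back : ∀ d ∈ axisCentralizer G (h * g * h⁻¹), h⁻¹ * d * h⁻¹⁻¹ ∈ axisCentralizer G g := by
      intro d hd
      have := conj_mem_axisCentralizer hG h⁻¹ _ d hd
      have e : h⁻¹ * (h * g * h⁻¹) * h⁻¹⁻¹ = g := by group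
      rwa [e] at this
    refine (Nat.card_congr
      (⟨fun d => ⟨h * d.1 * h⁻¹, conj_mem_axisCentralizer hG h g d.1 d.2⟩,
        fun d => ⟨h⁻¹ * d.1 * h⁻¹⁻¹, back d.1 d.2⟩, fun d => ?_, fun d => ?_⟩ :
        axisCentralizer G g ≃ axisCentralizer G (h * g * h⁻¹))).symm
    · apply Subtype.ext
      change h⁻¹ * (h * d.1 * h⁻¹) * h⁻¹⁻¹ = d.1
      group
    · apply Subtype.ext
      change h * (h⁻¹ * d.1 * h⁻¹⁻¹) * h⁻¹ = d.1
      group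
  unfold weight
  rw [primitiveLength_conj hG, hc]

end

end TreeAction

/-! ## Graphs of groups -/

/-- A graph of groups. The underlying graph is given by its vertices and by one orientation `e` of
each geometric edge, so that its oriented edges are the `e` and their formal inverses `ē`; loops
and multiple edges are allowed. The group `eGrp e` belongs to both `e` and `ē`; `toTgt e` is the
monomorphism `φ_e : G_e → G_{t(e)}` and `toSrc e` is `φ_ē : G_e → G_{s(e)}`. -/
structure GraphOfGroups where
  V : Type
  E : Type
  src : E → V
  tgt : E → V
  vGrp : V → Type
  eGrp : E → Type
  [vGroup : ∀ v, Group (vGrp v)]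
  [eGroup : ∀ e, Group (eGrp e)]
  toSrc : ∀ e, eGrp e →* vGrp (src e)
  toTgt : ∀ e, eGrp e →* vGrp (tgt e)
  toSrc_injective : ∀ e, Function.Injective (toSrc e)
  toTgt_injective : ∀ e, Function.Injective (toTgt e)

attribute [instance] GraphOfGroups.vGroup GraphOfGroups.eGroup

namespace GraphOfGroups

/-- A set `T` of edges forms a maximal subtree: it contains no loop and no two parallel edges, and
the graph on all vertices with the edges in `T` is a tree. -/
structure IsMaximalSubtree (X : GraphOfGroups) (T : Set X.E) : Prop where
  no_loop : ∀ e ∈ T, X.src e ≠ X.tgt e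
  no_parallel : Set.InjOn (fun e => s(X.src e, X.tgt e)) T
  isTree : (SimpleGraph.fromEdgeSet ((fun e => s(X.src e, X.tgt e)) '' T)).IsTree

/-- The generators of the fundamental group: the elements of all vertex groups and one letter
`g_e` for each edge (`g_ē` is `g_e⁻¹`). -/
abbrev Gen (X : GraphOfGroups) : Type := (Σ v, X.vGrp v) ⊕ X.E

/-- The relations of the fundamental group: those of the vertex groups,
`g_e φ_e(a) g_e⁻¹ = φ_ē(a)` for `a ∈ G_e`, and `g_e = 1` for `e ∈ T`. -/
inductive IsRelator (X : GraphOfGroups) (T : Set X.E) : FreeGroup X.Gen → Prop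
  | mul (v : X.V) (a b : X.vGrp v) : IsRelator X T
      (FreeGroup.of (Sum.inl ⟨v, a⟩) * FreeGroup.of (Sum.inl ⟨v, b⟩) *
        (FreeGroup.of (Sum.inl ⟨v, a * b⟩))⁻¹)
  | edge (e : X.E) (a : X.eGrp e) : IsRelator X T
      (FreeGroup.of (Sum.inr e) * FreeGroup.of (Sum.inl ⟨X.tgt e, X.toTgt e a⟩) *
        (FreeGroup.of (Sum.inr e))⁻¹ * (FreeGroup.of (Sum.inl ⟨X.src e, X.toSrc e a⟩))⁻¹)
  | tree (e : X.E) (he : e ∈ T) : IsRelator X T (FreeGroup.of (Sum.inr e))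

/-- The fundamental group `π₁(X, T)`. -/
abbrev Pi1 (X : GraphOfGroups) (T : Set X.E) : Type :=
  PresentedGroup {r | X.IsRelator T r}

/-- The canonical homomorphism from a vertex group to the fundamental group. -/
def vertexHom (X : GraphOfGroups) (T : Set X.E) (v : X.V) : X.vGrp v →* X.Pi1 T :=
  MonoidHom.mk' (fun a => PresentedGroup.of (Sum.inl ⟨v, a⟩)) (by
    intro a b
    have h := PresentedGroup.one_of_mem (rels := {r | X.IsRelator T r})
      (IsRelator.mul (X := X) (T := T) v a b)
    rw [map_mul, map_mul, map_inv, mul_inv_eq_one] at h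
    exact h.symm)

/-- The element `g_e` of the fundamental group. -/
def edgeElt (X : GraphOfGroups) (T : Set X.E) (e : X.E) : X.Pi1 T :=
  PresentedGroup.of (Sum.inr e)

/-- The vertices of the universal covering tree: the cosets `γ G_v`. -/
abbrev TreeVertex (X : GraphOfGroups) (T : Set X.E) : Type :=
  Σ v : X.V, X.Pi1 T ⧸ (X.vertexHom T v).range

/-- The universal covering tree. Each edge `e` of `X` and each `γ` in the fundamental group give an
edge that joins the vertices `γ G_{s(e)}` and `γ g_e G_{t(e)}`. -/
def tree (X : GraphOfGroups) (T : Set X.E) : SimpleGraph (X.TreeVertex T) :=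
  SimpleGraph.fromRel fun x y => ∃ (e : X.E) (γ : X.Pi1 T),
    x = ⟨X.src e, (γ : X.Pi1 T ⧸ (X.vertexHom T (X.src e)).range)⟩ ∧
    y = ⟨X.tgt e, ((γ * X.edgeElt T e : X.Pi1 T) : X.Pi1 T ⧸ (X.vertexHom T (X.tgt e)).range)⟩

theorem tree_adj_smul (X : GraphOfGroups) (T : Set X.E) (g : X.Pi1 T) (x y : X.TreeVertex T)
    (h : (X.tree T).Adj x y) : (X.tree T).Adj (g • x) (g • y) := by
  unfold tree at *
  rw [SimpleGraph.fromRel_adj] at *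
  refine ⟨fun he => h.1 (smul_left_cancel g he), ?_⟩
  rcases h.2 with ⟨e, γ, rfl, rfl⟩ | ⟨e, γ, rfl, rfl⟩
  · exact Or.inl ⟨e, g * γ, rfl, by rw [mul_assoc]; rfl⟩
  · exact Or.inr ⟨e, g * γ, rfl, by rw [mul_assoc]; rfl⟩

/-- The conjugacy classes of hyperbolic elements of translation length `m`. -/
def hyperbolicClasses (X : GraphOfGroups) (T : Set X.E) (m : ℕ) : Set (ConjClasses (X.Pi1 T)) :=
  {c | ∃ γ : X.Pi1 T, ConjClasses.mk γ = c ∧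
    TreeAction.IsHyperbolic (X.Pi1 T) (X.TreeVertex T) γ ∧
    TreeAction.translationLength (X.tree T) γ = m}

/-- The weight `ℓ(γ₀) / |Cent(γ, Γ_Axis(γ))|` of the conjugacy class of `γ`. -/
def classWeight (X : GraphOfGroups) (T : Set X.E) (c : ConjClasses (X.Pi1 T)) : ℝ :=
  Quotient.lift (TreeAction.weight (X.tree T)) (by
    intro a b hab
    obtain ⟨h, rfl⟩ := isConj_iff.1 hab
    exact (TreeAction.weight_conj (X.tree_adj_smul T) h a).symm) c

/-- `N_m(X)`: the sum of the weights over the conjugacy classes `[γ]` of hyperbolic elements of the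
fundamental group with `ℓ(γ) = m`. -/
def weightedCount (X : GraphOfGroups) (T : Set X.E) (m : ℕ) : ℝ :=
  ∑ᶠ c ∈ X.hyperbolicClasses T m, X.classWeight T c

end GraphOfGroups

/-! ## The graphs of groups `X_N` -/

namespace LoopWithCusp

/-- `G_k = (C_q)^k`. -/
abbrev G (q k : ℕ) : Type := Fin k → Multiplicative (ZMod q)

/-- `H_k = C_{q-1} × (C_q)^k`. -/
abbrev H (q k : ℕ) : Type := Multiplicative (ZMod (q - 1)) × G q k

/-- The inclusion of `G_j` into `G_k` as the first `j` coordinates, for `j ≤ k`. -/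
def inclG (q : ℕ) {j k : ℕ} (_h : j ≤ k) : G q j →* G q k where
  toFun f i := if hi : (i : ℕ) < j then f ⟨i, hi⟩ else 1
  map_one' := by
    funext i
    by_cases hi : (i : ℕ) < j <;> simp [hi]
  map_mul' f g := by
    funext i
    by_cases hi : (i : ℕ) < j <;> simp [hi]

theorem inclG_injective (q : ℕ) {j k : ℕ} (h : j ≤ k) : Function.Injective (inclG q h) := by
  intro f g hfg
  funext i
  have := congrFun hfg ⟨i, i.2.trans_le h⟩
  simpa [inclG] using this

/-- The inclusion of `H_j` into `H_k`, for `j ≤ k`. -/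
def inclH (q : ℕ) {j k : ℕ} (h : j ≤ k) : H q j →* H q k :=
  MonoidHom.prodMap (MonoidHom.id _) (inclG q h)

theorem inclH_injective (q : ℕ) {j k : ℕ} (h : j ≤ k) : Function.Injective (inclH q h) :=
  Function.Injective.prodMap Function.injective_id (inclG_injective q h)

/-- The vertices of `X_N` for `N = n + 1`: the base vertex, the upper vertices `a_1, …, a_N`, the
lower vertices `b_1, …, b_N`, and the vertices of the cusp. All indices start at `0` here, so
`a i` is `a_{i+1}`, `b i` is `b_{i+1}`, and `c k` is the vertex at distance `k + 1` from the
base. -/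
inductive Vertex (n : ℕ) : Type
  | base : Vertex n
  | a (i : Fin (n + 1)) : Vertex n
  | b (i : Fin (n + 1)) : Vertex n
  | c (k : ℕ) : Vertex n

/-- The edges: from the base to `a_1` and to `b_1`, the upper and the lower segment, the edge from
`a_N` to `b_N`, the edge from the base into the cusp, and the cusp. -/
inductive Edge (n : ℕ) : Type
  | baseA : Edge n
  | baseB : Edge n
  | segA (i : Fin n) : Edge n
  | segB (i : Fin n) : Edge n
  | top : Edge n
  | baseC : Edge n
  | segC (k : ℕ) : Edge n

def src (n : ℕ) : Edge n → Vertex n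
  | .baseA => .base
  | .baseB => .base
  | .segA i => .a i.castSucc
  | .segB i => .b i.castSucc
  | .top => .a (Fin.last n)
  | .baseC => .base
  | .segC k => .c k

def tgt (n : ℕ) : Edge n → Vertex n
  | .baseA => .a 0
  | .baseB => .b 0
  | .segA i => .a i.succ
  | .segB i => .b i.succ
  | .top => .b (Fin.last n)
  | .baseC => .c 0
  | .segC k => .c (k + 1)

/-- The vertex groups: `H_0` at the base, `H_i` at `a_i` and at `b_i`, and `G_k` at the cusp vertex
at distance `k` from the base. -/
def vGrp (q n : ℕ) : Vertex n → Type
  | .base => H q 0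
  | .a i => H q ((i : ℕ) + 1)
  | .b i => H q ((i : ℕ) + 1)
  | .c k => G q (k + 1)

/-- The edge groups: `H_i` between `H_i` and `H_{i+1}`, `H_N` between the two copies of `H_N`,
the trivial group `G_0` between `H_0` and `G_1`, and `G_k` between `G_k` and `G_{k+1}`. -/
def eGrp (q n : ℕ) : Edge n → Type
  | .baseA => H q 0
  | .baseB => H q 0
  | .segA i => H q ((i : ℕ) + 1)
  | .segB i => H q ((i : ℕ) + 1)
  | .top => H q (n + 1)
  | .baseC => G q 0
  | .segC k => G q (k + 1)

instance (q n : ℕ) : ∀ v : Vertex n, Group (vGrp q n v)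
  | .base => inferInstanceAs (Group (H q 0))
  | .a i => inferInstanceAs (Group (H q ((i : ℕ) + 1)))
  | .b i => inferInstanceAs (Group (H q ((i : ℕ) + 1)))
  | .c k => inferInstanceAs (Group (G q (k + 1)))

instance (q n : ℕ) : ∀ e : Edge n, Group (eGrp q n e)
  | .baseA => inferInstanceAs (Group (H q 0))
  | .baseB => inferInstanceAs (Group (H q 0))
  | .segA i => inferInstanceAs (Group (H q ((i : ℕ) + 1)))
  | .segB i => inferInstanceAs (Group (H q ((i : ℕ) + 1)))
  | .top => inferInstanceAs (Group (H q (n + 1)))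
  | .baseC => inferInstanceAs (Group (G q 0))
  | .segC k => inferInstanceAs (Group (G q (k + 1)))

def toSrc (q n : ℕ) : ∀ e : Edge n, eGrp q n e →* vGrp q n (src n e)
  | .baseA => MonoidHom.id (H q 0)
  | .baseB => MonoidHom.id (H q 0)
  | .segA i => MonoidHom.id (H q ((i : ℕ) + 1))
  | .segB i => MonoidHom.id (H q ((i : ℕ) + 1))
  | .top => MonoidHom.id (H q (n + 1))
  | .baseC => (1 : G q 0 →* H q 0)
  | .segC k => MonoidHom.id (G q (k + 1))

def toTgt (q n : ℕ) : ∀ e : Edge n, eGrp q n e →* vGrp q n (tgt n e)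
  | .baseA => inclH q (Nat.zero_le 1)
  | .baseB => inclH q (Nat.zero_le 1)
  | .segA i => inclH q (Nat.le_succ ((i : ℕ) + 1))
  | .segB i => inclH q (Nat.le_succ ((i : ℕ) + 1))
  | .top => MonoidHom.id (H q (n + 1))
  | .baseC => inclG q (Nat.zero_le 1)
  | .segC k => inclG q (Nat.le_succ (k + 1))

theorem toSrc_injective (q n : ℕ) : ∀ e : Edge n, Function.Injective (toSrc q n e)
  | .baseA => Function.injective_id
  | .baseB => Function.injective_id
  | .segA _ => Function.injective_id
  | .segB _ => Function.injective_id
  | .top => Function.injective_id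
  | .baseC => fun (f g : G q 0) _ => (Subsingleton.elim f g : f = g)
  | .segC _ => Function.injective_id

theorem toTgt_injective (q n : ℕ) : ∀ e : Edge n, Function.Injective (toTgt q n e)
  | .baseA => inclH_injective q (Nat.zero_le 1)
  | .baseB => inclH_injective q (Nat.zero_le 1)
  | .segA i => inclH_injective q (Nat.le_succ ((i : ℕ) + 1))
  | .segB i => inclH_injective q (Nat.le_succ ((i : ℕ) + 1))
  | .top => Function.injective_id
  | .baseC => inclG_injective q (Nat.zero_le 1)
  | .segC k => inclG_injective q (Nat.le_succ (k + 1))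

/-- The graph of groups `X_N` for `N = n + 1`: a circuit with the `2N + 1` vertices
`base, a_1, …, a_N, b_N, …, b_1` whose groups grow from `H_0` at the base to `H_N` at `a_N` and
`b_N`, and a cusp `G_1, G_2, …` that is attached to the base along the trivial group. -/
def graphOfGroups (q n : ℕ) : GraphOfGroups where
  V := Vertex n
  E := Edge n
  src := src n
  tgt := tgt n
  vGrp := vGrp q n
  eGrp := eGrp q n
  toSrc := toSrc q n
  toTgt := toTgt q n
  toSrc_injective := toSrc_injective q n
  toTgt_injective := toTgt_injective q n

end LoopWithCusp

end

/-!
The fundamental group of `X_N` acts on its universal covering tree, and the translates of the base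
vertex cut this tree into pieces that lie over the loop and pieces that lie over the cusp. A
geodesic between two translates of the base vertex is therefore described by a word in the
crossings of these pieces (`Step`, `Word`). The universal property of the fundamental group
provides an action on the set of words, which shows that words, up to the group of the base
vertex, are normal forms for the elements of the group (`LoopCuspTree.word`, `LoopCuspTree.elt`)
and that the covering graph really is a tree (`LoopCuspTree.isTree`). Distances are lengths of
words, where the length of a crossing is determined by the level of its label in the filtration
`G_0 ⊂ G_1 ⊂ …`.

Every hyperbolic element is conjugate to one whose axis passes through the base vertex, and the
conjugates with this property are the cyclic rotations of its word. Weighting each of them by the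
length of its first crossing, the sum over a conjugacy class of translation length `m` is `q - 1`
times the weight of the class, unless the class contains a proper power up to elements that fix
the axis. Such classes are so rare that they contribute at most about `m ^ 2 * q ^ (m / 2)`
(`LoopCuspTree.abs_finsum_weight_sub_le`, `LoopCuspTree.ncard_powers_le`). The remaining sum is a
count of closed words, and the transfer matrix method expresses its generating function as
`-u * det' / det` for an explicit rational function `det` (`LoopCuspTree.gapSeries_mul_det`), so
that it is a power sum over the inverses of the zeros of `det`
(`LoopCuspTree.gapSum_eq_powerSum`). With `x = q * u ^ 2` this function is
`(1 - u ^ 2) * (1 - q * u) * P * Q / (1 - x) ^ 3`, where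
`P = 1 + u - x ^ N * u * (1 + q * u)` and
`Q = (1 - u) * (1 + q * u) - x ^ N * u * (1 + q * (q - 2) * u ^ 2)`.

The factor `1 - q * u` contributes the main term `q ^ m`. For `N ≥ 5` neither `P` nor `Q` vanishes
on the disc `|u| ≤ 1 / q` (`one_div_lt_norm_of_mem_roots`), so everything else is of smaller
order. On the other hand `Q` tends to `(1 - u) * (1 + q * u)` near `-1 / q` as `N` grows, so that
for large `N` it has a zero slightly to the left of `-1 / q` (`exists_root_evenPoly`). The inverse
of this zero has modulus greater than `q - ε`, and a power sum is not bounded by the powers of any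
number that is smaller than the modulus of one of its terms (`not_isBigO_powerSum`).
-/

noncomputable section

/-! ### Geodesics in trees -/

namespace TreeGeometry

section

variable {V : Type} {G : SimpleGraph V}

/-- `n` is a neighbour of `v` on a geodesic from `v` to `u`. In a tree there is exactly one such
neighbour for `v ≠ u`. -/
def Toward (G : SimpleGraph V) (v u n : V) : Prop :=
  G.Adj v n ∧ G.dist n u + 1 = G.dist v u

/-- `y` lies on a geodesic from `u` to `w`. -/
def Between (G : SimpleGraph V) (u y w : V) : Prop :=
  G.dist u y + G.dist y w = G.dist u w

theorem Between.symm {u y w : V} (h : Between G u y w) : Between G w y u := by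
  unfold Between at *
  rw [G.dist_comm (u := w) (v := y), G.dist_comm (u := y) (v := u), G.dist_comm (u := w) (v := u)]
  omega

theorem Toward.ne {v u n : V} (h : Toward G v u n) : v ≠ u := by
  rintro rfl
  have := h.2
  rw [SimpleGraph.dist_self] at this
  omega

theorem toward_self_of_adj {v u : V} (h : G.Adj v u) : Toward G v u u :=
  ⟨h, by rw [SimpleGraph.dist_self, SimpleGraph.dist_eq_one_iff_adj.2 h]⟩

theorem exists_toward (hG : G.Connected) {v u : V} (h : v ≠ u) : ∃ n, Toward G v u n := by
  obtain ⟨p, hp⟩ := hG.exists_walk_length_eq_dist v u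
  cases p with
  | nil => exact absurd rfl h
  | cons hadj q =>
    rename_i n
    refine ⟨n, hadj, le_antisymm ?_ ?_⟩
    · rw [← hp, SimpleGraph.Walk.length_cons]
      exact Nat.succ_le_succ (SimpleGraph.dist_le q)
    · have := hG.dist_triangle (u := v) (v := n) (w := u)
      rw [SimpleGraph.dist_eq_one_iff_adj.2 hadj] at this
      omega

theorem toward_unique (hG : G.IsTree) {v u n n' : V} (h : Toward G v u n)
    (h' : Toward G v u n') : n = n' := by
  obtain ⟨p, hp⟩ := hG.connected.exists_walk_length_eq_dist n u
  obtain ⟨p', hp'⟩ := hG.connected.exists_walk_length_eq_dist n' u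
  have h1 : (SimpleGraph.Walk.cons h.1 p).IsPath :=
    SimpleGraph.Walk.isPath_of_length_eq_dist _ (by
      rw [SimpleGraph.Walk.length_cons, hp, h.2])
  have h2 : (SimpleGraph.Walk.cons h'.1 p').IsPath :=
    SimpleGraph.Walk.isPath_of_length_eq_dist _ (by
      rw [SimpleGraph.Walk.length_cons, hp', h'.2])
  have := congrArg Subtype.val
    ((hG.isAcyclic.subsingleton_path v u).elim (⟨_, h1⟩ : G.Path v u) ⟨_, h2⟩)
  have := congrArg SimpleGraph.Walk.snd this
  simpa using this

theorem dist_of_not_toward (hG : G.IsTree) {v u n : V} (h : G.Adj v n) (hn : ¬ Toward G v u n) :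
    G.dist n u = G.dist v u + 1 := by
  rcases hG.dist_eq_dist_add_one_of_adj u h with h1 | h1
  · exact absurd ⟨h, by rw [G.dist_comm (u := n), G.dist_comm (u := v)]; exact h1.symm⟩ hn
  · rw [G.dist_comm (u := n), G.dist_comm (u := v)]; exact h1

theorem Between.toward {u v w n : V} (hG : G.Connected) (h : Between G u v w)
    (hn : Toward G u v n) : Toward G u w n := by
  refine ⟨hn.1, ?_⟩
  have h1 := hG.dist_triangle (u := n) (v := v) (w := w)
  have h2 := hG.dist_triangle (u := u) (v := n) (w := w)
  rw [SimpleGraph.dist_eq_one_iff_adj.2 hn.1] at h2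
  have := hn.2
  unfold Between at h
  omega

theorem Toward.between {u w n : V} (hn : Toward G u w n) : Between G u n w := by
  unfold Between
  rw [SimpleGraph.dist_eq_one_iff_adj.2 hn.1, ← hn.2, add_comm]

/-- Geodesics in a tree can be concatenated if there is no backtracking. -/
theorem between_of_forall_toward (hG : G.IsTree) {u v w : V}
    (h : ∀ n, Toward G v u n → ¬ Toward G v w n) : Between G u v w := by
  obtain ⟨k, hk⟩ : ∃ k, G.dist v w = k := ⟨_, rfl⟩
  induction k generalizing v with
  | zero =>
    have := (hG.connected.dist_eq_zero_iff).1 hk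
    subst this
    simp [Between]
  | succ k ih =>
    have hne : v ≠ w := by
      rintro rfl
      simp at hk
    obtain ⟨n, hn⟩ := exists_toward hG.connected hne
    have h1 : ¬ Toward G v u n := fun h' => h n h' hn
    have h2 := dist_of_not_toward hG hn.1 h1
    have hb : Toward G n u v := ⟨hn.1.symm, h2.symm⟩
    have := ih (v := n) (by
      intro n' hn' hn''
      have := toward_unique hG hb hn'
      subst this
      have e1 := hn''.2
      have e2 := hn.2
      omega) (by have := hn.2; omega)
    unfold Between at *
    rw [G.dist_comm (u := u) (v := n), h2, G.dist_comm (u := v) (v := u)] at this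
    have := hn.2
    omega

theorem Between.order (hG : G.IsTree) {u y y' w : V} (h : Between G u y w)
    (h' : Between G u y' w) (hle : G.dist u y ≤ G.dist u y') : Between G u y y' := by
  obtain ⟨k, hk⟩ : ∃ k, G.dist u y = k := ⟨_, rfl⟩
  induction k generalizing u with
  | zero =>
    have := (hG.connected.dist_eq_zero_iff).1 hk
    subst this
    simp [Between]
  | succ k ih =>
    have hne : u ≠ y := by
      rintro rfl
      simp at hk
    have hne' : u ≠ y' := by
      rintro rfl
      rw [SimpleGraph.dist_self] at hle
      omega
    obtain ⟨n, hn⟩ := exists_toward hG.connected hne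
    obtain ⟨n', hn'⟩ := exists_toward hG.connected hne'
    have := toward_unique hG (h.toward hG.connected hn) (h'.toward hG.connected hn')
    subst this
    have e0 := (h.toward hG.connected hn).2
    have e1 := hn.2
    have e2 := hn'.2
    have := ih (u := n) (by unfold Between at *; omega) (by unfold Between at *; omega)
      (by omega) (by omega)
    unfold Between at *
    omega

theorem Between.eq_of_dist_eq (hG : G.IsTree) {u y y' w : V} (h : Between G u y w)
    (h' : Between G u y' w) (he : G.dist u y = G.dist u y') : y = y' := by
  have := h.order hG h' he.le
  refine (hG.connected.dist_eq_zero_iff).1 ?_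
  unfold Between at this
  omega

end

/-! ### Axes of tree automorphisms -/

section

variable {Γ V : Type} [Group Γ] [MulAction Γ V] {G : SimpleGraph V}

/-- `x` lies on the axis of the hyperbolic automorphism `g`: the geodesics `[x, g x]` and
`[g x, g² x]` meet only in `g x`. -/
def Translates (G : SimpleGraph V) (g : Γ) (x : V) : Prop :=
  g • x ≠ x ∧ G.dist x (g • g • x) = 2 * G.dist x (g • x)

variable (hG : G.IsTree) (hadj : ∀ (g : Γ) (x y : V), G.Adj x y → G.Adj (g • x) (g • y))

include hadj

theorem Between.smul (g : Γ) {u y w : V} (h : Between G u y w) :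
    Between G (g • u) (g • y) (g • w) := by
  unfold Between at *
  simpa only [TreeAction.dist_smul hadj] using h

theorem Toward.smul (g : Γ) {u v n : V} (h : Toward G v u n) :
    Toward G (g • v) (g • u) (g • n) :=
  ⟨hadj g _ _ h.1, by simpa only [TreeAction.dist_smul hadj] using h.2⟩

theorem dist_inv_smul (g : Γ) (x y : V) : G.dist x (g⁻¹ • y) = G.dist (g • x) y := by
  rw [← TreeAction.dist_smul hadj g, smul_inv_smul]

theorem Translates.conj {g : Γ} {x : V} (h : Translates G g x) (k : Γ) :
    Translates G (k * g * k⁻¹) (k • x) := by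
  constructor
  · rw [mul_smul, mul_smul, inv_smul_smul]
    exact fun e => h.1 (smul_left_cancel k e)
  · simp only [mul_smul, inv_smul_smul, TreeAction.dist_smul hadj]
    exact h.2

theorem Translates.smul_of_commute {g : Γ} {x : V} (h : Translates G g x) {k : Γ}
    (hk : k * g = g * k) : Translates G g (k • x) := by
  have := h.conj hadj k
  rwa [hk, mul_inv_cancel_right] at this

include hG

omit hadj in
theorem Translates.dist_pos {g : Γ} {x : V} (h : Translates G g x) : 0 < G.dist x (g • x) :=
  Nat.pos_of_ne_zero fun h0 => h.1 ((hG.connected.dist_eq_zero_iff).1 h0).symm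

theorem Translates.dist_pow {g : Γ} {x : V} (h : Translates G g x) (k : ℕ) :
    G.dist x (g ^ k • x) = k * G.dist x (g • x) := by
  induction k with
  | zero => simp
  | succ k ih =>
    rcases Nat.eq_zero_or_pos k with rfl | hk
    · simp
    have hb : Between G x (g • x) (g ^ k • x) := by
      obtain ⟨j, rfl⟩ : ∃ j, k = j + 1 := ⟨k - 1, by omega⟩
      have e : G.dist (g • x) (g ^ (j + 1) • x) = G.dist x (g ^ j • x) := by
        rw [pow_succ', mul_smul, TreeAction.dist_smul hadj]
      have t1 := hG.connected.dist_triangle (u := x) (v := g • x) (w := g ^ (j + 1) • x)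
      have t2 : G.dist x (g ^ j • x) ≤ j * G.dist x (g • x) := by
        clear ih hk t1 e
        induction j with
        | zero => simp
        | succ j ih =>
          have := hG.connected.dist_triangle (u := x) (v := g • x) (w := g ^ (j + 1) • x)
          rw [pow_succ', mul_smul, TreeAction.dist_smul hadj, ← mul_smul, ← pow_succ'] at this
          have e : (j + 1) * G.dist x (g • x) = j * G.dist x (g • x) + G.dist x (g • x) := by ring
          omega
      have e' : (j + 1) * G.dist x (g • x) = j * G.dist x (g • x) + G.dist x (g • x) := by ring
      unfold Between
      omega
    have key : Between G x (g • x) (g ^ (k + 1) • x) := by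
      refine between_of_forall_toward hG fun n h1 h2 => ?_
      have hb' : Between G (g • x) (g • g • x) (g ^ (k + 1) • x) := by
        have := hb.smul hadj g
        rwa [← mul_smul g (g ^ k), ← pow_succ'] at this
      obtain ⟨n', hn'⟩ := exists_toward hG.connected
        (v := g • x) (u := g • g • x) (fun e => h.1 (smul_left_cancel g e).symm)
      have := toward_unique hG (hb'.toward hG.connected hn') h2
      subst this
      have e1 := h1.2
      have e2 := hn'.2
      have e3 := h.2
      have e4 := hG.connected.dist_triangle (u := x) (v := n') (w := g • g • x)
      rw [TreeAction.dist_smul hadj] at e2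
      rw [G.dist_comm (u := n'), G.dist_comm (u := g • x)] at e1
      omega
    unfold Between at key
    rw [← key, pow_succ', mul_smul, TreeAction.dist_smul hadj, ih]
    ring

theorem Translates.dist_zpow {g : Γ} {x : V} (h : Translates G g x) (k : ℤ) :
    G.dist x (g ^ k • x) = k.natAbs * G.dist x (g • x) := by
  rcases Int.natAbs_eq k with hk | hk
  · conv_lhs => rw [hk]
    rw [zpow_natCast, h.dist_pow hG hadj]
  · conv_lhs => rw [hk]
    rw [zpow_neg, zpow_natCast, dist_inv_smul hadj, G.dist_comm, h.dist_pow hG hadj]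

/-- Every displacement is at least the displacement of a point on the axis. -/
theorem Translates.le_dist {g : Γ} {x : V} (h : Translates G g x) (y : V) :
    G.dist x (g • x) ≤ G.dist y (g • y) := by
  by_contra hlt
  push Not at hlt
  have hy : ∀ k : ℕ, G.dist y (g ^ k • y) ≤ k * G.dist y (g • y) := by
    intro k
    induction k with
    | zero => simp
    | succ k ih =>
      have := hG.connected.dist_triangle (u := y) (v := g • y) (w := g ^ (k + 1) • y)
      rw [pow_succ', mul_smul, TreeAction.dist_smul hadj, ← mul_smul, ← pow_succ'] at this
      have e : (k + 1) * G.dist y (g • y) = k * G.dist y (g • y) + G.dist y (g • y) := by ring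
      omega
  set k := 2 * G.dist x y + 1 with hk
  have h1 := h.dist_pow hG hadj k
  have h2 := hy k
  have t1 := hG.connected.dist_triangle (u := x) (v := y) (w := g ^ k • x)
  have t2 := hG.connected.dist_triangle (u := y) (v := g ^ k • y) (w := g ^ k • x)
  rw [TreeAction.dist_smul hadj, G.dist_comm (u := y) (v := x)] at t2
  have : k * (G.dist y (g • y) + 1) ≤ k * G.dist x (g • x) := Nat.mul_le_mul_left _ hlt
  rw [mul_add] at this
  omega

theorem Translates.isHyperbolic {g : Γ} {x : V} (h : Translates G g x) :
    TreeAction.IsHyperbolic Γ V g := by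
  intro y hy
  have h1 := h.le_dist hG hadj y
  have h2 := h.dist_pos hG
  rw [hy, SimpleGraph.dist_self] at h1
  omega

theorem Translates.translationLength_eq {g : Γ} {x : V} (h : Translates G g x) :
    TreeAction.translationLength G g = G.dist x (g • x) := by
  refine le_antisymm (Nat.sInf_le ⟨x, rfl⟩) ?_
  refine le_csInf ⟨_, x, rfl⟩ ?_
  rintro _ ⟨y, rfl⟩
  exact h.le_dist hG hadj y

theorem Translates.mem_axis_iff {g : Γ} {x : V} (h : Translates G g x) (y : V) :
    y ∈ TreeAction.axis G g ↔ G.dist y (g • y) = G.dist x (g • x) := by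
  rw [← h.translationLength_eq hG hadj]
  rfl

theorem Translates.of_between {g : Γ} {x z : V} (h : Translates G g x)
    (hz : Between G x z (g • x)) :
    G.dist z (g • z) = G.dist x (g • x) ∧ Translates G g z := by
  have h1 : G.dist z (g • z) ≤ G.dist x (g • x) := by
    have := hG.connected.dist_triangle (u := z) (v := g • x) (w := g • z)
    rw [TreeAction.dist_smul hadj] at this
    unfold Between at hz
    omega
  have h1' : G.dist z (g • z) = G.dist x (g • x) := le_antisymm h1 (h.le_dist hG hadj z)
  have hpos := h.dist_pos hG
  refine ⟨h1', fun e => ?_, ?_⟩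
  · rw [e, SimpleGraph.dist_self] at h1'
    omega
  · have h3 := h.dist_pow hG hadj 3
    have e3 : g ^ 3 • x = g • g • g • x := by
      simp only [← mul_smul]
      rw [pow_three]
    rw [e3] at h3
    have t1 := hG.connected.dist_triangle (u := x) (v := z) (w := g • g • g • x)
    have t2 := hG.connected.dist_triangle (u := z) (v := g • g • z) (w := g • g • g • x)
    have t3 := hG.connected.dist_triangle (u := z) (v := g • z) (w := g • g • z)
    rw [TreeAction.dist_smul hadj, TreeAction.dist_smul hadj] at t2
    rw [TreeAction.dist_smul hadj] at t3
    unfold Between at hz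
    omega

omit hG in
theorem Translates.zpow_smul {g : Γ} {x : V} (h : Translates G g x) (k : ℤ) :
    G.dist (g ^ k • x) (g • g ^ k • x) = G.dist x (g • x) ∧ Translates G g (g ^ k • x) := by
  have hc : g ^ k * g = g * g ^ k := (Commute.refl g).zpow_left k
  refine ⟨?_, h.smul_of_commute hadj hc⟩
  rw [← mul_smul, ← hc, mul_smul, TreeAction.dist_smul hadj]

/-- The union of the geodesics `[g ^ k x, g ^ (k + 1) x]` contains every vertex of minimal
displacement. -/
theorem Translates.exists_between {g : Γ} {x y : V} (h : Translates G g x)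
    (hy : G.dist y (g • y) = G.dist x (g • x)) :
    ∃ k : ℤ, Between G (g ^ k • x) y (g • g ^ k • x) := by
  classical
  by_contra hcon
  let L : Set V := {z | ∃ k : ℤ, Between G (g ^ k • x) z (g • g ^ k • x)}
  have hL : L.Nonempty := ⟨x, 0, by simp [Between]⟩
  -- a vertex `z` of the line that is nearest to `y`
  obtain ⟨z, ⟨k, hzk⟩, hmin⟩ : ∃ z ∈ L, ∀ z' ∈ L, G.dist z y ≤ G.dist z' y := by
    obtain ⟨z, hz, hz'⟩ := exists_minimalFor_of_wellFoundedLT (· ∈ L) (fun z => G.dist z y) hL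
    exact ⟨z, hz, fun z' h' => by
      rcases le_total (G.dist z y) (G.dist z' y) with h1 | h1
      · exact h1
      · exact hz' h' h1⟩
  have hyz : z ≠ y := fun e => hcon ⟨k, e ▸ hzk⟩
  obtain ⟨hd, hx'⟩ := h.zpow_smul hadj k
  have memL : ∀ (j : ℤ) (v : V), Between G (g ^ (k + j) • x) v (g • g ^ (k + j) • x) → v ∈ L :=
    fun j v hv => ⟨k + j, hv⟩
  have e1 : g ^ (k + 1) • x = g • g ^ k • x := by rw [add_comm, zpow_add, zpow_one, mul_smul]
  have e2 : g • g ^ (k + -1) • x = g ^ k • x := by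
    rw [← mul_smul, ← zpow_one_add]
    congr 2
    ring
  set x' := g ^ k • x with hx'def
  obtain ⟨hzm, hzt⟩ := hx'.of_between hG hadj hzk
  have hadd : G.dist x' z + G.dist z (g • x') = G.dist x' (g • x') := hzk
  have notL : ∀ n, Toward G z y n → n ∉ L := by
    intro n hn hnL
    have := hmin n hnL
    have := hn.2
    omega
  have fL : ∀ f, Toward G z (g • z) f → f ∈ L := by
    intro f hf
    by_cases hzx : z = g • x'
    · refine memL 1 f ?_
      rw [e1, ← hzx]
      exact hf.between
    · obtain ⟨f', hf'⟩ := exists_toward hG.connected hzx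
      have hb : Between G z (g • x') (g • z) := by
        unfold Between
        rw [TreeAction.dist_smul hadj, hzm]
        omega
      have := toward_unique hG hf (hb.toward hG.connected hf')
      subst this
      refine ⟨k, ?_⟩
      have t1 := hG.connected.dist_triangle (u := x') (v := z) (w := f)
      have t2 := hG.connected.dist_triangle (u := x') (v := f) (w := g • x')
      rw [SimpleGraph.dist_eq_one_iff_adj.2 hf.1] at t1
      have := hf'.2
      change G.dist x' f + G.dist f (g • x') = G.dist x' (g • x')
      omega
  have bL : ∀ b, Toward G z (g⁻¹ • z) b → b ∈ L := by
    intro b hb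
    by_cases hzx : z = x'
    · refine memL (-1) b ?_
      rw [e2]
      have : g ^ (k + -1) • x = g⁻¹ • z := by
        rw [eq_inv_smul_iff, e2, hzx]
      rw [this, ← hzx]
      exact hb.between.symm
    · obtain ⟨b', hb'⟩ := exists_toward hG.connected hzx
      have hbt : Between G z x' (g⁻¹ • z) := by
        unfold Between
        rw [dist_inv_smul hadj, dist_inv_smul hadj, G.dist_comm (u := z) (v := x'),
          G.dist_comm (u := g • x') (v := z), G.dist_comm (u := g • z) (v := z), hzm]
        omega
      have := toward_unique hG hb (hbt.toward hG.connected hb')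
      subst this
      refine ⟨k, ?_⟩
      have t1 := hG.connected.dist_triangle (u := b) (v := z) (w := g • x')
      have t2 := hG.connected.dist_triangle (u := x') (v := b) (w := g • x')
      rw [G.dist_comm (u := b) (v := z), SimpleGraph.dist_eq_one_iff_adj.2 hb.1] at t1
      have := hb'.2
      rw [G.dist_comm (u := b), G.dist_comm (u := z)] at this
      change G.dist x' b + G.dist b (g • x') = G.dist x' (g • x')
      omega
  have b1 : Between G y z (g • z) :=
    between_of_forall_toward hG fun n h1 h2 => notL n h1 (fL n h2)
  have b2 : Between G y (g • z) (g • y) := by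
    refine between_of_forall_toward hG fun n h1 h2 => ?_
    obtain ⟨n', hn'⟩ := exists_toward hG.connected (v := g • z) (u := z) hzt.1
    have := toward_unique hG h1 (b1.symm.toward hG.connected hn')
    subst this
    have h3 := hn'.smul hadj g⁻¹
    have h4 := h2.smul hadj g⁻¹
    rw [inv_smul_smul] at h3 h4
    rw [inv_smul_smul] at h4
    exact notL _ h4 (bL _ h3)
  have hpos : 0 < G.dist y z := Nat.pos_of_ne_zero fun h0 =>
    hyz ((hG.connected.dist_eq_zero_iff).1 h0).symm
  unfold Between at b1 b2
  rw [TreeAction.dist_smul hadj] at b2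
  omega

end

end TreeGeometry

/-! ### The cusp group and its filtration -/

namespace LoopWithCusp

/-- The union of the groups `(C_q)^k`: sequences in `C_q` that are eventually trivial. -/
def cuspSubgroup (q : ℕ) : Subgroup (ℕ → Multiplicative (ZMod q)) where
  carrier := {b | ∃ k, ∀ i, k ≤ i → b i = 1}
  mul_mem' := by
    rintro b c ⟨k, hk⟩ ⟨l, hl⟩
    refine ⟨max k l, fun i hi => ?_⟩
    rw [Pi.mul_apply, hk i (le_trans (le_max_left _ _) hi), hl i (le_trans (le_max_right _ _) hi),
      one_mul]
  one_mem' := ⟨0, fun _ _ => rfl⟩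
  inv_mem' := by
    rintro b ⟨k, hk⟩
    exact ⟨k, fun i hi => by rw [Pi.inv_apply, hk i hi, inv_one]⟩

/-- `G_∞`, the union of the groups `G_k`. -/
abbrev GInf (q : ℕ) : Type := cuspSubgroup q

variable {q : ℕ}

theorem GInf.exists_forall_eq_one (b : GInf q) : ∃ k, ∀ i, k ≤ i → b.1 i = 1 := b.2

open Classical in
/-- The least `k` for which `b` lies in `G_k`. -/
def level (b : GInf q) : ℕ := Nat.find b.exists_forall_eq_one

theorem level_le_iff {b : GInf q} {k : ℕ} : level b ≤ k ↔ ∀ i, k ≤ i → b.1 i = 1 := by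
  classical
  unfold level
  rw [Nat.find_le_iff]
  constructor
  · rintro ⟨m, hm, h⟩ i hi
    exact h i (hm.trans hi)
  · exact fun h => ⟨k, le_rfl, h⟩

@[simp] theorem level_one : level (1 : GInf q) = 0 :=
  Nat.le_zero.1 (level_le_iff.2 fun _ _ => rfl)

theorem level_eq_zero {b : GInf q} : level b = 0 ↔ b = 1 := by
  constructor
  · intro h
    have := level_le_iff.1 h.le
    exact Subtype.ext (funext fun i => this i (Nat.zero_le i))
  · rintro rfl
    exact level_one

@[simp] theorem level_inv (b : GInf q) : level b⁻¹ = level b := by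
  have key : ∀ b : GInf q, level b⁻¹ ≤ level b := fun b => level_le_iff.2 fun i hi => by
    have := level_le_iff.1 (le_refl (level b)) i hi
    change (b.1 i)⁻¹ = 1
    rw [this, inv_one]
  exact le_antisymm (key b) (by simpa using key b⁻¹)

theorem level_mul_le {b c : GInf q} {k : ℕ} (hb : level b ≤ k) (hc : level c ≤ k) :
    level (b * c) ≤ k :=
  level_le_iff.2 fun i hi => by
    change b.1 i * c.1 i = 1
    rw [level_le_iff.1 hb i hi, level_le_iff.1 hc i hi, one_mul]

/-- The embedding of `G_k` into `G_∞`. -/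
def emb (q k : ℕ) : G q k →* GInf q where
  toFun f := ⟨fun i => if hi : i < k then f ⟨i, hi⟩ else 1, k, fun i hi => by
    simp [Nat.not_lt.2 hi]⟩
  map_one' := by
    apply Subtype.ext
    funext i
    simp
  map_mul' f g := by
    apply Subtype.ext
    funext i
    by_cases hi : i < k <;> simp [hi]

/-- The projection of `G_∞` to the first `k` coordinates. -/
def res (q k : ℕ) : GInf q →* G q k where
  toFun b i := b.1 i
  map_one' := rfl
  map_mul' _ _ := rfl

theorem res_emb (k : ℕ) (f : G q k) : res q k (emb q k f) = f := by
  funext i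
  simp [res, emb]

theorem level_emb_le (k : ℕ) (f : G q k) : level (emb q k f) ≤ k :=
  level_le_iff.2 fun i hi => by simp [emb, Nat.not_lt.2 hi]

theorem emb_res {k : ℕ} {b : GInf q} (h : level b ≤ k) : emb q k (res q k b) = b := by
  apply Subtype.ext
  funext i
  by_cases hi : i < k
  · simp [emb, res, hi]
  · simp [emb, hi, level_le_iff.1 h i (Nat.not_lt.1 hi)]

theorem emb_inclG {j k : ℕ} (h : j ≤ k) (f : G q j) : emb q k (inclG q h f) = emb q j f := by
  apply Subtype.ext
  funext i
  by_cases hi : i < j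
  · simp [emb, inclG, hi, hi.trans_le h]
  · by_cases hk : i < k <;> simp [emb, inclG, hi, hk]

theorem inclG_res {j k : ℕ} (h : j ≤ k) {b : GInf q} (hb : level b ≤ j) :
    inclG q h (res q j b) = res q k b := by
  have := congrArg (res q k) (emb_inclG h (res q j b))
  rwa [res_emb, emb_res hb] at this

/-- The elements of `G_∞` of level at most `k` are the elements of `G_k`. -/
def levelLeEquiv (q k : ℕ) : {b : GInf q // level b ≤ k} ≃ G q k where
  toFun b := res q k b.1
  invFun f := ⟨emb q k f, level_emb_le k f⟩
  left_inv b := Subtype.ext (emb_res b.2)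
  right_inv f := res_emb k f

/-! ### Words -/

/-- The edges at the base vertex of the tree: one towards each of the two sides of the loop, and
the translates by `C_{q-1}` of the edge into the cusp. -/
inductive Dir (q : ℕ) : Type
  | loop (s : Bool) : Dir q
  | cusp (h : Multiplicative (ZMod (q - 1))) : Dir q

instance : MulAction (Multiplicative (ZMod (q - 1))) (Dir q) where
  smul c d := match d with
    | .loop s => .loop s
    | .cusp h => .cusp (c * h)
  one_smul d := by
    cases d with
    | loop s => rfl
    | cusp h => exact congrArg Dir.cusp (one_mul h)
  mul_smul c c' d := by
    cases d with
    | loop s => rfl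
    | cusp h => exact congrArg Dir.cusp (mul_assoc c c' h)

@[simp] theorem smul_loop (c : Multiplicative (ZMod (q - 1))) (s : Bool) :
    c • (Dir.loop s : Dir q) = Dir.loop s := rfl

@[simp] theorem smul_cusp (c h : Multiplicative (ZMod (q - 1))) :
    c • (Dir.cusp h : Dir q) = Dir.cusp (c * h) := rfl

/-- The tree is cut by the translates of the base vertex into pieces that lie over the loop and
pieces that lie over the cusp. `Joined N d d' b` says that the piece which is entered from a base
vertex in the direction `d` has an exit, labelled by `b`, that is seen in the direction `d'` from
the base vertex behind it. -/
def Joined (N : ℕ) : Dir q → Dir q → GInf q → Prop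
  | .loop _, .loop _, b => level b ≤ N
  | .cusp h, .cusp h', _ => h = h'
  | .loop _, .cusp _, _ => False
  | .cusp _, .loop _, _ => False

theorem joined_one (N : ℕ) (d : Dir q) : Joined N d d 1 := by
  cases d with
  | loop s => simp [Joined]
  | cusp h => rfl

theorem Joined.smul {N : ℕ} {d d' : Dir q} {b : GInf q} (h : Joined N d d' b)
    (c : Multiplicative (ZMod (q - 1))) : Joined N (c • d) (c • d') b := by
  cases d <;> cases d' <;> simp_all [Joined]

theorem Joined.mul {N : ℕ} {d d' : Dir q} {b b' : GInf q} (h : Joined N d d b)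
    (h' : Joined N d d' b') : Joined N d d' (b * b') := by
  cases d <;> cases d' <;> simp_all [Joined, level_mul_le]

/-- A geodesic from one base vertex of the tree to the next one, up to the action of the group:
it leaves in the direction `dep`, passes through one piece to the exit with label `elt`, and arrives
from the direction `arr`. -/
@[ext] structure Step (q N : ℕ) where
  dep : Dir q
  arr : Dir q
  elt : GInf q
  joined : Joined N dep arr elt
  ne : ¬ (dep = arr ∧ elt = 1)

variable {N : ℕ}

instance : MulAction (Multiplicative (ZMod (q - 1))) (Step q N) where
  smul c s := ⟨c • s.dep, c • s.arr, s.elt, s.joined.smul c, fun h =>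
    s.ne ⟨smul_left_cancel c h.1, h.2⟩⟩
  one_smul s := Step.ext (one_smul _ s.dep) (one_smul _ s.arr) rfl
  mul_smul c c' s := Step.ext (mul_smul c c' s.dep) (mul_smul c c' s.arr) rfl

@[simp] theorem Step.smul_dep (c : Multiplicative (ZMod (q - 1))) (s : Step q N) :
    (c • s).dep = c • s.dep := rfl
@[simp] theorem Step.smul_arr (c : Multiplicative (ZMod (q - 1))) (s : Step q N) :
    (c • s).arr = c • s.arr := rfl
@[simp] theorem Step.smul_elt (c : Multiplicative (ZMod (q - 1))) (s : Step q N) :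
    (c • s).elt = s.elt := rfl

/-- The base vertices of the tree, encoded by the geodesics that lead to them. -/
def Word (q N : ℕ) : Type :=
  {l : List (Step q N) // l.IsChain (fun s s' => s.arr ≠ s'.dep)}

namespace Word

/-- The empty word. -/
def nil : Word q N := ⟨[], List.isChain_nil⟩

/-- The word is empty or leaves in a direction different from `d`. -/
def Avoids (w : Word q N) (d : Dir q) : Prop := ∀ s ∈ w.1.head?, d ≠ s.dep

theorem nil_avoids (d : Dir q) : (nil : Word q N).Avoids d := by
  rintro s ⟨⟩

/-- The word with first step `s` and remainder `w`. -/
def cons (s : Step q N) (w : Word q N) (h : w.Avoids s.arr) : Word q N :=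
  ⟨s :: w.1, List.isChain_cons.2 ⟨h, w.2⟩⟩

theorem cons_avoids {s : Step q N} {w : Word q N} {h : w.Avoids s.arr} {d : Dir q} :
    (cons s w h).Avoids d ↔ d ≠ s.dep :=
  ⟨fun h' => h' s rfl, fun h' s' hs' => by
    obtain rfl : s = s' := by simpa [cons] using hs'
    exact h'⟩

theorem cons_inj {s s' : Step q N} {w w' : Word q N} {h : w.Avoids s.arr} {h' : w'.Avoids s'.arr} :
    cons s w h = cons s' w' h' ↔ s = s' ∧ w = w' := by
  constructor
  · intro e
    have := congrArg Subtype.val e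
    simp only [cons, List.cons.injEq] at this
    exact ⟨this.1, Subtype.ext this.2⟩
  · rintro ⟨rfl, rfl⟩
    rfl

theorem cons_ne_nil {s : Step q N} {w : Word q N} {h : w.Avoids s.arr} : cons s w h ≠ nil := by
  intro e
  have := congrArg Subtype.val e
  simp [cons, nil] at this

theorem nil_or_cons (w : Word q N) : w = nil ∨ ∃ s r h, w = cons s r h := by
  obtain ⟨l, hl⟩ := w
  cases l with
  | nil => exact Or.inl rfl
  | cons s l =>
    rw [List.isChain_cons] at hl
    exact Or.inr ⟨s, ⟨l, hl.2⟩, hl.1, rfl⟩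

theorem induction {P : Word q N → Prop} (h0 : P nil)
    (h1 : ∀ s r h, P r → P (cons s r h)) (w : Word q N) : P w := by
  obtain ⟨l, hl⟩ := w
  induction l with
  | nil => exact h0
  | cons s l ih =>
    have hl' := List.isChain_cons.1 hl
    exact h1 s ⟨l, hl'.2⟩ hl'.1 (ih hl'.2)

instance : MulAction (Multiplicative (ZMod (q - 1))) (Word q N) where
  smul c w := ⟨w.1.map (c • ·), by
    rw [List.isChain_map]
    exact w.2.imp fun s s' h e => h (smul_left_cancel c e)⟩
  one_smul w := Subtype.ext (by
    change List.map _ _ = _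
    simp)
  mul_smul c c' w := Subtype.ext (by
    change List.map _ _ = List.map _ (List.map _ _)
    simp [mul_smul, Function.comp_def])

theorem smul_val (c : Multiplicative (ZMod (q - 1))) (w : Word q N) :
    (c • w).1 = w.1.map (c • ·) := rfl

@[simp] theorem smul_nil (c : Multiplicative (ZMod (q - 1))) : c • (nil : Word q N) = nil := rfl

theorem Avoids.smul {w : Word q N} {d : Dir q} (h : w.Avoids d)
    (c : Multiplicative (ZMod (q - 1))) : (c • w).Avoids (c • d) := by
  intro s hs
  rw [smul_val, List.head?_map] at hs
  obtain ⟨s', hs', rfl⟩ := Option.map_eq_some_iff.1 hs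
  exact fun e => h s' hs' (smul_left_cancel c e)

theorem smul_cons (c : Multiplicative (ZMod (q - 1))) (s : Step q N) (w : Word q N)
    (h : w.Avoids s.arr) : c • cons s w h = cons (c • s) (c • w) (h.smul c) := rfl

end Word

/-- A base vertex of the tree as seen from the piece in direction `d`: the exit of the piece behind
which it lies (with label `elt`, seen from behind in the direction `arr`) and the remaining word.
The entrance of the piece itself is the exit with label `1` and direction `d`. -/
@[ext] structure Frame (q N : ℕ) (d : Dir q) where
  elt : GInf q
  arr : Dir q
  rest : Word q N
  joined : Joined N d arr elt
  avoids : rest.Avoids arr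

open Classical in
/-- The word of a frame. -/
def Frame.glue {d : Dir q} (x : Frame q N d) : Word q N :=
  if h : d = x.arr ∧ x.elt = 1 then x.rest
  else .cons ⟨d, x.arr, x.elt, x.joined, h⟩ x.rest x.avoids

open Classical in
/-- The frame of a word in a given direction. -/
def Word.frame (d : Dir q) (w : Word q N) : Frame q N d :=
  if h : ∃ s r, ∃ hr : r.Avoids s.arr, w = Word.cons s r hr ∧ s.dep = d then
    ⟨h.choose.elt, h.choose.arr, h.choose_spec.choose,
      (congrArg (fun d' => Joined N d' h.choose.arr h.choose.elt)
        h.choose_spec.choose_spec.choose_spec.2).mp h.choose.joined,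
      h.choose_spec.choose_spec.choose⟩
  else ⟨1, d, w, joined_one N d, fun s hs e => h (by
    rcases w.nil_or_cons with rfl | ⟨s', r, hr, rfl⟩
    · cases hs
    · obtain rfl : s' = s := by simpa [Word.cons] using hs
      exact ⟨s', r, hr, rfl, e.symm⟩)⟩

theorem Word.frame_cons (s : Step q N) (r : Word q N) (h : r.Avoids s.arr) :
    (Word.cons s r h).frame s.dep = ⟨s.elt, s.arr, r, s.joined, h⟩ := by
  have hex : ∃ s' r', ∃ hr : r'.Avoids s'.arr,
      Word.cons s r h = Word.cons s' r' hr ∧ s'.dep = s.dep := ⟨s, r, h, rfl, rfl⟩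
  unfold Word.frame
  rw [dif_pos hex]
  have := hex.choose_spec.choose_spec.choose_spec.1
  rw [Word.cons_inj] at this
  refine Frame.ext ?_ ?_ ?_
  · exact congrArg Step.elt this.1.symm
  · exact congrArg Step.arr this.1.symm
  · exact this.2.symm

theorem Word.frame_of_avoids {d : Dir q} {w : Word q N} (h : w.Avoids d) :
    w.frame d = ⟨1, d, w, joined_one N d, h⟩ := by
  unfold Word.frame
  rw [dif_neg]
  rintro ⟨s, r, hr, rfl, rfl⟩
  exact Word.cons_avoids.1 h rfl

theorem Frame.glue_of_eq {d : Dir q} {x : Frame q N d} (h : d = x.arr ∧ x.elt = 1) :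
    x.glue = x.rest := dif_pos h

theorem Frame.glue_of_ne {d : Dir q} {x : Frame q N d} (h : ¬ (d = x.arr ∧ x.elt = 1)) :
    x.glue = .cons ⟨d, x.arr, x.elt, x.joined, h⟩ x.rest x.avoids := dif_neg h

/-- Words correspond to frames. -/
def frameEquiv (q N : ℕ) (d : Dir q) : Word q N ≃ Frame q N d where
  toFun w := w.frame d
  invFun x := x.glue
  left_inv w := by
    change (w.frame d).glue = w
    by_cases h : w.Avoids d
    · rw [Word.frame_of_avoids h, Frame.glue_of_eq ⟨rfl, rfl⟩]
    · rcases w.nil_or_cons with rfl | ⟨s, r, hr, rfl⟩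
      · exact absurd (Word.nil_avoids d) h
      · rw [Word.cons_avoids, not_not] at h
        subst h
        rw [Word.frame_cons, Frame.glue_of_ne s.ne]
  right_inv x := by
    change x.glue.frame d = x
    by_cases h : d = x.arr ∧ x.elt = 1
    · rw [Frame.glue_of_eq h]
      have ha : x.rest.Avoids d := by
        have := x.avoids
        rwa [← h.1] at this
      rw [Word.frame_of_avoids ha]
      exact Frame.ext h.2.symm h.1 rfl
    · rw [Frame.glue_of_ne h]
      exact Word.frame_cons _ _ _

@[simp] theorem Frame.frame_glue {d : Dir q} (x : Frame q N d) : x.glue.frame d = x :=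
  (frameEquiv q N d).right_inv x

@[simp] theorem Word.glue_frame (d : Dir q) (w : Word q N) : (w.frame d).glue = w :=
  (frameEquiv q N d).left_inv w

/-! ### The action of the generators on words -/

/-- Frames are permuted by changing the labels of all exits. -/
def Frame.mulLeft {d : Dir q} (b : GInf q) (hb : Joined N d d b) (x : Frame q N d) :
    Frame q N d :=
  ⟨b * x.elt, x.arr, x.rest, hb.mul x.joined, x.avoids⟩

/-- A homomorphism to `G_∞` whose values are labels in the piece of direction `d` acts on the words
by permuting the exits of that piece. -/
def labelPerm (d : Dir q) (f : GInf q →* GInf q) (hf : ∀ b, Joined N d d (f b)) :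
    GInf q →* Equiv.Perm (Word q N) :=
  MonoidHom.mk' (fun b =>
    ((frameEquiv q N d).trans
      { toFun := Frame.mulLeft (f b) (hf b)
        invFun := Frame.mulLeft (f b⁻¹) (hf b⁻¹)
        left_inv := fun x => Frame.ext (by simp [Frame.mulLeft]) rfl rfl
        right_inv := fun x => Frame.ext (by simp [Frame.mulLeft]) rfl rfl }).trans
      (frameEquiv q N d).symm) (by
    intro b b'
    ext w : 1
    change (Frame.mulLeft (f (b * b')) (hf _) (w.frame d)).glue =
      (Frame.mulLeft (f b) (hf _) ((Frame.mulLeft (f b') (hf _) (w.frame d)).glue.frame d)).glue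
    rw [Frame.frame_glue]
    congr 1
    exact Frame.ext (by simp [Frame.mulLeft, mul_assoc]) rfl rfl)

theorem Joined.change_side {s s' : Bool} {d : Dir q} {b : GInf q}
    (h : Joined N (.loop s) d b) : Joined N (.loop s') d b := by
  cases d <;> exact h

/-- A frame of the loop piece, as seen from the other entrance. -/
def Frame.changeSide {s : Bool} (s' : Bool) (x : Frame q N (.loop s)) : Frame q N (.loop s') :=
  ⟨x.elt, x.arr, x.rest, x.joined.change_side, x.avoids⟩

/-- The loop moves the upper entrance of a piece to the lower one. -/
def loopPerm (q N : ℕ) : Equiv.Perm (Word q N) :=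
  ((frameEquiv q N (.loop true)).trans
    { toFun := Frame.changeSide false
      invFun := Frame.changeSide true
      left_inv := fun _ => rfl
      right_inv := fun _ => rfl }).trans (frameEquiv q N (.loop false)).symm

theorem loopPerm_apply (w : Word q N) :
    loopPerm q N w = ((w.frame (.loop true)).changeSide false).glue := rfl

theorem loopPerm_inv_apply (w : Word q N) :
    (loopPerm q N)⁻¹ w = ((w.frame (.loop false)).changeSide true).glue := rfl

/-- The action of `C_{q-1}` on the words. -/
def basePerm (q N : ℕ) : Multiplicative (ZMod (q - 1)) →* Equiv.Perm (Word q N) :=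
  MulAction.toPermHom _ _

theorem basePerm_apply (c : Multiplicative (ZMod (q - 1))) (w : Word q N) :
    basePerm q N c w = c • w := rfl

/-- Truncation of the labels to `G_N`. -/
def trunc (q N : ℕ) : GInf q →* GInf q := (emb q N).comp (res q N)

theorem trunc_of_level_le {b : GInf q} (h : level b ≤ N) : trunc q N b = b := emb_res h

theorem joined_trunc (s s' : Bool) (b : GInf q) :
    Joined N (.loop s) (.loop s') (trunc q N b) := level_emb_le N _

/-- The action of `G_N` on the words by the labels of the exits of the loop piece. -/
def upperPerm (q N : ℕ) : GInf q →* Equiv.Perm (Word q N) :=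
  labelPerm (.loop false) (trunc q N) (joined_trunc _ _)

theorem upperPerm_apply (b : GInf q) (w : Word q N) :
    upperPerm q N b w =
      ((w.frame (.loop false)).mulLeft (trunc q N b) (joined_trunc _ _ b)).glue := rfl

theorem joined_cusp (h : Multiplicative (ZMod (q - 1))) (b : GInf q) :
    Joined N (.cusp h) (.cusp h) b := rfl

/-- The action of `G_∞` on the words by the labels of the exits of the cusp. -/
def cuspPerm (q N : ℕ) : GInf q →* Equiv.Perm (Word q N) :=
  labelPerm (.cusp 1) (MonoidHom.id _) (joined_cusp 1)

theorem cuspPerm_apply (b : GInf q) (w : Word q N) :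
    cuspPerm q N b w = ((w.frame (.cusp 1)).mulLeft b (joined_cusp 1 b)).glue := rfl

/-- The frame with the action of `C_{q-1}`. -/
def Frame.baseSMul {d : Dir q} (c : Multiplicative (ZMod (q - 1))) (x : Frame q N d) :
    Frame q N (c • d) :=
  ⟨x.elt, c • x.arr, c • x.rest, x.joined.smul c, x.avoids.smul c⟩

theorem Word.smul_glue {d : Dir q} (c : Multiplicative (ZMod (q - 1))) (x : Frame q N d) :
    c • x.glue = (x.baseSMul c).glue := by
  by_cases h : d = x.arr ∧ x.elt = 1
  · rw [Frame.glue_of_eq h, Frame.glue_of_eq (x := x.baseSMul c) ⟨congrArg (c • ·) h.1, h.2⟩]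
    rfl
  · rw [Frame.glue_of_ne h, Frame.glue_of_ne (x := x.baseSMul c)
      fun h' => h ⟨smul_left_cancel c h'.1, h'.2⟩]
    rfl

theorem Word.frame_smul (d : Dir q) (c : Multiplicative (ZMod (q - 1))) (w : Word q N) :
    (c • w).frame (c • d) = (w.frame d).baseSMul c := by
  conv_lhs => rw [← Word.glue_frame d w, Word.smul_glue, Frame.frame_glue]

theorem Word.frame_smul_loop (s : Bool) (c : Multiplicative (ZMod (q - 1))) (w : Word q N) :
    (c • w).frame (.loop s) = (w.frame (.loop s)).baseSMul c :=
  Word.frame_smul (.loop s) c w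

theorem commute_basePerm_loopPerm (c : Multiplicative (ZMod (q - 1))) :
    Commute (basePerm q N c) (loopPerm q N) := by
  ext w : 1
  change c • loopPerm q N w = loopPerm q N (c • w)
  rw [loopPerm_apply, loopPerm_apply, Word.frame_smul_loop, Word.smul_glue]
  rfl

theorem commute_basePerm_upperPerm (c : Multiplicative (ZMod (q - 1))) (b : GInf q) :
    Commute (basePerm q N c) (upperPerm q N b) := by
  ext w : 1
  change c • upperPerm q N b w = upperPerm q N b (c • w)
  rw [upperPerm_apply, upperPerm_apply, Word.frame_smul_loop, Word.smul_glue]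
  rfl

end LoopWithCusp

/-! ### The tree and the group acting on it -/

namespace LoopWithCusp

/-- The direction of the other side of the loop. -/
def Dir.flip {q : ℕ} : Dir q → Dir q
  | .loop s => .loop (!s)
  | .cusp h => .cusp h

/-- The rays along the two sides of the loop have length `N`, the cusp is infinite. -/
def Dir.HasLevel {q : ℕ} (N k : ℕ) : Dir q → Prop
  | .loop _ => k ≤ N
  | .cusp _ => True

variable {q N : ℕ} {Γ V : Type} [Group Γ] [MulAction Γ V]

/-- The element that carries the ray in direction `d` to a fundamental domain: the two sides of the
loop are joined after a translation by the loop element `t`, and the cusps at the base vertex are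
conjugated to the standard one. -/
def frameElt (κ : Multiplicative (ZMod (q - 1)) →* Γ) (t : Γ) : Dir q → Γ
  | .loop false => 1
  | .loop true => t
  | .cusp h => (κ h)⁻¹

/-- The group that permutes the exits of the piece in direction `d`. -/
def labelHom (α β : GInf q →* Γ) : Dir q → (GInf q →* Γ)
  | .loop _ => α
  | .cusp _ => β

open Classical in
/-- The neighbour of the vertex of level `k` on the ray in direction `d` that is further away from
the base. -/
def upPoint (N : ℕ) (κ : Multiplicative (ZMod (q - 1)) →* Γ) (t : Γ) (pt : Dir q → ℕ → V)
    (d : Dir q) (k : ℕ) : V :=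
  if d.HasLevel N (k + 1) then pt d (k + 1)
  else ((frameElt κ t d)⁻¹ * frameElt κ t d.flip) • pt d.flip N

/-- A group acting on a graph like the fundamental group of the graph of groups `X_N` on its
universal covering tree. The vertices `pt d k` form rays that start at `base` and lie over the two
sides of the loop and over the cusp; `κ` is the group of the base vertex, `α` and `β` are the groups
of the top of the loop and of the cusp, `t` is the loop. The homomorphism `φ` to the permutations of
words is what the universal property of the fundamental group provides. -/
structure LoopCuspTree (q N : ℕ) (Γ V : Type) [Group Γ] [MulAction Γ V]
    (𝒯 : SimpleGraph V) where
  two_le : 2 ≤ q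
  one_le : 1 ≤ N
  κ : Multiplicative (ZMod (q - 1)) →* Γ
  α : GInf q →* Γ
  β : GInf q →* Γ
  t : Γ
  commute_α : ∀ c b, Commute (κ c) (α b)
  commute_t : ∀ c, Commute (κ c) t
  α_trunc : ∀ b, α (trunc q N b) = α b
  closure_eq_top : Subgroup.closure
    (Set.range κ ∪ Set.range α ∪ Set.range β ∪ {t}) = ⊤
  φ : Γ →* Equiv.Perm (Word q N)
  φ_κ : ∀ c, φ (κ c) = basePerm q N c
  φ_α : ∀ b, φ (α b) = upperPerm q N b
  φ_β : ∀ b, φ (β b) = cuspPerm q N b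
  φ_t : φ t = loopPerm q N
  base : V
  pt : Dir q → ℕ → V
  pt_zero : ∀ d, pt d 0 = base
  κ_smul_pt : ∀ c d k, κ c • pt d k = pt (c • d) k
  exists_eq_smul_pt : ∀ v, ∃ (γ : Γ) (d : Dir q) (k : ℕ), d.HasLevel N k ∧ v = γ • pt d k
  smul_base : ∀ γ : Γ, γ • base = base → ∃ c, γ = κ c
  smul_pt : ∀ (γ : Γ) (d : Dir q) (k : ℕ), d.HasLevel N (k + 1) →
    (γ • pt d (k + 1) = pt d (k + 1) ↔ ∃ b c, level b ≤ k + 1 ∧ c • d = d ∧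
      γ = (frameElt κ t d)⁻¹ * labelHom α β d b * frameElt κ t d * κ c)
  type_eq : ∀ (γ : Γ) (d d' : Dir q) (k k' : ℕ), d.HasLevel N k → d'.HasLevel N k' →
    γ • pt d k = pt d' k' → k = k' ∧ (k = 0 ∨ ∃ c : Multiplicative (ZMod (q - 1)), d' = c • d)
  adj_iff : ∀ x y, 𝒯.Adj x y ↔ ∃ (γ : Γ) (d : Dir q) (k : ℕ), d.HasLevel N k ∧
    ((x = γ • pt d k ∧ y = γ • upPoint N κ t pt d k) ∨
      (y = γ • pt d k ∧ x = γ • upPoint N κ t pt d k))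

theorem Dir.HasLevel.mono {d : Dir q} {k l : ℕ} (h : d.HasLevel N l) (hkl : k ≤ l) :
    d.HasLevel N k := by
  cases d with
  | loop s => exact hkl.trans h
  | cusp h => trivial

theorem Dir.HasLevel.smul {d : Dir q} {k : ℕ} (h : d.HasLevel N k)
    (c : Multiplicative (ZMod (q - 1))) : (c • d).HasLevel N k := by
  cases d <;> exact h

theorem exists_level_eq (hq : 2 ≤ q) (k : ℕ) : ∃ b : GInf q, level b = k := by
  have : Fact (1 < q) := ⟨hq⟩
  cases k with
  | zero => exact ⟨1, level_one⟩
  | succ k =>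
    let f : G q (k + 1) := fun i => if (i : ℕ) = k then Multiplicative.ofAdd 1 else 1
    refine ⟨emb q (k + 1) f, le_antisymm (level_emb_le _ _) ?_⟩
    by_contra hlt
    have := level_le_iff.1 (Nat.lt_succ_iff.1 (not_le.1 hlt)) k le_rfl
    have h1 : (Multiplicative.ofAdd (1 : ZMod q)) = 1 := by
      simp [emb, f] at this
    rw [ofAdd_eq_one] at h1
    exact one_ne_zero h1

namespace LoopCuspTree

variable {𝒯 : SimpleGraph V} (M : LoopCuspTree q N Γ V 𝒯)

/-- The frame element of a direction. -/
abbrev e (d : Dir q) : Γ := frameElt M.κ M.t d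

/-- The group of labels of the piece in direction `d`. -/
abbrev lab (d : Dir q) : GInf q →* Γ := labelHom M.α M.β d

/-- The neighbour of `pt d k` away from the base. -/
abbrev up (d : Dir q) (k : ℕ) : V := upPoint N M.κ M.t M.pt d k

include M in
theorem adj_smul (g : Γ) (x y : V) (h : 𝒯.Adj x y) : 𝒯.Adj (g • x) (g • y) := by
  rw [M.adj_iff] at h ⊢
  obtain ⟨γ, d, k, hk, h⟩ := h
  refine ⟨g * γ, d, k, hk, ?_⟩
  rcases h with ⟨rfl, rfl⟩ | ⟨rfl, rfl⟩
  · exact Or.inl ⟨(mul_smul _ _ _).symm, (mul_smul _ _ _).symm⟩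
  · exact Or.inr ⟨(mul_smul _ _ _).symm, (mul_smul _ _ _).symm⟩

/-! ### Normal forms -/

/-- Passing to the frame of a joined direction changes neither the leading group element nor
the arrival and the rest of a word. -/
theorem φ_e_frame {d d' : Dir q} {b : GInf q} (h : Joined N d d' b) (w : Word q N) :
    ((M.φ ((M.e d)⁻¹ * M.e d') w).frame d).elt = (w.frame d').elt ∧
      ((M.φ ((M.e d)⁻¹ * M.e d') w).frame d).arr = (w.frame d').arr ∧
      ((M.φ ((M.e d)⁻¹ * M.e d') w).frame d).rest = (w.frame d').rest := by
  cases d with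
  | loop s =>
    cases d' with
    | loop s' =>
      rw [map_mul, map_inv]
      cases s <;> cases s' <;> simp only [e, frameElt, map_one, inv_one, one_mul, mul_one,
        Equiv.Perm.one_apply, M.φ_t, inv_mul_cancel, loopPerm_apply,
        loopPerm_inv_apply, Frame.frame_glue] <;> refine ⟨?_, ?_, ?_⟩ <;> trivial
    | cusp h' => exact h.elim
  | cusp h =>
    cases d' with
    | loop s => exact h.elim
    | cusp h' =>
      obtain rfl : _ = _ := h
      rw [inv_mul_cancel, map_one]
      exact ⟨rfl, rfl, rfl⟩

/-- The label of an element joining a direction to itself acts on frames by left multiplication. -/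
theorem φ_lab_frame {d : Dir q} {b : GInf q} (h : Joined N d d b) (w : Word q N) :
    (M.φ ((M.e d)⁻¹ * M.lab d b * M.e d) w).frame d = (w.frame d).mulLeft b h := by
  have hloop : ∀ (w : Word q N) (hb : Joined N (.loop false) (.loop false) b),
      (upperPerm q N b w).frame (.loop false) = (w.frame (.loop false)).mulLeft b hb := by
    intro w hb
    rw [upperPerm_apply, Frame.frame_glue]
    refine Frame.ext ?_ rfl rfl
    change trunc q N b * _ = b * _
    rw [trunc_of_level_le hb]
  cases d with
  | loop s =>
    rw [map_mul, map_mul, map_inv]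
    cases s with
    | false =>
      simp only [e, lab, frameElt, labelHom, map_one, inv_one, one_mul, mul_one, M.φ_α]
      exact hloop w h
    | true =>
      simp only [e, lab, frameElt, labelHom, M.φ_α, M.φ_t, Equiv.Perm.mul_apply,
        loopPerm_inv_apply, Frame.frame_glue, loopPerm_apply]
      rw [hloop _ h, Frame.frame_glue]
      rfl
  | cusp h' =>
    simp only [e, lab, frameElt, labelHom, inv_inv, map_mul, map_inv, M.φ_κ, M.φ_β,
      Equiv.Perm.mul_apply]
    have h1 : (Dir.cusp h' : Dir q) = h' • Dir.cusp 1 := by simp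
    have h2 : (Dir.cusp 1 : Dir q) = h'⁻¹ • Dir.cusp h' := by simp
    rw [← map_inv, basePerm_apply, basePerm_apply]
    have e2 := Word.frame_smul (Dir.cusp h') h'⁻¹ w
    rw [cuspPerm_apply]
    refine (frameEquiv q N _).symm.injective ?_
    change ((h' • (Frame.mulLeft _ _ ((h'⁻¹ • w).frame (Dir.cusp 1))).glue).frame _).glue =
      (Frame.mulLeft b h (w.frame (Dir.cusp h'))).glue
    rw [Word.glue_frame]
    have e3 : (Frame.mulLeft b h (w.frame (Dir.cusp h'))).glue =
        h' • h'⁻¹ • (Frame.mulLeft b h (w.frame (Dir.cusp h'))).glue := by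
      rw [smul_inv_smul]
    rw [e3, Word.smul_glue h'⁻¹]
    congr 1
    have key : ∀ (d : Dir q) (hd : d = h'⁻¹ • Dir.cusp h') (hj : Joined N d d b),
        (Frame.mulLeft b hj ((h'⁻¹ • w).frame d)).glue =
          ((Frame.mulLeft b h (w.frame (Dir.cusp h'))).baseSMul h'⁻¹).glue := by
      rintro d rfl hj
      rw [e2]
      rfl
    exact key _ h2 rfl

/-- The group element that moves the base vertex by one step. -/
def stepElt (s : Step q N) : Γ := (M.e s.dep)⁻¹ * M.lab s.dep s.elt * M.e s.arr

/-- The group element that moves the base vertex by a list of steps. -/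
def listElt (l : List (Step q N)) : Γ := (l.map M.stepElt).prod

/-- The group element that moves the base vertex by a word. -/
def elt (w : Word q N) : Γ := M.listElt w.1

@[simp] theorem listElt_nil : M.listElt [] = 1 := rfl

@[simp] theorem listElt_cons (s : Step q N) (l : List (Step q N)) :
    M.listElt (s :: l) = M.stepElt s * M.listElt l := by
  simp [listElt]

theorem listElt_append (l l' : List (Step q N)) :
    M.listElt (l ++ l') = M.listElt l * M.listElt l' := by
  simp [listElt]

@[simp] theorem elt_nil : M.elt Word.nil = 1 := rfl

theorem elt_cons (s : Step q N) (w : Word q N) (h : w.Avoids s.arr) :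
    M.elt (.cons s w h) = M.stepElt s * M.elt w := M.listElt_cons s w.1

theorem Step.joined_dep_of_joined {d d' : Dir q} {b : GInf q} (h : Joined N d d' b) :
    Joined N d d b := by
  cases d <;> cases d' <;> first | exact h.elim | exact h | rfl

theorem φ_stepElt (s : Step q N) (w : Word q N) (h : w.Avoids s.arr) :
    M.φ (M.stepElt s) w = .cons s w h := by
  have hj := Step.joined_dep_of_joined s.joined
  have e1 : M.stepElt s = ((M.e s.dep)⁻¹ * M.lab s.dep s.elt * M.e s.dep) *
      ((M.e s.dep)⁻¹ * M.e s.arr) := by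
    unfold stepElt
    group
  rw [e1, map_mul, Equiv.Perm.mul_apply]
  set w' := M.φ ((M.e s.dep)⁻¹ * M.e s.arr) w with hw'
  obtain ⟨h1, h2, h3⟩ := M.φ_e_frame s.joined w
  rw [Word.frame_of_avoids h, ← hw'] at h1 h2 h3
  have h4 := M.φ_lab_frame hj w'
  rw [← Word.glue_frame s.dep (M.φ _ w'), h4]
  have h5 : Frame.mulLeft s.elt hj (w'.frame s.dep) = ⟨s.elt, s.arr, w, s.joined, h⟩ := by
    refine Frame.ext ?_ h2 h3
    change s.elt * (w'.frame s.dep).elt = s.elt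
    rw [h1, mul_one]
  rw [h5, Frame.glue_of_ne s.ne]

theorem φ_listElt (l : List (Step q N)) (w : Word q N)
    (h : (l ++ w.1).IsChain (fun s s' => s.arr ≠ s'.dep)) :
    M.φ (M.listElt l) w = ⟨l ++ w.1, h⟩ := by
  induction l with
  | nil =>
    rw [listElt_nil, map_one]
    rfl
  | cons s l ih =>
    rw [List.cons_append] at h
    have h2 := List.isChain_cons.1 h
    rw [listElt_cons, map_mul, Equiv.Perm.mul_apply, ih h2.2]
    exact M.φ_stepElt s ⟨_, h2.2⟩ h2.1

theorem φ_elt_nil (w : Word q N) : M.φ (M.elt w) .nil = w := by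
  have := M.φ_listElt w.1 .nil (by rw [Word.nil, List.append_nil]; exact w.2)
  refine this.trans (Subtype.ext ?_)
  exact List.append_nil _

theorem elt_glue {d : Dir q} (x : Frame q N d) :
    M.elt x.glue = (M.e d)⁻¹ * M.lab d x.elt * M.e x.arr * M.elt x.rest := by
  by_cases h : d = x.arr ∧ x.elt = 1
  · rw [Frame.glue_of_eq h, ← h.1, h.2]
    simp
  · rw [Frame.glue_of_ne h, elt_cons]
    rfl

theorem κ_mul_stepElt (c : Multiplicative (ZMod (q - 1))) (s : Step q N) :
    M.κ c * M.stepElt s = M.stepElt (c • s) * M.κ c := by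
  have key : ∀ (d d' : Dir q) (b : GInf q), Joined N d d' b →
      M.κ c * ((M.e d)⁻¹ * M.lab d b * M.e d') =
        (M.e (c • d))⁻¹ * M.lab (c • d) b * M.e (c • d') * M.κ c := by
    intro d d' b h
    have hl : ∀ s, Commute (M.κ c) (M.e (.loop s)) := by
      intro s
      cases s
      · exact Commute.one_right _
      · exact M.commute_t c
    cases d with
    | loop s =>
      cases d' with
      | loop s' =>
        have h3 : Commute (M.κ c) ((M.e (.loop s))⁻¹ * M.α b * M.e (.loop s')) :=
          (((hl s).inv_right).mul_right (M.commute_α c b)).mul_right (hl s')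
        exact h3.eq
      | cusp h' => exact h.elim
    | cusp h' =>
      cases d' with
      | loop s => exact h.elim
      | cusp h'' =>
        simp only [e, lab, frameElt, labelHom, smul_cusp, map_mul]
        group
  exact key _ _ _ s.joined

theorem κ_mul_elt (c : Multiplicative (ZMod (q - 1))) (w : Word q N) :
    M.κ c * M.elt w = M.elt (c • w) * M.κ c := by
  induction w using Word.induction with
  | h0 => simp
  | h1 s r h ih =>
    rw [Word.smul_cons, elt_cons, elt_cons, ← mul_assoc, κ_mul_stepElt, mul_assoc, ih, mul_assoc]

/-- Every element is the product of the element of a word and an element of the group of the base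
vertex. -/
theorem exists_mul_elt (γ : Γ) (w : Word q N) :
    ∃ c, γ * M.elt w = M.elt (M.φ γ w) * M.κ c := by
  have hγ : γ ∈ Subgroup.closure (Set.range M.κ ∪ Set.range M.α ∪ Set.range M.β ∪ {M.t}) := by
    rw [M.closure_eq_top]
    trivial
  induction hγ using Subgroup.closure_induction generalizing w with
  | mem x hx =>
    rcases hx with ((⟨c, rfl⟩ | ⟨b, rfl⟩) | ⟨b, rfl⟩) | rfl
    · exact ⟨c, by rw [M.φ_κ, basePerm_apply, κ_mul_elt]⟩
    · refine ⟨1, ?_⟩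
      rw [M.φ_α]
      rw [upperPerm_apply, elt_glue, map_one, mul_one]
      conv_lhs => rw [← Word.glue_frame (.loop false) w, elt_glue]
      simp only [Frame.mulLeft, e, lab, frameElt, labelHom, map_mul, M.α_trunc]
      group
    · refine ⟨1, ?_⟩
      rw [M.φ_β]
      rw [cuspPerm_apply, elt_glue, map_one, mul_one]
      conv_lhs => rw [← Word.glue_frame (.cusp 1) w, elt_glue]
      simp only [Frame.mulLeft, e, lab, frameElt, labelHom, map_mul, map_one]
      group
    · refine ⟨1, ?_⟩
      rw [M.φ_t, loopPerm_apply, elt_glue, map_one, mul_one]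
      conv_lhs => rw [← Word.glue_frame (.loop true) w, elt_glue]
      simp only [Frame.changeSide, e, lab, frameElt, labelHom]
      group
  | one => exact ⟨1, by simp⟩
  | mul x y _ _ hx hy =>
    obtain ⟨c, hc⟩ := hy w
    obtain ⟨c', hc'⟩ := hx (M.φ y w)
    refine ⟨c' * c, ?_⟩
    rw [mul_assoc, hc, ← mul_assoc, hc', map_mul, map_mul, Equiv.Perm.mul_apply, mul_assoc]
  | inv x _ hx =>
    obtain ⟨c, hc⟩ := hx (M.φ x⁻¹ w)
    refine ⟨c⁻¹, ?_⟩
    rw [← Equiv.Perm.mul_apply, ← map_mul, mul_inv_cancel, map_one, Equiv.Perm.one_apply] at hc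
    rw [inv_mul_eq_iff_eq_mul, ← mul_assoc, hc, mul_assoc, ← map_mul M.κ, mul_inv_cancel, map_one,
      mul_one]

/-- The word of a group element: the word that leads from the base vertex to its image. -/
def word (γ : Γ) : Word q N := M.φ γ .nil

theorem exists_eq_elt_mul (γ : Γ) : ∃ c, γ = M.elt (M.word γ) * M.κ c := by
  obtain ⟨c, hc⟩ := M.exists_mul_elt γ .nil
  exact ⟨c, by rwa [elt_nil, mul_one] at hc⟩

theorem word_elt_mul (w : Word q N) (c : Multiplicative (ZMod (q - 1))) :
    M.word (M.elt w * M.κ c) = w := by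
  unfold word
  rw [map_mul, Equiv.Perm.mul_apply, M.φ_κ, basePerm_apply, Word.smul_nil, φ_elt_nil]

theorem κ_smul_base (c : Multiplicative (ZMod (q - 1))) : M.κ c • M.base = M.base := by
  have := M.κ_smul_pt c (.loop false) 0
  rwa [M.pt_zero, M.pt_zero] at this

theorem κ_injective : Function.Injective M.κ := by
  rw [injective_iff_map_eq_one]
  intro c hc
  obtain ⟨b, hb⟩ := exists_level_eq M.two_le 1
  have hb1 : b ≠ 1 := by
    rintro rfl
    simp at hb
  let s : Step q N := ⟨.cusp 1, .cusp 1, b, rfl, fun h => hb1 h.2⟩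
  have h1 : M.φ (M.κ c) (.cons s .nil (Word.nil_avoids _)) =
      .cons s .nil (Word.nil_avoids _) := by
    rw [hc, map_one, Equiv.Perm.one_apply]
  rw [M.φ_κ, basePerm_apply, Word.smul_cons, Word.cons_inj] at h1
  have h2 := congrArg Step.dep h1.1
  simpa [s] using h2

theorem smul_base_eq_iff {γ γ' : Γ} : γ • M.base = γ' • M.base ↔ M.word γ = M.word γ' := by
  constructor
  · intro h
    have h1 : (γ'⁻¹ * γ) • M.base = M.base := by rw [mul_smul, h, inv_smul_smul]
    obtain ⟨c, hc⟩ := M.smul_base _ h1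
    rw [inv_mul_eq_iff_eq_mul] at hc
    unfold word
    rw [hc, map_mul, Equiv.Perm.mul_apply, M.φ_κ, basePerm_apply, Word.smul_nil]
  · intro h
    obtain ⟨c, hc⟩ := M.exists_eq_elt_mul γ
    obtain ⟨c', hc'⟩ := M.exists_eq_elt_mul γ'
    rw [hc, hc', h, mul_smul, mul_smul, κ_smul_base, κ_smul_base]

theorem smul_base_eq (γ : Γ) : γ • M.base = M.elt (M.word γ) • M.base := by
  rw [smul_base_eq_iff]
  have := M.word_elt_mul (M.word γ) 1
  rw [map_one, mul_one] at this
  exact this.symm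

end LoopCuspTree

end LoopWithCusp

/-! ### The graph is a tree -/

/-- A graph is acyclic if every directed edge has a set, its "half-space", such that the half-spaces
strictly decrease along walks without backtracking. -/
theorem SimpleGraph.isAcyclic_of_halfSpaces {V W : Type} {G : SimpleGraph V}
    (U : V → V → Set W)
    (hU : ∀ x y z, G.Adj x y → G.Adj y z → x ≠ z → U y z ⊂ U x y) : G.IsAcyclic := by
  intro v c hc
  have h3 := hc.three_le_length
  have key : ∀ i, i + 1 < c.length →
      U (c.getVert (i + 1)) (c.getVert (i + 2)) ⊂ U (c.getVert i) (c.getVert (i + 1)) := by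
    intro i hi
    refine hU _ _ _ (c.adj_getVert_succ (by omega)) (c.adj_getVert_succ (by omega)) ?_
    exact fun e => by
      rcases Nat.eq_zero_or_pos i with rfl | hpos
      · rw [c.getVert_zero] at e
        have := hc.getVert_injOn (x₁ := 2) (x₂ := c.length) ⟨by omega, by omega⟩
          ⟨by omega, by omega⟩ (by rw [c.getVert_length]; exact e.symm)
        omega
      · have := hc.getVert_injOn (x₁ := i) (x₂ := i + 2) ⟨by omega, by omega⟩
          ⟨by omega, by omega⟩ e
        omega
  have chain : ∀ i, i + 1 < c.length →
      U (c.getVert (i + 1)) (c.getVert (i + 2)) ⊂ U (c.getVert 0) (c.getVert 1) := by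
    intro i
    induction i with
    | zero => exact fun h => key 0 h
    | succ i ih => exact fun h => (key (i + 1) h).trans (ih (by omega))
  obtain ⟨n, hn⟩ : ∃ n, c.length = n + 2 := ⟨c.length - 2, by omega⟩
  have h1 := chain n (by omega)
  have e2 : c.getVert (n + 2) = v := by rw [← hn, c.getVert_length]
  have adj1 := c.adj_getVert_succ (i := n + 1) (by omega)
  have adj2 := c.adj_getVert_succ (i := 0) (by omega)
  rw [e2] at adj1 h1
  rw [c.getVert_zero] at adj2 h1
  have h2 := hU _ _ _ adj1 adj2 (fun e => by
    have := hc.getVert_injOn (x₁ := n + 1) (x₂ := 1) ⟨by omega, by omega⟩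
      ⟨by omega, by omega⟩ e
    omega)
  exact (h1.trans h2).false

namespace LoopWithCusp

namespace LoopCuspTree

variable {q N : ℕ} {Γ V : Type} [Group Γ] [MulAction Γ V] {𝒯 : SimpleGraph V}
  (M : LoopCuspTree q N Γ V 𝒯)

/-- The words of the base vertices that are separated from `up d k` by `pt d k`. -/
def lower (d : Dir q) (k : ℕ) : Set (Word q N) :=
  {w | (w.frame d).arr = d ∧ level (w.frame d).elt ≤ k}

/-- The half-space of the edge from `y` to its neighbour `x`. -/
inductive Outward : V → V → Set (Word q N) → Prop
  | up (γ : Γ) (d : Dir q) (k : ℕ) (h : d.HasLevel N k) :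
      Outward (γ • M.pt d k) (γ • M.up d k) {w | M.φ γ⁻¹ w ∉ lower d k}
  | down (γ : Γ) (d : Dir q) (k : ℕ) (h : d.HasLevel N (k + 1)) :
      Outward (γ • M.pt d (k + 1)) (γ • M.pt d k) {w | M.φ γ⁻¹ w ∈ lower d k}

theorem up_of_hasLevel {d : Dir q} {k : ℕ} (h : d.HasLevel N (k + 1)) :
    M.up d k = M.pt d (k + 1) := if_pos h

theorem up_of_not_hasLevel {d : Dir q} {k : ℕ} (h : ¬ d.HasLevel N (k + 1)) :
    M.up d k = ((M.e d)⁻¹ * M.e d.flip) • M.pt d.flip N := if_neg h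

theorem not_hasLevel_iff {d : Dir q} {k : ℕ} (hk : d.HasLevel N k) :
    ¬ d.HasLevel N (k + 1) ↔ k = N ∧ ∃ s, d = .loop s := by
  cases d with
  | loop s =>
    simp only [Dir.HasLevel] at *
    constructor
    · exact fun h => ⟨by omega, s, rfl⟩
    · rintro ⟨rfl, -⟩
      omega
  | cusp h => simp [Dir.HasLevel]

/-- At the top of the loop the lower half-spaces of the two sides are complementary. -/
theorem mem_lower_flip (s : Bool) (w : Word q N) :
    M.φ ((M.e (.loop s))⁻¹ * M.e (.loop (!s))) w ∈ lower (.loop s) N ↔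
      w ∉ lower (.loop (!s)) N := by
  obtain ⟨h1, h2, -⟩ := M.φ_e_frame (d := .loop s) (d' := .loop (!s)) (b := 1)
    (by simp [Joined]) w
  have hj := (w.frame (.loop (!s))).joined
  unfold lower
  rw [Set.mem_ofPred_eq, Set.mem_ofPred_eq, h1, h2]
  revert hj
  generalize (w.frame (.loop (!s))).arr = a
  generalize (w.frame (.loop (!s))).elt = b
  intro hj
  cases a with
  | loop s' =>
    have : level b ≤ N := hj
    cases s <;> cases s' <;> simp [this]
  | cusp h => exact hj.elim

theorem exists_outward_of_adj {x y : V} (h : 𝒯.Adj x y) : ∃ S, M.Outward x y S := by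
  rw [M.adj_iff] at h
  obtain ⟨γ, d, k, hk, ⟨rfl, rfl⟩ | ⟨rfl, rfl⟩⟩ := h
  · exact ⟨_, .up γ d k hk⟩
  · by_cases h : d.HasLevel N (k + 1)
    · change ∃ S, M.Outward (γ • M.up d k) _ S
      rw [M.up_of_hasLevel h]
      exact ⟨_, .down γ d k h⟩
    · change ∃ S, M.Outward (γ • M.up d k) _ S
      rw [M.up_of_not_hasLevel h]
      obtain ⟨rfl, s, rfl⟩ := (not_hasLevel_iff hk).1 h
      have := Outward.up (M := M) (γ * ((M.e (.loop s))⁻¹ * M.e (.loop (!s)))) (.loop (!s)) k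
        (le_refl k)
      rw [M.up_of_not_hasLevel (by simp [Dir.HasLevel])] at this
      simp only [Dir.flip, Bool.not_not, ← mul_smul] at this ⊢
      have e2 : γ * ((M.e (.loop s))⁻¹ * M.e (.loop (!s))) *
          ((M.e (.loop (!s)))⁻¹ * M.e (.loop s)) = γ := by group
      rw [e2] at this
      exact ⟨_, this⟩

theorem Outward.symm {x y : V} {S : Set (Word q N)} (h : M.Outward x y S) :
    M.Outward y x Sᶜ := by
  cases h with
  | up γ d k hk =>
    by_cases h : d.HasLevel N (k + 1)
    · rw [M.up_of_hasLevel h]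
      have := Outward.down (M := M) γ d k h
      convert this using 1
      ext w
      simp
    · rw [M.up_of_not_hasLevel h]
      obtain ⟨rfl, s, rfl⟩ := (not_hasLevel_iff hk).1 h
      have := Outward.up (M := M) (γ * ((M.e (.loop s))⁻¹ * M.e (.loop (!s)))) (.loop (!s)) k
        (le_refl k)
      rw [M.up_of_not_hasLevel (by simp [Dir.HasLevel])] at this
      simp only [Dir.flip, Bool.not_not, ← mul_smul] at this ⊢
      have e2 : γ * ((M.e (.loop s))⁻¹ * M.e (.loop (!s))) *
          ((M.e (.loop (!s)))⁻¹ * M.e (.loop s)) = γ := by group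
      rw [e2] at this
      convert this using 1
      ext w
      have h3 := M.mem_lower_flip s
        (M.φ (γ * ((M.e (.loop s))⁻¹ * M.e (.loop (!s))))⁻¹ w)
      rw [← Equiv.Perm.mul_apply, ← map_mul] at h3
      have e3 : (M.e (.loop s))⁻¹ * M.e (.loop (!s)) *
          (γ * ((M.e (.loop s))⁻¹ * M.e (.loop (!s))))⁻¹ = γ⁻¹ := by group
      rw [e3] at h3
      simp only [Set.mem_compl_iff, Set.mem_ofPred_eq, not_not]
      exact h3
  | down γ d k hk =>
    have := Outward.up (M := M) γ d k (hk.mono (Nat.le_succ k))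
    rw [M.up_of_hasLevel hk] at this
    exact this

theorem mem_lower_smul (c : Multiplicative (ZMod (q - 1))) (d : Dir q) (k : ℕ) (w : Word q N) :
    M.φ (M.κ c) w ∈ lower (c • d) k ↔ w ∈ lower d k := by
  rw [M.φ_κ, basePerm_apply]
  unfold lower
  rw [Set.mem_ofPred_eq, Set.mem_ofPred_eq, Word.frame_smul]
  simp [Frame.baseSMul]

theorem κ_smul_up (c : Multiplicative (ZMod (q - 1))) (d : Dir q) (k : ℕ)
    (hk : d.HasLevel N k) : M.κ c • M.up d k = M.up (c • d) k := by
  by_cases h : d.HasLevel N (k + 1)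
  · rw [M.up_of_hasLevel h, M.up_of_hasLevel (h.smul c), M.κ_smul_pt]
  · obtain ⟨rfl, s, rfl⟩ := (not_hasLevel_iff hk).1 h
    rw [smul_loop, M.up_of_not_hasLevel h, ← mul_smul]
    have hl : ∀ s, Commute (M.κ c) (M.e (.loop s)) := by
      intro s
      cases s
      · exact Commute.one_right _
      · exact M.commute_t c
    have := ((hl s).inv_right.mul_right (hl (!s))).eq
    change (M.κ c * ((M.e (.loop s))⁻¹ * M.e (.loop (!s)))) • _ = _
    rw [this, mul_smul, M.κ_smul_pt]
    rfl

/-- The stabilizer of a vertex on a ray fixes the edge away from the base. -/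
theorem smul_up {γ : Γ} {d : Dir q} {k : ℕ} (hk : d.HasLevel N (k + 1))
    (h : γ • M.pt d (k + 1) = M.pt d (k + 1)) : γ • M.up d (k + 1) = M.up d (k + 1) := by
  obtain ⟨b, c, hb, hc, rfl⟩ := (M.smul_pt γ d k hk).1 h
  by_cases h' : d.HasLevel N (k + 2)
  · rw [M.up_of_hasLevel h']
    exact (M.smul_pt _ d (k + 1) h').2 ⟨b, c, by omega, hc, rfl⟩
  · obtain ⟨hkN, s, rfl⟩ := (not_hasLevel_iff hk).1 h'
    obtain rfl : N = k + 1 := hkN.symm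
    rw [mul_smul]
    have h2 : M.κ c • M.up (.loop s) (k + 1) = M.up (.loop s) (k + 1) :=
      M.κ_smul_up c (.loop s) (k + 1) (le_refl (k + 1))
    rw [h2, M.up_of_not_hasLevel h', ← mul_smul]
    have h3 := (M.smul_pt ((M.e (.loop (!s)))⁻¹ * M.lab (.loop (!s)) b * M.e (.loop (!s)) * M.κ 1)
      (.loop (!s)) k (le_refl (k + 1))).2 ⟨b, 1, hb, rfl, rfl⟩
    simp only [Dir.flip]
    conv_rhs => rw [← h3]
    rw [← mul_smul]
    congr 1
    change (M.e (.loop s))⁻¹ * M.α b * M.e (.loop s) * ((M.e (.loop s))⁻¹ * M.e (.loop (!s))) = _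
    simp only [map_one, mul_one]
    change _ = (M.e (.loop s))⁻¹ * M.e (.loop (!s)) *
      ((M.e (.loop (!s)))⁻¹ * M.α b * M.e (.loop (!s)))
    group

theorem mem_lower_conj {d : Dir q} {b : GInf q} {c : Multiplicative (ZMod (q - 1))}
    (hj : Joined N d d b) (hc : c • d = d) (j : ℕ) (w : Word q N) :
    M.φ ((M.e d)⁻¹ * M.lab d b * M.e d * M.κ c) w ∈ lower d j ↔
      (w.frame d).arr = d ∧ level (b * (w.frame d).elt) ≤ j := by
  rw [map_mul, Equiv.Perm.mul_apply]
  unfold lower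
  rw [Set.mem_ofPred_eq, M.φ_lab_frame hj]
  have h1 : ((M.φ (M.κ c) w).frame d).elt = (w.frame d).elt ∧
      ((M.φ (M.κ c) w).frame d).arr = c • (w.frame d).arr := by
    rw [M.φ_κ, basePerm_apply]
    have := Word.frame_smul d c w
    have key : ∀ d', d' = c • d → ((c • w).frame d').elt = (w.frame d).elt ∧
      ((c • w).frame d').arr = c • (w.frame d).arr := by
      rintro _ rfl
      rw [this]
      exact ⟨rfl, rfl⟩
    exact key d hc.symm
  change (_ ∧ level (b * _) ≤ j) ↔ _
  rw [h1.1]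
  refine and_congr_left fun _ => ?_
  change ((M.φ (M.κ c) w).frame d).arr = d ↔ _
  rw [h1.2]
  constructor
  · intro h
    conv_rhs at h => rw [← hc]
    exact smul_left_cancel c h
  · intro h
    rw [h, hc]

theorem joined_of_level {d : Dir q} {k : ℕ} (hk : d.HasLevel N k) {b : GInf q}
    (hb : level b ≤ k) : Joined N d d b := by
  cases d with
  | loop s => exact hb.trans hk
  | cusp h => rfl

theorem exists_mem_lower {d : Dir q} {k : ℕ} (hk : d.HasLevel N k) {b : GInf q}
    (hb : level b ≤ k) : ∃ w : Word q N, (w.frame d).arr = d ∧ (w.frame d).elt = b := by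
  refine ⟨Frame.glue ⟨b, d, .nil, joined_of_level hk hb, Word.nil_avoids d⟩, ?_, ?_⟩ <;>
  rw [Frame.frame_glue]

include M in
theorem exists_not_mem_lower {d : Dir q} {k : ℕ} : ∃ w : Word q N, w ∉ lower d k := by
  cases d with
  | loop s =>
    have hj : Joined N (.loop s : Dir q) (.loop (!s)) 1 := by simp [Joined]
    refine ⟨Frame.glue ⟨1, .loop (!s), .nil, hj, Word.nil_avoids _⟩, ?_⟩
    unfold lower
    rw [Set.mem_ofPred_eq, Frame.frame_glue]
    cases s <;> simp
  | cusp h =>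
    obtain ⟨b, hb⟩ := exists_level_eq M.two_le (k + 1)
    refine ⟨Frame.glue ⟨b, .cusp h, .nil, joined_cusp h b, Word.nil_avoids _⟩, ?_⟩
    unfold lower
    rw [Set.mem_ofPred_eq, Frame.frame_glue]
    simp [hb]

theorem Outward.up_smul {γ : Γ} (c : Multiplicative (ZMod (q - 1))) {d : Dir q} {k : ℕ} :
    {w | M.φ γ⁻¹ w ∈ lower (c • d) k} = {w | M.φ (γ * M.κ c)⁻¹ w ∈ lower d k} := by
  ext w
  rw [Set.mem_ofPred_eq, Set.mem_ofPred_eq, ← M.mem_lower_smul c d k (M.φ (γ * M.κ c)⁻¹ w),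
    ← Equiv.Perm.mul_apply, ← map_mul]
  have : M.κ c * (γ * M.κ c)⁻¹ = γ⁻¹ := by group
  rw [this]

/-- A vertex is seen from only one side along any two different edges. -/
theorem Outward.disjoint {x y z : V} {S S' : Set (Word q N)} (h : M.Outward y x S)
    (h' : M.Outward y z S') (hxz : x ≠ z) : (∀ w, ¬ (w ∈ S ∧ w ∈ S')) ∧ ∃ w, w ∉ S ∧ w ∉ S' := by
  -- two representations of the same vertex `y` differ by an element of its stabilizer
  have stab : ∀ (γ γ' : Γ) (d d' : Dir q) (k k' : ℕ), d.HasLevel N (k + 1) →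
      d'.HasLevel N (k' + 1) → γ • M.pt d (k + 1) = γ' • M.pt d' (k' + 1) →
      k = k' ∧ ∃ c b c', d' = c • d ∧ level b ≤ k + 1 ∧ c' • d = d ∧
        γ' * M.κ c = γ * ((M.e d)⁻¹ * M.lab d b * M.e d * M.κ c') ∧
        (γ⁻¹ * (γ' * M.κ c)) • M.pt d (k + 1) = M.pt d (k + 1) := by
    intro γ γ' d d' k k' hk hk' he
    have h1 : (γ'⁻¹ * γ) • M.pt d (k + 1) = M.pt d' (k' + 1) := by
      rw [mul_smul, he, inv_smul_smul]
    obtain ⟨hkk, h2⟩ := M.type_eq _ _ _ _ _ hk hk' h1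
    obtain rfl : k = k' := by omega
    obtain ⟨c, rfl⟩ := h2.resolve_left (by omega)
    have h3 : (γ⁻¹ * (γ' * M.κ c)) • M.pt d (k + 1) = M.pt d (k + 1) := by
      rw [mul_smul, mul_smul, M.κ_smul_pt, ← he, inv_smul_smul]
    obtain ⟨b, c', hb, hc', h4⟩ := (M.smul_pt _ _ _ hk).1 h3
    exact ⟨rfl, c, b, c', rfl, hb, hc', by rw [← h4]; group, h3⟩
  have main : ∀ (γ γ' : Γ) (d : Dir q) (k : ℕ) (b : GInf q) (c' : Multiplicative (ZMod (q - 1))),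
      d.HasLevel N (k + 1) → level b ≤ k + 1 → c' • d = d →
      γ' = γ * ((M.e d)⁻¹ * M.lab d b * M.e d * M.κ c') → ∀ j w,
      M.φ γ⁻¹ w ∈ lower d j ↔ ((M.φ γ'⁻¹ w).frame d).arr = d ∧
        level (b * ((M.φ γ'⁻¹ w).frame d).elt) ≤ j := by
    intro γ γ' d k b c' hk hb hc hγ j w
    rw [← M.mem_lower_conj (joined_of_level hk hb) hc j, ← Equiv.Perm.mul_apply, ← map_mul]
    have : γ⁻¹ = (M.e d)⁻¹ * M.lab d b * M.e d * M.κ c' * γ'⁻¹ := by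
      rw [hγ]
      group
    rw [this]
  have upDown : ∀ (γ γ' : Γ) (d d' : Dir q) (k k' : ℕ), d.HasLevel N k → d'.HasLevel N (k' + 1) →
      γ • M.pt d k = γ' • M.pt d' (k' + 1) →
      (∀ w, ¬ (M.φ γ⁻¹ w ∉ lower d k ∧ M.φ γ'⁻¹ w ∈ lower d' k')) ∧
        ∃ w, M.φ γ⁻¹ w ∈ lower d k ∧ M.φ γ'⁻¹ w ∉ lower d' k' := by
    intro γ γ' d d' k k' hk hk' he
    have h1 : (γ'⁻¹ * γ) • M.pt d k = M.pt d' (k' + 1) := by rw [mul_smul, he, inv_smul_smul]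
    obtain ⟨rfl, -⟩ := M.type_eq _ _ _ _ _ hk hk' h1
    obtain ⟨-, c, b, c', rfl, hb, hc', hγ, -⟩ := stab γ γ' d d' k' k' hk hk' he
    have hm := main γ _ d k' b c' hk hb hc' hγ (k' + 1)
    have hs : ∀ w, M.φ γ'⁻¹ w ∈ lower (c • d) k' ↔ M.φ (γ' * M.κ c)⁻¹ w ∈ lower d k' := fun w =>
      Set.ext_iff.1 (Outward.up_smul M (γ := γ') c (d := d) (k := k')) w
    simp only [hs]
    constructor
    · rintro w ⟨h2, h3, h4⟩
      exact h2 ((hm w).2 ⟨h3, level_mul_le hb (h4.trans (Nat.le_succ _))⟩)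
    · obtain ⟨u, hu⟩ := exists_level_eq M.two_le (k' + 1)
      obtain ⟨w, hw1, hw2⟩ := exists_mem_lower (N := N) hk (b := u) hu.le
      refine ⟨M.φ (γ' * M.κ c) w, (hm _).2 ?_, ?_⟩ <;>
      rw [← Equiv.Perm.mul_apply, ← map_mul, inv_mul_cancel, map_one, Equiv.Perm.one_apply]
      · exact ⟨hw1, by rw [hw2]; exact level_mul_le hb hu.le⟩
      · rintro ⟨-, h2⟩
        rw [hw2, hu] at h2
        omega
  generalize hy : y = y' at h'
  cases h with
  | up γ d k hk =>
    cases h' with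
    | up γ' d' k' hk' =>
      have h1 : (γ'⁻¹ * γ) • M.pt d k = M.pt d' k' := by rw [mul_smul, hy, inv_smul_smul]
      obtain ⟨rfl, h2⟩ := M.type_eq _ _ _ _ _ hk hk' h1
      rcases Nat.eq_zero_or_pos k with rfl | hpos
      · -- two edges at a base vertex
        have h3 : (γ⁻¹ * γ') • M.base = M.base := by
          rw [M.pt_zero, M.pt_zero] at hy
          rw [mul_smul, ← hy, inv_smul_smul]
        obtain ⟨c, hc⟩ := M.smul_base _ h3
        rw [inv_mul_eq_iff_eq_mul] at hc
        subst hc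
        have hcd : d ≠ c • d' := by
          rintro rfl
          apply hxz
          rw [← M.κ_smul_up c d' 0 hk', mul_smul]
        have low : ∀ (d : Dir q) (w : Word q N), w ∈ lower d 0 ↔ w.Avoids d := by
          intro d w
          constructor
          · rintro ⟨h4, h5⟩
            have h5 := level_eq_zero.1 (Nat.le_zero.1 h5)
            have := (w.frame d).avoids
            rw [h4] at this
            have h6 := Frame.glue_of_eq (x := w.frame d) ⟨h4.symm, h5⟩
            rw [Word.glue_frame] at h6
            rwa [h6]
          · intro h4
            unfold lower
            rw [Set.mem_ofPred_eq, Word.frame_of_avoids h4]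
            simp
        have hs : ∀ w, M.φ (γ * M.κ c)⁻¹ w ∈ lower d' 0 ↔ M.φ γ⁻¹ w ∈ lower (c • d') 0 := fun w =>
          (Set.ext_iff.1 (Outward.up_smul M (γ := γ) c (d := d') (k := 0)) w).symm
        simp only [Set.mem_ofPred_eq, hs, low, not_not]
        constructor
        · rintro w ⟨h4, h5⟩
          rcases (M.φ γ⁻¹ w).nil_or_cons with h6 | ⟨s, r, hr, h6⟩
          · rw [h6] at h4
            exact h4 (Word.nil_avoids _)
          · rw [h6, Word.cons_avoids, not_not] at h4 h5
            exact hcd (h4.trans h5.symm)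
        · refine ⟨M.φ γ .nil, ?_⟩
          rw [← Equiv.Perm.mul_apply, ← map_mul, inv_mul_cancel, map_one, Equiv.Perm.one_apply]
          exact ⟨Word.nil_avoids _, Word.nil_avoids _⟩
      · obtain ⟨k, rfl⟩ : ∃ j, k = j + 1 := ⟨k - 1, by omega⟩
        obtain ⟨-, c, b, c', rfl, hb, hc', hγ, hst⟩ := stab γ γ' d d' k k hk hk' hy
        exfalso
        apply hxz
        have := M.smul_up hk hst
        rw [mul_smul, inv_smul_eq_iff, mul_smul, M.κ_smul_up c d _ hk] at this
        exact this.symm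
    | down γ' d' k' hk' =>
      obtain ⟨h1, w, h2, h3⟩ := upDown γ γ' d d' k k' hk hk' hy
      exact ⟨h1, w, not_not.2 h2, h3⟩
  | down γ d k hk =>
    cases h' with
    | up γ' d' k' hk' =>
      obtain ⟨h1, w, h2, h3⟩ := upDown γ' γ d' d k' k hk' hk hy.symm
      exact ⟨fun w hw => h1 w hw.symm, w, h3, not_not.2 h2⟩
    | down γ' d' k' hk' =>
      obtain ⟨rfl, c, b, c', rfl, hb, hc', hγ, hst⟩ := stab γ γ' d d' k k' hk hk' hy
      have hm := main γ _ d k b c' hk hb hc' hγ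
      have hs : ∀ w, M.φ γ'⁻¹ w ∈ lower (c • d) k ↔ M.φ (γ' * M.κ c)⁻¹ w ∈ lower d k := fun w =>
        Set.ext_iff.1 (Outward.up_smul M (γ := γ') c (d := d) (k := k)) w
      have hbk : k < level b := by
        by_contra hle
        push Not at hle
        apply hxz
        have h1 : ((M.e d)⁻¹ * M.lab d b * M.e d * M.κ c') • M.pt d k = M.pt d k := by
          rcases Nat.eq_zero_or_pos k with rfl | hpos
          · rw [level_eq_zero.1 (Nat.le_zero.1 hle), map_one, mul_one, inv_mul_cancel, one_mul,
              M.pt_zero, κ_smul_base]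
          · obtain ⟨k, rfl⟩ : ∃ j, k = j + 1 := ⟨k - 1, by omega⟩
            exact (M.smul_pt _ d k (hk.mono (Nat.le_succ _))).2 ⟨b, c', hle, hc', rfl⟩
        rw [← M.κ_smul_pt, ← mul_smul, hγ, mul_smul, h1]
      simp only [Set.mem_ofPred_eq, hs]
      constructor
      · rintro w ⟨h1, h2, h3⟩
        have h4 := ((hm k w).1 h1).2
        have := level_mul_le h4 ((level_inv _).trans_le h3)
        rw [mul_inv_cancel_right] at this
        omega
      · obtain ⟨w, hw⟩ := M.exists_not_mem_lower (d := d) (k := k + 1)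
        refine ⟨M.φ (γ' * M.κ c) w, ?_, ?_⟩
        · rw [hm, ← Equiv.Perm.mul_apply, ← map_mul, inv_mul_cancel, map_one,
            Equiv.Perm.one_apply]
          rintro ⟨h1, h2⟩
          refine hw ⟨h1, ?_⟩
          have := level_mul_le ((level_inv b).trans_le hb) (h2.trans (Nat.le_succ k))
          rwa [inv_mul_cancel_left] at this
        · rw [← Equiv.Perm.mul_apply, ← map_mul, inv_mul_cancel, map_one, Equiv.Perm.one_apply]
          rintro ⟨h1, h2⟩
          exact hw ⟨h1, h2.trans (Nat.le_succ k)⟩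

include M in
/-- Outward half-spaces of the oriented edges separate the endpoints consistently, which rules
out cycles. -/
theorem isAcyclic : 𝒯.IsAcyclic := by
  classical
  refine SimpleGraph.isAcyclic_of_halfSpaces
    (fun x y => if h : 𝒯.Adj x y then (M.exists_outward_of_adj h).choose else ∅) ?_
  intro x y z hxy hyz hxz
  rw [dif_pos hxy, dif_pos hyz]
  have h1 := (M.exists_outward_of_adj hxy).choose_spec.symm
  have h2 := (M.exists_outward_of_adj hyz).choose_spec
  obtain ⟨h3, w, h4, h5⟩ := h1.disjoint M h2 hxz
  refine ⟨fun w hw => by_contra fun h => h3 w ⟨h, hw⟩, fun h => ?_⟩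
  exact h5 (h (not_not.1 h4))

theorem adj_up (γ : Γ) {d : Dir q} {k : ℕ} (h : d.HasLevel N k) :
    𝒯.Adj (γ • M.pt d k) (γ • M.up d k) :=
  (M.adj_iff _ _).2 ⟨γ, d, k, h, Or.inl ⟨rfl, rfl⟩⟩

theorem adj_pt_succ (γ : Γ) {d : Dir q} {k : ℕ} (h : d.HasLevel N (k + 1)) :
    𝒯.Adj (γ • M.pt d k) (γ • M.pt d (k + 1)) := by
  have := M.adj_up γ (h.mono (Nat.le_succ k))
  rwa [M.up_of_hasLevel h] at this

theorem reachable_pt (γ : Γ) {d : Dir q} {k : ℕ} (h : d.HasLevel N k) :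
    𝒯.Reachable (γ • M.base) (γ • M.pt d k) := by
  induction k with
  | zero => rw [M.pt_zero]
  | succ k ih => exact (ih (h.mono (Nat.le_succ k))).trans (M.adj_pt_succ γ h).reachable

theorem lab_smul_pt {d : Dir q} {b : GInf q} {k : ℕ} (h : d.HasLevel N (k + 1))
    (hb : level b ≤ k + 1) :
    ((M.e d)⁻¹ * M.lab d b * M.e d) • M.pt d (k + 1) = M.pt d (k + 1) :=
  (M.smul_pt _ d k h).2 ⟨b, 1, hb, one_smul _ d, by rw [map_one, mul_one]⟩

include M in
/-- The vertices joined to the base point contain its whole orbit: each generator fixes a vertex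
joined to the base point, or moves one to a neighbour that is joined to the base point. -/
theorem connected : 𝒯.Connected := by
  have hsub : ∀ γ : Γ, 𝒯.Reachable M.base (γ • M.base) := by
    intro γ
    have hγ : γ ∈ Subgroup.closure
        (Set.range M.κ ∪ Set.range M.α ∪ Set.range M.β ∪ {M.t}) := by
      rw [M.closure_eq_top]
      trivial
    have hsm : ∀ (g : Γ) (x y : V), 𝒯.Reachable x y → 𝒯.Reachable (g • x) (g • y) := by
      rintro g x y ⟨p⟩
      exact ⟨p.map ⟨fun z => g • z, fun {a b} h => M.adj_smul g a b h⟩⟩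
    have hfix : ∀ (g : Γ) (d : Dir q) (k : ℕ), d.HasLevel N k → g • M.pt d k = M.pt d k →
        𝒯.Reachable M.base (g • M.base) := by
      intro g d k hk hg
      have h1 := M.reachable_pt 1 hk
      have h2 := M.reachable_pt g hk
      rw [one_smul, one_smul] at h1
      rw [hg] at h2
      exact h1.trans h2.symm
    obtain ⟨n, hn⟩ : ∃ n, N = n + 1 := ⟨N - 1, by have := M.one_le; omega⟩
    induction hγ using Subgroup.closure_induction with
    | mem x hx =>
      rcases hx with ((⟨c, rfl⟩ | ⟨b, rfl⟩) | ⟨b, rfl⟩) | rfl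
      · rw [κ_smul_base]
      · refine hfix _ (.loop false) (n + 1) hn.ge ?_
        have := M.lab_smul_pt (d := .loop false) (b := trunc q N b) (k := n) hn.ge
          ((level_emb_le N _).trans hn.le)
        simpa [e, lab, frameElt, labelHom, M.α_trunc] using this
      · refine hfix _ (.cusp 1) (level b + 1) trivial ?_
        have := M.lab_smul_pt (d := .cusp 1) (b := b) (k := level b) trivial (Nat.le_succ _)
        simpa [e, lab, frameElt, labelHom] using this
      · have h1 := M.reachable_pt 1 (d := .loop false) (k := N) (le_refl N)
        have h2 := (M.adj_up 1 (d := .loop false) (k := N) (le_refl N)).reachable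
        rw [M.up_of_not_hasLevel (by simp [Dir.HasLevel])] at h2
        have h3 := M.reachable_pt M.t (d := .loop true) (k := N) (le_refl N)
        simp only [one_smul, e, frameElt, Dir.flip, Bool.not_false, inv_one, one_mul] at h1 h2
        exact (h1.trans h2).trans h3.symm
    | one => rw [one_smul]
    | mul x y _ _ hx hy => exact hx.trans (by rw [mul_smul]; exact hsm x _ _ hy)
    | inv x _ hx => simpa using (hsm x⁻¹ _ _ hx).symm
  have hall : ∀ v, 𝒯.Reachable M.base v := by
    intro v
    obtain ⟨γ, d, k, hk, rfl⟩ := M.exists_eq_smul_pt v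
    exact (hsub γ).trans (M.reachable_pt γ hk)
  exact { preconnected := fun u v => (hall u).symm.trans (hall v), nonempty := ⟨M.base⟩ }

include M in
theorem isTree : 𝒯.IsTree := ⟨M.connected, M.isAcyclic⟩

end LoopCuspTree

end LoopWithCusp

/-! ### Distances in the tree -/

namespace LoopWithCusp

open TreeGeometry

variable {q N : ℕ} {Γ V : Type} [Group Γ] [MulAction Γ V] {𝒯 : SimpleGraph V}

open Classical in
/-- The number of edges of a step. -/
def Step.len (s : Step q N) : ℕ := if s.dep = s.arr then 2 * level s.elt else 2 * N + 1

/-- The number of edges of a list of steps. -/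
def listLen (l : List (Step q N)) : ℕ := (l.map Step.len).sum

@[simp] theorem listLen_nil : listLen ([] : List (Step q N)) = 0 := rfl

@[simp] theorem listLen_cons (s : Step q N) (l : List (Step q N)) :
    listLen (s :: l) = s.len + listLen l := by simp [listLen]

/-- The direction in which one looks back after a list of steps; `d` if there is no step. -/
def endDir (d : Dir q) : List (Step q N) → Dir q
  | [] => d
  | s :: l => endDir s.arr l

theorem endDir_append_cons (d : Dir q) (l l' : List (Step q N)) (s : Step q N) :
    endDir d (l ++ s :: l') = endDir s.arr l' := by
  induction l generalizing d with
  | nil => rfl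
  | cons s' l ih => exact ih s'.arr

theorem Step.len_pos (s : Step q N) : 0 < s.len := by
  unfold Step.len
  split_ifs with h
  · have : level s.elt ≠ 0 := fun h0 => s.ne ⟨h, level_eq_zero.1 h0⟩
    omega
  · omega

@[simp] theorem Step.len_smul (c : Multiplicative (ZMod (q - 1))) (s : Step q N) :
    (c • s).len = s.len := by
  unfold Step.len
  have : (c • s).dep = (c • s).arr ↔ s.dep = s.arr :=
    ⟨fun h => smul_left_cancel c h, fun h => congrArg (c • ·) h⟩
  by_cases h : s.dep = s.arr
  · rw [if_pos h, if_pos (this.2 h), Step.smul_elt]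
  · rw [if_neg h, if_neg (fun h' => h (this.1 h'))]

namespace LoopCuspTree

variable (M : LoopCuspTree q N Γ V 𝒯)

include M in
theorem hasLevel_one (d : Dir q) : d.HasLevel N 1 := by
  cases d with
  | loop s => exact M.one_le
  | cusp h => trivial

theorem adj_pt {d : Dir q} {k : ℕ} (h : d.HasLevel N (k + 1)) :
    𝒯.Adj (M.pt d k) (M.pt d (k + 1)) := by
  simpa using M.adj_pt_succ 1 h

theorem dist_pt {d : Dir q} {k : ℕ} (h : d.HasLevel N k) : 𝒯.dist M.base (M.pt d k) = k := by
  induction k using Nat.strong_induction_on with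
  | _ k ih =>
    rcases k with _ | k
    · rw [M.pt_zero, SimpleGraph.dist_self]
    · have hk := h.mono (Nat.le_succ k)
      have hn : ¬ Toward 𝒯 (M.pt d k) M.base (M.pt d (k + 1)) := by
        intro hn
        rcases k with _ | k
        · rw [M.pt_zero] at hn
          exact hn.ne rfl
        · have h1 := ih k (by omega) (hk.mono (Nat.le_succ k))
          have h2 := ih (k + 1) (by omega) hk
          have h3 : Toward 𝒯 (M.pt d (k + 1)) M.base (M.pt d k) :=
            ⟨(M.adj_pt hk).symm, by rw [𝒯.dist_comm, h1, 𝒯.dist_comm, h2]⟩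
          have h4 := toward_unique M.isTree hn h3
          have h5 := M.type_eq 1 d d (k + 1 + 1) k h (hk.mono (Nat.le_succ k))
            (by rw [one_smul, h4])
          omega
      have := dist_of_not_toward M.isTree (M.adj_pt h) hn
      rw [𝒯.dist_comm, this, 𝒯.dist_comm, ih k (by omega) hk]

theorem dist_pt_pt_le {d : Dir q} {j i : ℕ} (h : d.HasLevel N (j + i)) :
    𝒯.dist (M.pt d j) (M.pt d (j + i)) ≤ i := by
  induction i with
  | zero => simp
  | succ i ih =>
    have h1 := ih (h.mono (by omega))
    have h2 := M.connected.dist_triangle (u := M.pt d j) (v := M.pt d (j + i))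
      (w := M.pt d (j + i + 1))
    rw [SimpleGraph.dist_eq_one_iff_adj.2 (M.adj_pt (k := j + i) h)] at h2
    exact h2.trans (by omega)

theorem between_pt {d : Dir q} {j k : ℕ} (hjk : j ≤ k) (h : d.HasLevel N k) :
    Between 𝒯 M.base (M.pt d j) (M.pt d k) := by
  obtain ⟨i, rfl⟩ := Nat.exists_eq_add_of_le hjk
  have h1 := M.dist_pt_pt_le h
  have h2 := M.connected.dist_triangle (u := M.base) (v := M.pt d j) (w := M.pt d (j + i))
  unfold Between
  rw [M.dist_pt h] at *
  rw [M.dist_pt (h.mono hjk)] at *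
  omega

theorem toward_base_pt {d : Dir q} {k : ℕ} (h : d.HasLevel N (k + 1)) :
    Toward 𝒯 (M.pt d (k + 1)) M.base (M.pt d k) :=
  ⟨(M.adj_pt h).symm, by
    rw [𝒯.dist_comm, 𝒯.dist_comm (u := M.pt d (k + 1)), M.dist_pt h,
      M.dist_pt (h.mono (Nat.le_succ k))]⟩

theorem toward_pt {d : Dir q} {k : ℕ} (hk : 1 ≤ k) (h : d.HasLevel N k) :
    Toward 𝒯 M.base (M.pt d k) (M.pt d 1) := by
  have h1 := M.between_pt hk h
  have h2 := M.adj_pt (h.mono hk : d.HasLevel N (0 + 1))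
  rw [M.pt_zero] at h2
  refine h1.toward M.connected ?_
  exact toward_self_of_adj h2

theorem word_lab {d : Dir q} {b : GInf q} (hj : Joined N d d b)
    (c : Multiplicative (ZMod (q - 1))) :
    ((M.word ((M.e d)⁻¹ * M.lab d b * M.e d * M.κ c)).frame d).elt = b := by
  unfold word
  rw [map_mul, Equiv.Perm.mul_apply, M.φ_κ, basePerm_apply, Word.smul_nil, M.φ_lab_frame hj,
    Word.frame_of_avoids (Word.nil_avoids d)]
  exact mul_one b

theorem lab_smul_pt_ne {d : Dir q} {b : GInf q} {k : ℕ} (h : d.HasLevel N (k + 1))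
    (hb : level b = k + 1) :
    ((M.e d)⁻¹ * M.lab d b * M.e d) • M.pt d k ≠ M.pt d k := by
  have hj : Joined N d d b := joined_of_level h hb.le
  have h1 := M.word_lab hj 1
  rw [map_one, mul_one] at h1
  have key : ∀ b' c, level b' ≤ k → (M.e d)⁻¹ * M.lab d b * M.e d =
      (M.e d)⁻¹ * M.lab d b' * M.e d * M.κ c → False := by
    intro b' c hb' he
    have h2 := M.word_lab (joined_of_level h (hb'.trans (Nat.le_succ k))) c
    rw [← he, h1] at h2
    subst h2
    omega
  intro he
  rcases k with _ | k
  · rw [M.pt_zero] at he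
    obtain ⟨c, hc⟩ := M.smul_base _ he
    exact key 1 c (by simp) (by rw [hc]; simp)
  · obtain ⟨b', c, hb', -, h2⟩ := (M.smul_pt _ d k (h.mono (Nat.le_succ _))).1 he
    exact key b' c hb' h2

theorem pt_one_injective {d d' : Dir q} (h : M.pt d 1 = M.pt d' 1) : d = d' := by
  obtain ⟨-, h1⟩ := M.type_eq 1 d d' 1 1 (M.hasLevel_one d) (M.hasLevel_one d')
    (by rw [one_smul, h])
  obtain ⟨c, rfl⟩ := h1.resolve_left one_ne_zero
  cases d with
  | loop s => rfl
  | cusp h' =>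
    rw [← M.κ_smul_pt] at h
    obtain ⟨b, c', hb, hc', h2⟩ := (M.smul_pt _ _ 0 (M.hasLevel_one _)).1 h.symm
    have h3 := M.word_lab (joined_cusp h' b) c'
    rw [← h2] at h3
    have h4 : M.word (M.κ c) = .nil := by
      unfold word
      rw [M.φ_κ, basePerm_apply, Word.smul_nil]
    rw [h4, Word.frame_of_avoids (Word.nil_avoids _)] at h3
    change 1 = b at h3
    subst h3
    simp only [smul_cusp, Dir.cusp.injEq, mul_eq_right] at hc'
    subst hc'
    simp only [map_one, mul_one, inv_mul_cancel] at h2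
    have := M.κ_injective (h2.trans (map_one _).symm)
    rw [this, one_smul]

/-- The geodesic of a step runs along the ray in its first direction and then back to the next base
vertex along the ray in its last direction. -/
theorem exists_step_geodesic (s : Step q N) :
    𝒯.dist M.base (M.stepElt s • M.base) = s.len ∧ ∃ K, 1 ≤ K ∧ s.dep.HasLevel N K ∧
      s.arr.HasLevel N K ∧ Between 𝒯 M.base (M.pt s.dep K) (M.stepElt s • M.base) ∧
      Between 𝒯 M.base (M.stepElt s • M.pt s.arr K) (M.stepElt s • M.base) ∧ s.len ≤ 2 * K + 1 := by
  have hT := M.isTree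
  have ha := M.adj_smul
  by_cases hd : s.dep = s.arr
  · obtain ⟨k, hk⟩ : ∃ k, level s.elt = k + 1 := by
      refine ⟨level s.elt - 1, ?_⟩
      have : level s.elt ≠ 0 := fun h0 => s.ne ⟨hd, level_eq_zero.1 h0⟩
      omega
    have hlev : s.dep.HasLevel N (k + 1) := by
      have hj := s.joined
      rw [← hd] at hj
      revert hj
      generalize s.dep = d
      intro hj
      cases d with
      | loop s' => exact hk ▸ hj
      | cusp h => trivial
    have hstep : M.stepElt s = (M.e s.dep)⁻¹ * M.lab s.dep s.elt * M.e s.dep := by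
      unfold stepElt
      rw [← hd]
    have hfix : M.stepElt s • M.pt s.dep (k + 1) = M.pt s.dep (k + 1) := by
      rw [hstep]
      exact M.lab_smul_pt hlev hk.le
    have hb : Between 𝒯 M.base (M.pt s.dep (k + 1)) (M.stepElt s • M.base) := by
      refine between_of_forall_toward hT fun n h1 h2 => ?_
      have h3 := M.toward_base_pt hlev
      have h4 := h3.smul ha (M.stepElt s)
      rw [hfix] at h4
      refine M.lab_smul_pt_ne hlev hk ?_
      rw [← hstep, toward_unique hT h4 h2, toward_unique hT h3 h1]
    have hdist : 𝒯.dist (M.pt s.dep (k + 1)) (M.stepElt s • M.base) = k + 1 := by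
      conv_lhs => rw [← hfix]
      rw [TreeAction.dist_smul ha, 𝒯.dist_comm, M.dist_pt hlev]
    have hlen : s.len = 2 * (k + 1) := by
      unfold Step.len
      rw [if_pos hd, hk]
    refine ⟨?_, k + 1, by omega, hlev, hd ▸ hlev, hb, ?_, by omega⟩
    · unfold Between at hb
      rw [M.dist_pt hlev, hdist] at hb
      omega
    · rw [← hd, hfix]
      exact hb
  · obtain ⟨s', hs1, hs2⟩ : ∃ s', s.dep = .loop s' ∧ s.arr = .loop (!s') := by
      have hj := s.joined
      revert hj hd
      generalize s.dep = d
      generalize s.arr = d'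
      intro hd hj
      cases d with
      | loop s' =>
        cases d' with
        | loop s'' =>
          refine ⟨s', rfl, ?_⟩
          cases s' <;> cases s'' <;> simp_all
        | cusp h => exact hj.elim
      | cusp h =>
        cases d' with
        | loop s' => exact hj.elim
        | cusp h' => exact absurd (congrArg Dir.cusp hj) hd
    have hlen : s.len = 2 * N + 1 := if_neg hd
    have hb : level s.elt ≤ N := by
      have := s.joined
      rw [hs1, hs2] at this
      exact this
    obtain ⟨n, hn⟩ : ∃ n, N = n + 1 := ⟨N - 1, by have := M.one_le; omega⟩
    have hl1 : s.dep.HasLevel N (n + 1) := by rw [hs1]; exact hn.ge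
    have hl2 : s.arr.HasLevel N (n + 1) := by rw [hs2]; exact hn.ge
    set u := M.up s.dep N with hu
    have hu' : u = ((M.e s.dep)⁻¹ * M.e s.arr) • M.pt s.arr N := by
      rw [hu, M.up_of_not_hasLevel (by rw [hs1]; simp [Dir.HasLevel])]
      have : s.dep.flip = s.arr := by rw [hs1, hs2]; rfl
      rw [this]
    have hσ : M.stepElt s • M.pt s.arr N = u := by
      have h1 : M.stepElt s = ((M.e s.dep)⁻¹ * M.lab s.dep s.elt * M.e s.dep) *
          ((M.e s.dep)⁻¹ * M.e s.arr) := by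
        unfold stepElt
        group
      rw [h1, mul_smul, ← hu', hu]
      have h2 := M.lab_smul_pt (d := s.dep) (b := s.elt) hl1 (hb.trans hn.le)
      have h3 := M.smul_up hl1 h2
      rwa [← hn] at h3
    rw [← hn] at hl1 hl2
    have hadj : 𝒯.Adj (M.pt s.dep N) u := by simpa using M.adj_up 1 hl1
    have htow : ∀ m, Toward 𝒯 (M.pt s.dep N) M.base m → m = M.pt s.dep n := by
      intro m hm
      have := M.toward_base_pt (d := s.dep) (k := n) (hn ▸ hl1)
      rw [← hn] at this
      exact toward_unique hT hm this
    have hdu : 𝒯.dist M.base u = N + 1 := by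
      have := dist_of_not_toward hT (u := M.base) hadj (fun h => by
        have h1 := htow u h
        rw [hu'] at h1
        have := M.type_eq _ _ _ _ _ hl2 (hl1.mono (by omega : n ≤ N)) h1
        omega)
      rw [𝒯.dist_comm, this, 𝒯.dist_comm, M.dist_pt hl1]
    have hb1 : Between 𝒯 M.base u (M.stepElt s • M.base) := by
      refine between_of_forall_toward hT fun m h1 h2 => ?_
      have h3 : Toward 𝒯 u M.base (M.pt s.dep N) :=
        ⟨hadj.symm, by rw [𝒯.dist_comm, M.dist_pt hl1, 𝒯.dist_comm, hdu]⟩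
      have h4 := (M.toward_base_pt (d := s.arr) (k := n) (hn ▸ hl2)).smul ha (M.stepElt s)
      rw [← hn, hσ] at h4
      have h5 := toward_unique hT h3 h1
      have h6 := toward_unique hT h4 h2
      have := M.type_eq _ _ _ _ _ (hl2.mono (by omega : n ≤ N)) hl1 (h6.trans h5.symm)
      omega
    have hd2 : 𝒯.dist u (M.stepElt s • M.base) = N := by
      rw [← hσ, TreeAction.dist_smul ha, 𝒯.dist_comm, M.dist_pt hl2]
    have htot : 𝒯.dist M.base (M.stepElt s • M.base) = 2 * N + 1 := by
      unfold Between at hb1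
      omega
    refine ⟨htot.trans hlen.symm, N, M.one_le, hl1, hl2, ?_, by rw [hσ]; exact hb1, by omega⟩
    have := M.connected.dist_triangle (u := M.pt s.dep N) (v := u) (w := M.stepElt s • M.base)
    have h2 := M.connected.dist_triangle (u := M.base) (v := M.pt s.dep N)
      (w := M.stepElt s • M.base)
    rw [SimpleGraph.dist_eq_one_iff_adj.2 hadj] at this
    unfold Between
    rw [M.dist_pt hl1] at *
    omega

theorem dist_step (s : Step q N) : 𝒯.dist M.base (M.stepElt s • M.base) = s.len :=
  (M.exists_step_geodesic s).1

theorem toward_step (s : Step q N) : Toward 𝒯 M.base (M.stepElt s • M.base) (M.pt s.dep 1) := by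
  obtain ⟨-, K, hK, h1, -, h2, -⟩ := M.exists_step_geodesic s
  exact h2.toward M.connected (M.toward_pt hK h1)

theorem step_toward (s : Step q N) :
    Toward 𝒯 (M.stepElt s • M.base) M.base (M.stepElt s • M.pt s.arr 1) := by
  obtain ⟨-, K, hK, -, h1, -, h2, -⟩ := M.exists_step_geodesic s
  exact h2.symm.toward M.connected ((M.toward_pt hK h1).smul M.adj_smul _)

/-- There is no base vertex in the interior of the geodesic of a step. -/
theorem eq_of_between_step (s : Step q N) (g : Γ)
    (h : Between 𝒯 M.base (g • M.base) (M.stepElt s • M.base)) :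
    g • M.base = M.base ∨ g • M.base = M.stepElt s • M.base := by
  obtain ⟨h0, K, hK, h1, h2, h3, h4, h5⟩ := M.exists_step_geodesic s
  have hT := M.isTree
  have hcase : 𝒯.dist M.base (g • M.base) ≤ K ∨
      𝒯.dist (g • M.base) (M.stepElt s • M.base) ≤ K := by
    unfold Between at h
    omega
  rcases hcase with hc | hc
  · left
    set j := 𝒯.dist M.base (g • M.base) with hj
    have h6 : Between 𝒯 M.base (M.pt s.dep j) (M.stepElt s • M.base) := by
      have h7 := M.between_pt hc h1
      have h8 := M.connected.dist_triangle (u := M.pt s.dep j) (v := M.pt s.dep K)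
        (w := M.stepElt s • M.base)
      have h9 := M.connected.dist_triangle (u := M.base) (v := M.pt s.dep j)
        (w := M.stepElt s • M.base)
      unfold Between at *
      omega
    have h7 := h.eq_of_dist_eq hT h6 (by rw [M.dist_pt (h1.mono hc)])
    rw [← M.pt_zero s.dep] at h7
    have h8 := M.type_eq _ _ _ _ _ (h1.mono (Nat.zero_le K)) (h1.mono hc) h7
    rw [M.pt_zero] at h7
    rw [h7, ← h8.1, M.pt_zero]
  · right
    set j := 𝒯.dist (g • M.base) (M.stepElt s • M.base) with hj
    have h6 : Between 𝒯 (M.stepElt s • M.base) (M.stepElt s • M.pt s.arr j) M.base := by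
      have h7 := (M.between_pt hc h2).smul M.adj_smul (M.stepElt s)
      have h8 := M.connected.dist_triangle (u := M.stepElt s • M.pt s.arr j)
        (v := M.stepElt s • M.pt s.arr K) (w := M.base)
      have h9 := M.connected.dist_triangle (u := M.stepElt s • M.base)
        (v := M.stepElt s • M.pt s.arr j) (w := M.base)
      have h4' := h4.symm
      unfold Between at *
      omega
    have h7 := h.symm.eq_of_dist_eq hT h6 (by
      rw [TreeAction.dist_smul M.adj_smul, M.dist_pt (h2.mono hc), 𝒯.dist_comm])
    have h7' : ((M.stepElt s)⁻¹ * g) • M.base = M.pt s.arr j := by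
      rw [mul_smul, h7, inv_smul_smul]
    rw [← M.pt_zero s.arr] at h7'
    have h8 := M.type_eq _ _ _ _ _ (h2.mono (Nat.zero_le K)) (h2.mono hc) h7'
    rw [h7, ← h8.1, M.pt_zero]

/-- The distances and the first and the last edge of the geodesic given by a word. -/
theorem geodesic_elt (w : Word q N) :
    𝒯.dist M.base (M.elt w • M.base) = listLen w.1 ∧
      (∀ s r h, w = .cons s r h → Toward 𝒯 M.base (M.elt w • M.base) (M.pt s.dep 1) ∧
        Between 𝒯 M.base (M.stepElt s • M.base) (M.elt w • M.base)) ∧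
      (w ≠ .nil → ∀ d, Toward 𝒯 (M.elt w • M.base) M.base (M.elt w • M.pt (endDir d w.1) 1)) := by
  induction w using Word.induction with
  | h0 =>
    refine ⟨by rw [elt_nil, one_smul, SimpleGraph.dist_self]; rfl, ?_, fun h => absurd rfl h⟩
    intro s r h e
    exact absurd e.symm Word.cons_ne_nil
  | h1 s r h ih =>
    obtain ⟨ih1, ih2, ih3⟩ := ih
    have hT := M.isTree
    have hb : Between 𝒯 M.base (M.stepElt s • M.base) (M.elt (.cons s r h) • M.base) := by
      rw [elt_cons, mul_smul]
      rcases r.nil_or_cons with rfl | ⟨s', r', hr', rfl⟩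
      · rw [elt_nil, one_smul]
        unfold Between
        simp
      · refine between_of_forall_toward hT fun n h1 h2 => ?_
        have h3 := M.step_toward s
        have h4 := (ih2 s' r' hr' rfl).1.smul M.adj_smul (M.stepElt s)
        have h5 := (toward_unique hT h3 h1).trans (toward_unique hT h4 h2).symm
        exact Word.cons_avoids.1 h (M.pt_one_injective (smul_left_cancel _ h5))
    refine ⟨?_, ?_, ?_⟩
    · unfold Between at hb
      rw [← hb, M.dist_step, elt_cons, mul_smul, TreeAction.dist_smul M.adj_smul, ih1]
      exact (listLen_cons s r.1).symm
    · intro s' r' h' he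
      obtain ⟨rfl, rfl⟩ := Word.cons_inj.1 he
      exact ⟨hb.toward M.connected (M.toward_step s), hb⟩
    · intro _ d
      have he : endDir d (Word.cons s r h).1 = endDir s.arr r.1 := rfl
      rw [he, elt_cons, mul_smul, mul_smul]
      rcases r.nil_or_cons with rfl | ⟨s', r', hr', rfl⟩
      · rw [elt_nil, one_smul, one_smul]
        exact M.step_toward s
      · have h1 := (ih3 Word.cons_ne_nil s.arr).smul M.adj_smul (M.stepElt s)
        rw [elt_cons M s, mul_smul] at hb
        exact hb.symm.toward M.connected h1

theorem dist_elt (w : Word q N) : 𝒯.dist M.base (M.elt w • M.base) = listLen w.1 :=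
  (M.geodesic_elt w).1

theorem dist_smul_base (γ : Γ) : 𝒯.dist M.base (γ • M.base) = listLen (M.word γ).1 := by
  rw [M.smul_base_eq, dist_elt]

/-- The base vertices on the geodesic of a word are given by its initial segments. -/
theorem exists_take_of_between (w : Word q N) (g : Γ)
    (h : Between 𝒯 M.base (g • M.base) (M.elt w • M.base)) :
    ∃ i ≤ w.1.length, g • M.base = M.listElt (w.1.take i) • M.base := by
  induction w using Word.induction generalizing g with
  | h0 =>
    refine ⟨0, le_rfl, ?_⟩
    unfold Between at h
    rw [elt_nil, one_smul, SimpleGraph.dist_self] at h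
    have : 𝒯.dist M.base (g • M.base) = 0 := by omega
    rw [List.take_zero, listElt_nil, one_smul]
    exact ((M.connected.dist_eq_zero_iff).1 this).symm
  | h1 s r hr ih =>
    have hT := M.isTree
    have hb := ((M.geodesic_elt (.cons s r hr)).2.1 s r hr rfl).2
    rcases le_total (𝒯.dist M.base (g • M.base)) (𝒯.dist M.base (M.stepElt s • M.base)) with
      hle | hle
    · rcases M.eq_of_between_step s g (h.order hT hb hle) with h1 | h1
      · exact ⟨0, Nat.zero_le _, by rw [h1, List.take_zero, listElt_nil, one_smul]⟩
      · refine ⟨1, by simp [Word.cons], ?_⟩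
        rw [h1]
        simp [Word.cons]
    · have h1 := hb.order hT h hle
      have h2 : Between 𝒯 M.base (((M.stepElt s)⁻¹ * g) • M.base) (M.elt r • M.base) := by
        have h3 : Between 𝒯 (M.stepElt s • M.base) (g • M.base)
            (M.elt (.cons s r hr) • M.base) := by
          unfold Between at *
          omega
        have h4 := h3.smul M.adj_smul (M.stepElt s)⁻¹
        rwa [inv_smul_smul, elt_cons, mul_smul, inv_smul_smul, ← mul_smul] at h4
      obtain ⟨i, hi, h5⟩ := ih _ h2
      refine ⟨i + 1, ?_, ?_⟩
      · simp only [Word.cons, List.length_cons]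
        omega
      · rw [mul_smul, inv_smul_eq_iff] at h5
        rw [h5]
        simp [Word.cons, mul_smul]

/-- An element translates the base vertex along an axis if and only if its word is cyclically
reduced. -/
theorem translates_iff (s : Step q N) (r : Word q N) (hr : r.Avoids s.arr)
    (h : Multiplicative (ZMod (q - 1))) :
    Translates 𝒯 (M.elt (.cons s r hr) * M.κ h) M.base ↔ endDir s.arr r.1 ≠ h • s.dep := by
  have hT := M.isTree
  set w := Word.cons s r hr with hw
  set γ := M.elt w * M.κ h with hγ
  have hγb : γ • M.base = M.elt w • M.base := by rw [hγ, mul_smul, κ_smul_base]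
  obtain ⟨h0, h1, h2⟩ := M.geodesic_elt w
  have h3 := (h1 s r hr rfl).1
  have h4 := h2 Word.cons_ne_nil s.arr
  have h5 := h3.smul M.adj_smul γ
  have h6 : endDir s.arr w.1 = endDir s.arr r.1 := rfl
  rw [← hγb] at h3 h4 h5
  have h7 : γ • M.pt s.dep 1 = M.elt w • M.pt (h • s.dep) 1 := by
    rw [hγ, mul_smul, M.κ_smul_pt]
  rw [h7] at h5
  rw [h6] at h4
  constructor
  · rintro ⟨hn, hd⟩ he
    rw [he] at h4
    have e1 := h4.2
    have e2 := h5.2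
    have e3 := M.connected.dist_triangle (u := M.base) (v := M.elt w • M.pt (h • s.dep) 1)
      (w := γ • γ • M.base)
    rw [TreeAction.dist_smul M.adj_smul] at e2
    rw [𝒯.dist_comm, 𝒯.dist_comm (u := γ • M.base)] at e1
    omega
  · intro hne
    refine ⟨fun e => ?_, ?_⟩
    · have := h3.ne
      exact this e.symm
    · have hb : Between 𝒯 M.base (γ • M.base) (γ • γ • M.base) := by
        refine between_of_forall_toward hT fun n h8 h9 => hne ?_
        have := (toward_unique hT h4 h8).trans (toward_unique hT h5 h9).symm
        exact M.pt_one_injective (smul_left_cancel _ this)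
      unfold Between at hb
      rw [TreeAction.dist_smul M.adj_smul] at hb
      omega

theorem length_φ_stepElt_le (s : Step q N) (w : Word q N) :
    (M.φ (M.stepElt s) w).1.length ≤ (w.frame s.arr).rest.1.length + 1 := by
  have hj := Step.joined_dep_of_joined s.joined
  have e1 : M.stepElt s = ((M.e s.dep)⁻¹ * M.lab s.dep s.elt * M.e s.dep) *
      ((M.e s.dep)⁻¹ * M.e s.arr) := by
    unfold stepElt
    group
  rw [e1, map_mul, Equiv.Perm.mul_apply]
  set w' := M.φ ((M.e s.dep)⁻¹ * M.e s.arr) w with hw'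
  obtain ⟨-, -, h3⟩ := M.φ_e_frame s.joined w
  rw [← Word.glue_frame s.dep (M.φ _ w'), M.φ_lab_frame hj w']
  have h4 : (Frame.mulLeft s.elt hj (w'.frame s.dep)).rest = (w.frame s.arr).rest := h3
  rw [← h4]
  generalize Frame.mulLeft s.elt hj (w'.frame s.dep) = x
  by_cases h : s.dep = x.arr ∧ x.elt = 1
  · rw [Frame.glue_of_eq h]
    exact Nat.le_succ _
  · rw [Frame.glue_of_ne h]
    simp [Word.cons]

theorem length_frame_rest_le (d : Dir q) (w : Word q N) :
    (w.frame d).rest.1.length ≤ w.1.length := by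
  by_cases h : w.Avoids d
  · rw [Word.frame_of_avoids h]
  · rcases w.nil_or_cons with rfl | ⟨s, r, hr, rfl⟩
    · exact absurd (Word.nil_avoids d) h
    · rw [Word.cons_avoids, not_not] at h
      subst h
      rw [Word.frame_cons]
      simp [Word.cons]

theorem length_φ_listElt_le (l : List (Step q N)) (w : Word q N) :
    (M.φ (M.listElt l) w).1.length ≤ l.length + w.1.length := by
  induction l with
  | nil => simp
  | cons s l ih =>
    rw [listElt_cons, map_mul, Equiv.Perm.mul_apply]
    have h1 := M.length_φ_stepElt_le s (M.φ (M.listElt l) w)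
    have h2 := length_frame_rest_le s.arr (M.φ (M.listElt l) w)
    rw [List.length_cons]
    omega

/-- Cyclic reduction: every hyperbolic element is conjugate to one that translates the base
vertex along its axis. -/
theorem exists_conj_translates (γ : Γ) (hγ : TreeAction.IsHyperbolic Γ V γ) :
    ∃ g, Translates 𝒯 (g * γ * g⁻¹) M.base := by
  obtain ⟨n, hn⟩ : ∃ n, (M.word γ).1.length = n := ⟨_, rfl⟩
  induction n using Nat.strong_induction_on generalizing γ with
  | _ n ih =>
    obtain ⟨h, hh⟩ := M.exists_eq_elt_mul γ
    rcases (M.word γ).nil_or_cons with hw | ⟨s, r, hr, hw⟩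
    · refine absurd ?_ (hγ M.base)
      rw [hh, hw, elt_nil, one_mul, κ_smul_base]
    by_cases hred : endDir s.arr r.1 = h • s.dep
    swap
    · refine ⟨1, ?_⟩
      rw [one_mul, inv_one, mul_one, hh, hw]
      exact (M.translates_iff s r hr h).2 hred
    rcases List.eq_nil_or_concat r.1 with hnil | ⟨u, s', hu⟩
    · -- a single step that is not cyclically reduced is elliptic
      exfalso
      have hr0 : r = .nil := Subtype.ext hnil
      subst hr0
      have hda : s.dep = s.arr := by
        have hj := s.joined
        revert hj hred
        change s.arr = h • s.dep → _
        generalize s.dep = d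
        generalize s.arr = d'
        intro h1 h2
        cases d with
        | loop s' => exact h1.symm
        | cusp h' =>
          cases d' with
          | loop s' => exact h2.elim
          | cusp h'' => exact congrArg Dir.cusp h2
      have hlev : ∃ k, s.dep.HasLevel N (k + 1) ∧ level s.elt ≤ k + 1 := by
        have hj := s.joined
        rw [← hda] at hj
        revert hj
        generalize s.dep = d
        intro hj
        cases d with
        | loop s' =>
          have := M.one_le
          refine ⟨N - 1, ?_, ?_⟩
          · change N - 1 + 1 ≤ N
            omega
          · have : level s.elt ≤ N := hj
            omega
        | cusp h => exact ⟨level s.elt, trivial, Nat.le_succ _⟩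
      obtain ⟨k, hk, hb⟩ := hlev
      refine hγ (M.pt s.dep (k + 1)) ((M.smul_pt _ _ _ hk).2 ⟨s.elt, h, hb, ?_, ?_⟩)
      · change s.arr = _ at hred
        rw [← hred, hda]
      · rw [hh, hw, elt_cons, elt_nil, mul_one]
        unfold stepElt
        rw [← hda]
    · set γ' := (M.stepElt s)⁻¹ * γ * (M.stepElt s)⁻¹⁻¹ with hγ'
      have hsn : s'.arr = h • s.dep := by
        rw [← hred, hu, List.concat_eq_append, endDir_append_cons]
        rfl
      have e1 : γ' = M.listElt u * (M.stepElt s' * (M.stepElt (h • s) * M.κ h)) := by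
        rw [hγ', hh, hw, elt_cons, ← κ_mul_stepElt]
        have : M.elt r = M.listElt u * M.stepElt s' := by
          unfold elt
          rw [hu, List.concat_eq_append, listElt_append, listElt_cons, listElt_nil, mul_one]
        rw [this]
        group
      have hlt : (M.word γ').1.length < n := by
        have h1 : M.φ (M.stepElt (h • s) * M.κ h) .nil =
          .cons (h • s) .nil (Word.nil_avoids _) := by
          rw [map_mul, Equiv.Perm.mul_apply, M.φ_κ, basePerm_apply, Word.smul_nil]
          exact M.φ_stepElt _ _ _
        have h2 : M.word γ' = M.φ (M.listElt u) (M.φ (M.stepElt s')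
            (.cons (h • s) .nil (Word.nil_avoids _))) := by
          unfold word
          rw [e1, map_mul, Equiv.Perm.mul_apply, map_mul M.φ (M.stepElt s'), Equiv.Perm.mul_apply,
            h1]
        have h3 := M.length_φ_listElt_le u (M.φ (M.stepElt s')
            (.cons (h • s) .nil (Word.nil_avoids _)))
        have h4 := M.length_φ_stepElt_le s' (.cons (h • s) .nil (Word.nil_avoids _))
        have h5 : (Word.cons (h • s) .nil (Word.nil_avoids _) : Word q N).frame s'.arr =
            ⟨s.elt, h • s.arr, .nil, by rw [hsn]; exact s.joined.smul h, Word.nil_avoids _⟩ := by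
          have key : ∀ d (hd : d = (h • s).dep),
              (Word.cons (h • s) .nil (Word.nil_avoids _) : Word q N).frame d =
                ⟨s.elt, h • s.arr, .nil, by rw [hd]; exact s.joined.smul h,
                  Word.nil_avoids _⟩ := by
            rintro _ rfl
            exact Word.frame_cons (h • s) .nil _
          exact key _ hsn
        have h6 : (Word.nil : Word q N).1.length = 0 := rfl
        rw [h5, h6] at h4
        have h7 : n = u.length + 2 := by
          rw [← hn, hw]
          simp [Word.cons, hu]
        rw [h2]
        omega
      obtain ⟨g, hg⟩ := ih _ hlt γ' (TreeAction.isHyperbolic_conj _ _ hγ) rfl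
      refine ⟨g * (M.stepElt s)⁻¹, ?_⟩
      convert hg using 1
      rw [hγ']
      group

end LoopCuspTree

end LoopWithCusp

/-! ### Centralizers of translations -/

namespace LoopWithCusp

open TreeGeometry

variable {q N : ℕ} {Γ V : Type} [Group Γ] [MulAction Γ V] {𝒯 : SimpleGraph V}

theorem listLen_append (l l' : List (Step q N)) : listLen (l ++ l') = listLen l + listLen l' := by
  simp [listLen]

/-- The length of the first step of a list. -/
def headLen : List (Step q N) → ℕ
  | [] => 0
  | s :: _ => s.len

theorem isChain_rotate {s : Step q N} {l : List (Step q N)} {h : Multiplicative (ZMod (q - 1))}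
    (hl : (s :: l).IsChain (fun s s' => s.arr ≠ s'.dep)) (hne : endDir s.arr l ≠ h • s.dep)
    (i : ℕ) : ((s :: l).drop i ++ ((s :: l).take i).map (h • ·)).IsChain
      (fun s s' => s.arr ≠ s'.dep) := by
  refine List.isChain_append.2 ⟨hl.drop i, ?_, fun x hx y hy => ?_⟩
  · rw [List.isChain_map]
    exact (hl.take i).imp fun s s' h e => h (smul_left_cancel _ e)
  · cases i with
    | zero => simp at hy
    | succ i =>
      obtain rfl : h • s = y := by simpa using hy
      obtain ⟨l', hl'⟩ := List.getLast?_eq_some_iff.1 hx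
      rw [List.drop_succ_cons] at hl'
      have h1 : l = (l.take i ++ l') ++ x :: [] := by
        rw [List.append_assoc, ← hl', List.take_append_drop]
      rw [h1, endDir_append_cons] at hne
      exact hne

theorem finite_dir (hq : 2 ≤ q) : Finite (Dir q) := by
  have h1 : NeZero (q - 1) := ⟨by omega⟩
  refine Finite.of_injective
    (fun d : Dir q => (match d with
      | .loop s => Sum.inl s
      | .cusp h => Sum.inr h : Bool ⊕ Multiplicative (ZMod (q - 1)))) ?_
  rintro (s | h) (s' | h') <;> simp

theorem finite_level_le (hq : 2 ≤ q) (k : ℕ) : {b : GInf q | level b ≤ k}.Finite := by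
  have h2 : NeZero q := ⟨by omega⟩
  have : Finite {b : GInf q // level b ≤ k} := Finite.of_equiv _ (levelLeEquiv q k).symm
  exact this

theorem Step.level_le (s : Step q N) : level s.elt ≤ max s.len N := by
  unfold Step.len
  split_ifs with h
  · omega
  · refine le_trans ?_ (le_max_right _ _)
    obtain ⟨d, d', b, hj, hne⟩ := s
    cases d <;> cases d' <;> first | exact hj.elim | exact hj | exact absurd (congrArg _ hj) h

theorem finite_step_len_le (hq : 2 ≤ q) (m : ℕ) : {s : Step q N | s.len ≤ m}.Finite := by
  have hd := finite_dir hq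
  refine Set.Finite.of_finite_image (f := fun s : Step q N => (s.dep, s.arr, s.elt)) ?_ ?_
  · refine ((Set.finite_univ (α := Dir q)).prod ((Set.finite_univ (α := Dir q)).prod
      (finite_level_le hq (max m N)))).subset ?_
    rintro _ ⟨s, hs, rfl⟩
    exact ⟨trivial, trivial, s.level_le.trans (max_le_max hs le_rfl)⟩
  · intro s _ s' _ e
    simp only [Prod.mk.injEq] at e
    exact Step.ext e.1 e.2.1 e.2.2

theorem length_le_listLen (l : List (Step q N)) : l.length ≤ listLen l := by
  induction l with
  | nil => simp
  | cons s l ih =>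
    rw [List.length_cons, listLen_cons]
    have := s.len_pos
    omega

theorem finite_listLen_le (hq : 2 ≤ q) (m : ℕ) : {l : List (Step q N) | listLen l ≤ m}.Finite := by
  have : Finite {s : Step q N // s.len ≤ m} := finite_step_len_le hq m
  refine ((List.finite_length_le {s : Step q N // s.len ≤ m} m).image
    (List.map Subtype.val)).subset ?_
  intro l hl
  have h1 : ∀ s ∈ l, s.len ≤ m := fun s hs =>
    (List.single_le_sum (by simp) _ (List.mem_map_of_mem hs)).trans hl
  refine ⟨l.attach.map fun s => ⟨s.1, h1 s.1 s.2⟩, ?_, ?_⟩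
  · rw [Set.mem_ofPred_eq, List.length_map, List.length_attach]
    exact (length_le_listLen l).trans hl
  · rw [List.map_map]
    exact List.attach_map_subtype_val l

theorem finite_word_listLen_le (hq : 2 ≤ q) (m : ℕ) : {w : Word q N | listLen w.1 ≤ m}.Finite :=
  Set.Finite.of_finite_image (f := Subtype.val)
    ((finite_listLen_le hq m).subset (by rintro _ ⟨w, hw, rfl⟩; exact hw))
    Subtype.val_injective.injOn

namespace LoopCuspTree

variable (M : LoopCuspTree q N Γ V 𝒯)

/-- The elements that translate the base vertex by the distance `m` along their axis. -/
def translations (m : ℕ) : Set Γ :=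
  {γ | Translates 𝒯 γ M.base ∧ 𝒯.dist M.base (γ • M.base) = m}

include M in
theorem finite_units : Finite (Multiplicative (ZMod (q - 1))) := by
  have h1 : NeZero (q - 1) := ⟨by have := M.two_le; omega⟩
  infer_instance

theorem finite_translations (m : ℕ) : (M.translations m).Finite := by
  have hC := M.finite_units
  refine (((finite_word_listLen_le M.two_le m).prod
    (Set.finite_univ (α := Multiplicative (ZMod (q - 1))))).image
    fun x => M.elt x.1 * M.κ x.2).subset ?_
  rintro γ ⟨_, h⟩
  obtain ⟨c, hc⟩ := M.exists_eq_elt_mul γ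
  exact ⟨(M.word γ, c), ⟨(M.dist_smul_base γ ▸ h).le, trivial⟩, hc.symm⟩

theorem κ_mul_listElt (c : Multiplicative (ZMod (q - 1))) (l : List (Step q N)) :
    M.κ c * M.listElt l = M.listElt (l.map (c • ·)) * M.κ c := by
  induction l with
  | nil => simp
  | cons s l ih =>
    rw [List.map_cons, listElt_cons, listElt_cons, ← mul_assoc, κ_mul_stepElt, mul_assoc, ih,
      mul_assoc]

theorem dist_listElt {l : List (Step q N)} (hl : l.IsChain (fun s s' => s.arr ≠ s'.dep)) :
    𝒯.dist M.base (M.listElt l • M.base) = listLen l :=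
  M.dist_elt ⟨l, hl⟩

theorem word_listElt_mul {l : List (Step q N)} (hl : l.IsChain (fun s s' => s.arr ≠ s'.dep))
    (c : Multiplicative (ZMod (q - 1))) : M.word (M.listElt l * M.κ c) = ⟨l, hl⟩ :=
  M.word_elt_mul ⟨l, hl⟩ c

theorem between_take (w : Word q N) (i : ℕ) :
    Between 𝒯 M.base (M.listElt (w.1.take i) • M.base) (M.elt w • M.base) := by
  have h1 : M.elt w = M.listElt (w.1.take i) * M.listElt (w.1.drop i) := by
    rw [← listElt_append, List.take_append_drop]
    rfl
  unfold Between
  rw [M.dist_elt, h1, mul_smul, TreeAction.dist_smul M.adj_smul, M.dist_listElt (w.2.take i),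
    M.dist_listElt (w.2.drop i), ← listLen_append, List.take_append_drop]

section

variable {M}

/-- If `u` commutes with the translation `γ`, some `γ^k u` moves the base vertex to a vertex
between the base vertex and its image under `γ`. -/
theorem exists_zpow_between {γ u : Γ} (hγ : Translates 𝒯 γ M.base) (hu : u * γ = γ * u) :
    ∃ k : ℤ, Between 𝒯 M.base ((γ ^ k * u) • M.base) (γ • M.base) := by
  obtain ⟨k, hk⟩ := hγ.exists_between M.isTree M.adj_smul (y := u • M.base) (by
    rw [← mul_smul, ← hu, mul_smul, TreeAction.dist_smul M.adj_smul])
  refine ⟨-k, ?_⟩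
  have := hk.smul M.adj_smul (γ ^ (-k))
  rwa [smul_smul, smul_smul, smul_smul, smul_smul, ← zpow_add, neg_add_cancel, zpow_zero, one_smul,
    (Commute.refl γ).zpow_left (-k), mul_assoc, ← zpow_add, neg_add_cancel, zpow_zero,
    mul_one] at this

/-- An element that commutes with a translation and fixes a point of its axis fixes the axis. -/
theorem mem_axisCentralizer {γ u : Γ} (hγ : Translates 𝒯 γ M.base) (hu : u * γ = γ * u)
    (hfix : u • M.base = M.base) : u ∈ TreeAction.axisCentralizer 𝒯 γ := by
  refine Subgroup.mem_inf.2 ⟨Subgroup.mem_centralizer_singleton_iff.2 hu, ?_⟩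
  rw [mem_fixingSubgroup_iff]
  intro y hy
  rw [hγ.mem_axis_iff M.isTree M.adj_smul] at hy
  obtain ⟨k, hk⟩ := hγ.exists_between M.isTree M.adj_smul hy
  have h1 : u • γ ^ k • M.base = γ ^ k • M.base := by
    have hc : u * γ ^ k = γ ^ k * u := (Commute.zpow_right (show Commute u γ from hu) k)
    rw [← mul_smul, hc, mul_smul, hfix]
  have h2 : u • γ • γ ^ k • M.base = γ • γ ^ k • M.base := by
    rw [← mul_smul, hu, mul_smul, h1]
  have h3 := hk.smul M.adj_smul u
  rw [h1, h2] at h3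
  refine (h3.eq_of_dist_eq M.isTree hk ?_)
  conv_lhs => rw [← h1]
  rw [TreeAction.dist_smul M.adj_smul]

theorem smul_base_of_mem_axisCentralizer {γ u : Γ} (hγ : Translates 𝒯 γ M.base)
    (hu : u ∈ TreeAction.axisCentralizer 𝒯 γ) {y : V}
    (hy : 𝒯.dist y (γ • y) = 𝒯.dist M.base (γ • M.base)) : u • y = y :=
  (mem_fixingSubgroup_iff Γ).1 (Subgroup.mem_inf.1 hu).2 y
    ((hγ.mem_axis_iff M.isTree M.adj_smul y).2 hy)

/-- If `z` commutes with the translation `γ` and moves the base vertex towards its image under `γ`,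
then `z` is a translation. -/
theorem translates_of_between {γ z : Γ} (hγ : Translates 𝒯 γ M.base) (hz : z * γ = γ * z)
    (hb : Between 𝒯 M.base (z • M.base) (γ • M.base)) (hne : z • M.base ≠ M.base) (j : ℕ) :
    𝒯.dist M.base (z ^ j • M.base) = j * 𝒯.dist M.base (z • M.base) ∧
      Between 𝒯 M.base (z ^ j • M.base) (γ ^ j • M.base) ∧ Translates 𝒯 z M.base := by
  have hT := M.isTree.connected
  have hpow : ∀ (g : Γ) (j : ℕ), 𝒯.dist M.base (g ^ j • M.base) ≤
    j * 𝒯.dist M.base (g • M.base) := by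
    intro g j
    induction j with
    | zero => simp
    | succ j ih =>
      have := hT.dist_triangle (u := M.base) (v := g ^ j • M.base) (w := g ^ (j + 1) • M.base)
      rw [pow_succ, mul_smul, TreeAction.dist_smul M.adj_smul] at this
      rw [pow_succ, mul_smul, add_mul, one_mul]
      omega
  have key : ∀ j : ℕ, 𝒯.dist M.base (z ^ j • M.base) = j * 𝒯.dist M.base (z • M.base) ∧
      Between 𝒯 M.base (z ^ j • M.base) (γ ^ j • M.base) := by
    intro j
    -- `γ = z v` with `v` commuting with `z`, and `v` moves the base by the remaining distance.
    obtain ⟨v, hv⟩ : ∃ v, v = z⁻¹ * γ := ⟨_, rfl⟩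
    have hγv : γ = z * v := by rw [hv, mul_inv_cancel_left]
    have hcomm : Commute z v := by
      rw [hv]
      exact (Commute.inv_right (Commute.refl z)).mul_right hz
    have h1 : 𝒯.dist (z • M.base) (γ • M.base) = 𝒯.dist M.base (v • M.base) := by
      rw [hγv, mul_smul, TreeAction.dist_smul M.adj_smul]
    have h2 : 𝒯.dist (z ^ j • M.base) (γ ^ j • M.base) = 𝒯.dist M.base (v ^ j • M.base) := by
      rw [hγv, hcomm.mul_pow, mul_smul, TreeAction.dist_smul M.adj_smul]
    have h3 := hT.dist_triangle (u := M.base) (v := z ^ j • M.base) (w := γ ^ j • M.base)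
    have h4 := hpow z j
    have h5 := hpow v j
    rw [hγ.dist_pow M.isTree M.adj_smul] at h3
    unfold Between at hb ⊢
    rw [hγ.dist_pow M.isTree M.adj_smul]
    rw [h1] at hb
    rw [← hb, mul_add] at h3 ⊢
    omega
  refine ⟨(key j).1, (key j).2, hne, ?_⟩
  have := (key 2).1
  rwa [pow_two, mul_smul] at this

/-- The centralizer of a translation is generated by a root and by elements fixing the axis: here is
a root `z` with the minimal distance. -/
theorem exists_root {γ : Γ} (hγ : Translates 𝒯 γ M.base) :
    ∃ (z : Γ) (j : ℕ) (c : Multiplicative (ZMod (q - 1))), Translates 𝒯 z M.base ∧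
      γ = z ^ j * M.κ c ∧ j * 𝒯.dist M.base (z • M.base) = 𝒯.dist M.base (γ • M.base) ∧
      (j = 1 → ∀ u, u * γ = γ * u → ∃ k : ℤ, ∃ a ∈ TreeAction.axisCentralizer 𝒯 γ, u =
        γ ^ k * a) := by
  classical
  have hT := M.isTree.connected
  let Q : ℕ → Prop := fun s => 0 < s ∧ ∃ z : Γ, z * γ = γ * z ∧
    Between 𝒯 M.base (z • M.base) (γ • M.base) ∧ 𝒯.dist M.base (z • M.base) = s
  have hQ : ∃ s, Q s := ⟨_, hγ.dist_pos M.isTree, γ, rfl, by simp [Between], rfl⟩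
  obtain ⟨hs, z, hz, hb, hd⟩ := Nat.find_spec hQ
  have hmin : ∀ s, Q s → Nat.find hQ ≤ s := fun s h => Nat.find_min' hQ h
  set s := Nat.find hQ
  have hne : z • M.base ≠ M.base := by
    intro e
    rw [e, SimpleGraph.dist_self] at hd
    omega
  have htr := translates_of_between hγ hz hb hne
  obtain ⟨m, hm⟩ : ∃ m, 𝒯.dist M.base (γ • M.base) = m := ⟨_, rfl⟩
  obtain ⟨j, hj⟩ : ∃ j, j = m / s := ⟨_, rfl⟩
  have hsm : s ≤ m := by
    have := hb
    unfold Between at this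
    omega
  have hj0 : 1 ≤ j := by rw [hj]; exact (Nat.one_le_div_iff hs).2 hsm
  have hjm : j * s ≤ m := by rw [hj]; exact Nat.div_mul_le_self m s
  have hlt : m < j * s + s := by
    rw [hj]
    have := Nat.lt_div_mul_add hs (a := m)
    exact this
  have hzj : z ^ j * γ = γ * z ^ j := (Commute.pow_left (show Commute z γ from hz) j)
  have hb1 : Between 𝒯 M.base (z ^ j • M.base) (γ • M.base) := by
    have h2 : Between 𝒯 M.base (γ • M.base) (γ ^ j • M.base) := by
      unfold Between
      have e : γ ^ j = γ * γ ^ (j - 1) := by rw [← pow_succ', Nat.sub_add_cancel hj0]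
      rw [hγ.dist_pow M.isTree M.adj_smul, e, mul_smul, TreeAction.dist_smul M.adj_smul,
        hγ.dist_pow M.isTree M.adj_smul]
      obtain ⟨i, rfl⟩ : ∃ i, j = i + 1 := ⟨j - 1, by omega⟩
      rw [Nat.add_sub_cancel]
      ring
    refine (htr j).2.1.order M.isTree h2 ?_
    rw [(htr j).1, hd, hm]
    exact hjm
  have hb2 : 𝒯.dist M.base (((z ^ j)⁻¹ * γ) • M.base) + j * s = m := by
    unfold Between at hb1
    rw [(htr j).1, hd, hm] at hb1
    rw [mul_smul, dist_inv_smul M.adj_smul]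
    omega
  have hfix : ((z ^ j)⁻¹ * γ) • M.base = M.base := by
    by_contra hne'
    have hpos : 0 < 𝒯.dist M.base (((z ^ j)⁻¹ * γ) • M.base) :=
      (hT.pos_dist_of_ne (Ne.symm hne'))
    have := hmin _ ⟨hpos, (z ^ j)⁻¹ * γ, ?_, ?_, rfl⟩
    · omega
    · rw [mul_assoc, inv_mul_eq_iff_eq_mul, ← mul_assoc, ← mul_assoc, hzj, mul_assoc γ,
        mul_inv_cancel, mul_one]
    · unfold Between
      have h6 : 𝒯.dist (((z ^ j)⁻¹ * γ) • M.base) (γ • M.base) = j * s := by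
        rw [← TreeAction.dist_smul M.adj_smul (z ^ j), ← mul_smul, ← mul_smul, mul_inv_cancel_left,
          hzj, mul_smul, TreeAction.dist_smul M.adj_smul, (htr j).1, hd]
      rw [hm, h6]
      exact hb2
  obtain ⟨c, hc⟩ := M.smul_base _ hfix
  rw [inv_mul_eq_iff_eq_mul] at hc
  have hms : j * s = m := by
    rw [hfix, SimpleGraph.dist_self] at hb2
    omega
  refine ⟨z, j, c, (htr 1).2.2, hc, by rw [hd, hm, hms], ?_⟩
  rintro rfl u hu
  obtain ⟨k, hk⟩ := exists_zpow_between hγ hu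
  have hcomm : ∀ k : ℤ, (γ ^ k * u) * γ = γ * (γ ^ k * u) := fun k =>
    ((Commute.refl γ).zpow_left k).mul_left hu
  -- The image of the base under `γ^k u` is one of the two ends.
  have hends : (γ ^ k * u) • M.base = M.base ∨ (γ ^ k * u) • M.base = γ • M.base := by
    by_contra! hne'
    have h1 := hmin _ ⟨hT.pos_dist_of_ne (Ne.symm hne'.1), γ ^ k * u, hcomm k, hk, rfl⟩
    have h2 := hT.pos_dist_of_ne hne'.2
    unfold Between at hk
    omega
  obtain ⟨k', hk'⟩ : ∃ k' : ℤ, (γ ^ k' * u) • M.base = M.base := by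
    rcases hends with h | h
    · exact ⟨k, h⟩
    · refine ⟨-1 + k, ?_⟩
      rw [zpow_add, mul_assoc, mul_smul, h, zpow_neg_one, inv_smul_smul]
  refine ⟨-k', γ ^ k' * u, mem_axisCentralizer hγ (hcomm k') hk', ?_⟩
  rw [← mul_assoc, ← zpow_add, neg_add_cancel, zpow_zero, one_mul]

end

end LoopCuspTree

end LoopWithCusp

/-! ### The sum over the conjugacy classes of translations -/

namespace LoopWithCusp

open TreeGeometry

namespace LoopCuspTree

variable {q N : ℕ} {Γ V : Type} [Group Γ] [MulAction Γ V] {𝒯 : SimpleGraph V}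
  (M : LoopCuspTree q N Γ V 𝒯)

/-- The element that conjugates `γ` to its cyclic rotation by `i` steps, twisted by `c`. -/
def rotator (γ : Γ) (c : Multiplicative (ZMod (q - 1))) (i : ℕ) : Γ :=
  M.listElt ((M.word γ).1.take i) * M.κ c

/-- The length of the first step towards `γ • base`. -/
def gap (γ : Γ) : ℕ := headLen (M.word γ).1

theorem rotator_smul_base (γ : Γ) (c : Multiplicative (ZMod (q - 1))) (i : ℕ) :
    M.rotator γ c i • M.base = M.listElt ((M.word γ).1.take i) • M.base := by
  rw [rotator, mul_smul, κ_smul_base]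

theorem between_rotator (γ : Γ) (c : Multiplicative (ZMod (q - 1))) (i : ℕ) :
    Between 𝒯 M.base (M.rotator γ c i • M.base) (γ • M.base) := by
  rw [rotator_smul_base, M.smul_base_eq γ]
  exact M.between_take _ i

theorem dist_rotator (γ : Γ) (c : Multiplicative (ZMod (q - 1))) (i : ℕ) :
    𝒯.dist M.base (M.rotator γ c i • M.base) = listLen ((M.word γ).1.take i) := by
  rw [rotator_smul_base, M.dist_listElt ((M.word γ).2.take i)]

theorem rotator_injective {γ : Γ} {c c' : Multiplicative (ZMod (q - 1))} {i i' : ℕ}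
    (hi : i ≤ (M.word γ).1.length) (hi' : i' ≤ (M.word γ).1.length)
    (h : M.rotator γ c i = M.rotator γ c' i') : c = c' ∧ i = i' := by
  have h1 := congrArg M.word h
  rw [rotator, rotator, M.word_listElt_mul ((M.word γ).2.take i),
    M.word_listElt_mul ((M.word γ).2.take i')] at h1
  have h2 := congrArg (fun w => w.1.length) h1
  simp only [List.length_take] at h2
  obtain rfl : i = i' := by omega
  exact ⟨M.κ_injective (mul_left_cancel h), rfl⟩

section

variable {M} {γ : Γ} {m : ℕ}

theorem rotate_mem (hγ : γ ∈ M.translations m) (c : Multiplicative (ZMod (q - 1))) (i : ℕ) :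
    (M.rotator γ c i)⁻¹ * γ * M.rotator γ c i ∈ M.translations m := by
  obtain ⟨h1, h2⟩ := hγ.1.of_between M.isTree M.adj_smul (M.between_rotator γ c i)
  have h3 := h2.conj M.adj_smul (M.rotator γ c i)⁻¹
  rw [inv_inv, inv_smul_smul] at h3
  refine ⟨h3, ?_⟩
  rw [mul_assoc, mul_smul, dist_inv_smul M.adj_smul, mul_smul, h1]
  exact hγ.2

/-- The gap of the `i`-th rotation of a translation is the length of the `i`-th step of its word. -/
theorem gap_rotate (hγ : γ ∈ M.translations m) (c : Multiplicative (ZMod (q - 1)))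
    {i : ℕ} (hi : i < (M.word γ).1.length) :
    M.gap ((M.rotator γ c i)⁻¹ * γ * M.rotator γ c i) = ((M.word γ).1[i]).len := by
  obtain ⟨h, hh⟩ := M.exists_eq_elt_mul γ
  rcases (M.word γ).nil_or_cons with hw | ⟨s, r, hr, hw⟩
  · refine absurd ?_ hγ.1.1
    rw [hw, elt_nil, one_mul] at hh
    rw [hh, κ_smul_base]
  have hne : endDir s.arr r.1 ≠ h • s.dep := by
    rw [← M.translates_iff s r hr h, ← hw, ← hh]
    exact hγ.1
  have hwl : (M.word γ).1 = s :: r.1 := by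
    rw [hw]
    rfl
  have hch : ((M.word γ).1.drop i ++ ((M.word γ).1.take i).map (h • ·)).IsChain
      (fun s s' => s.arr ≠ s'.dep) := by
    rw [hwl]
    refine isChain_rotate ?_ hne i
    rw [← hwl]
    exact (M.word γ).2
  have hch' : (((M.word γ).1.drop i ++ ((M.word γ).1.take i).map (h • ·)).map (c⁻¹ • ·)).IsChain
      (fun s s' => s.arr ≠ s'.dep) := by
    rw [List.isChain_map]
    exact hch.imp fun s s' h e => h (smul_left_cancel _ e)
  have e1 : (M.rotator γ c i)⁻¹ * γ * M.rotator γ c i =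
      M.listElt (((M.word γ).1.drop i ++ ((M.word γ).1.take i).map (h • ·)).map (c⁻¹ • ·)) *
        M.κ (c⁻¹ * h * c) := by
    have e2 : γ = M.listElt ((M.word γ).1.take i) * M.listElt ((M.word γ).1.drop i) * M.κ h := by
      rw [← listElt_append, List.take_append_drop]
      exact hh
    have e3 : (M.rotator γ c i)⁻¹ * γ * M.rotator γ c i =
        M.κ c⁻¹ * (M.listElt ((M.word γ).1.drop i) *
          (M.κ h * M.listElt ((M.word γ).1.take i))) * M.κ c := by
      calc _ = (M.rotator γ c i)⁻¹ * (M.listElt ((M.word γ).1.take i) *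
            M.listElt ((M.word γ).1.drop i) * M.κ h) * M.rotator γ c i := by rw [← e2]
        _ = _ := by
          rw [rotator, map_inv]
          group
    rw [e3, κ_mul_listElt, ← mul_assoc (M.listElt _), ← listElt_append, ← mul_assoc (M.κ c⁻¹),
      κ_mul_listElt, map_mul, map_mul]
    group
  unfold gap
  rw [e1, M.word_listElt_mul hch']
  have e4 : (M.word γ).1.drop i = (M.word γ).1[i] :: (M.word γ).1.drop (i + 1) :=
    List.drop_eq_getElem_cons hi
  change headLen (List.map _ (List.drop _ _ ++ _)) = _
  rw [e4]
  exact Step.len_smul _ _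

theorem length_word_pos (hγ : γ ∈ M.translations m) : 0 < (M.word γ).1.length := by
  by_contra h0
  have h1 : (M.word γ).1 = [] := List.eq_nil_of_length_eq_zero (by omega)
  have h2 := hγ.1.dist_pos M.isTree
  rw [M.dist_smul_base, h1] at h2
  simp at h2

/-- Every conjugate that again translates along the base point is one of the rotations. -/
theorem exists_eq_rotate (hγ : γ ∈ M.translations m) {g : Γ}
    (hg : g * γ * g⁻¹ ∈ M.translations m) :
    ∃ c, ∃ i < (M.word γ).1.length,
      (M.rotator γ c i)⁻¹ * γ * M.rotator γ c i = g * γ * g⁻¹ := by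
  obtain ⟨k, hk⟩ := hγ.1.exists_between M.isTree M.adj_smul (y := g⁻¹ • M.base) (by
    rw [hγ.2, ← hg.2, ← TreeAction.dist_smul M.adj_smul g, smul_inv_smul, mul_smul, mul_smul])
  have h1 := hk.smul M.adj_smul (γ ^ (-k))
  rw [smul_smul, smul_smul, smul_smul, smul_smul, ← zpow_add, neg_add_cancel, zpow_zero, one_smul,
    (Commute.refl γ).zpow_left (-k), mul_assoc, ← zpow_add, neg_add_cancel, zpow_zero,
    mul_one, M.smul_base_eq γ] at h1
  obtain ⟨i, hi, h2⟩ := M.exists_take_of_between _ _ h1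
  obtain ⟨k', i', hi', h3⟩ : ∃ (k' : ℤ) (i' : ℕ), i' < (M.word γ).1.length ∧
      (γ ^ k' * g⁻¹) • M.base = M.listElt ((M.word γ).1.take i') • M.base := by
    rcases hi.lt_or_eq with hlt | rfl
    · exact ⟨-k, i, hlt, h2⟩
    · refine ⟨-1 + -k, 0, length_word_pos hγ, ?_⟩
      rw [List.take_length] at h2
      rw [zpow_add, mul_assoc, mul_smul, h2, List.take_zero, listElt_nil, one_smul, zpow_neg_one,
        inv_smul_eq_iff]
      exact (M.smul_base_eq γ).symm
  obtain ⟨c, hc⟩ := M.smul_base ((M.listElt ((M.word γ).1.take i'))⁻¹ * (γ ^ k' * g⁻¹)) (by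
    rw [mul_smul, h3, inv_smul_smul])
  refine ⟨c, i', hi', ?_⟩
  have h4 : M.rotator γ c i' = γ ^ k' * g⁻¹ := by
    rw [rotator, ← hc, mul_inv_cancel_left]
  have h5 : γ ^ k' * γ = γ * γ ^ k' := (Commute.refl γ).zpow_left k'
  rw [h4, mul_inv_rev, inv_inv]
  calc g * (γ ^ k')⁻¹ * γ * (γ ^ k' * g⁻¹) = g * (γ ^ k')⁻¹ * (γ * γ ^ k') * g⁻¹ := by group
    _ = g * γ * g⁻¹ := by rw [← h5]; group

/-- A translation `γ` is generic if its centralizer consists of the products of powers of `γ` and of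
elements that fix the axis. -/
def IsGeneric (𝒯 : SimpleGraph V) (γ : Γ) : Prop :=
  ∀ u, u * γ = γ * u → ∃ k : ℤ, ∃ a ∈ TreeAction.axisCentralizer 𝒯 γ, u = γ ^ k * a

theorem rotate_eq_iff {u v : Γ} : u⁻¹ * γ * u = v⁻¹ * γ * v ↔ (v * u⁻¹) * γ = γ * (v * u⁻¹) := by
  constructor
  · intro h
    calc v * u⁻¹ * γ = v * (u⁻¹ * γ * u) * u⁻¹ := by group
      _ = γ * (v * u⁻¹) := by rw [h]; group
  · intro h
    calc u⁻¹ * γ * u = v⁻¹ * (v * u⁻¹ * γ) * u := by group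
      _ = v⁻¹ * γ * v := by rw [h]; group

/-- The rotations of a generic translation coincide exactly if they differ by elements that fix the
axis. -/
theorem mul_inv_mem_axisCentralizer (hγ : γ ∈ M.translations m) (hgen : IsGeneric 𝒯 γ)
    {c c' : Multiplicative (ZMod (q - 1))} {i i' : ℕ} (hi : i < (M.word γ).1.length)
    (hi' : i' < (M.word γ).1.length)
    (h : (M.rotator γ c i)⁻¹ * γ * M.rotator γ c i =
      (M.rotator γ c' i')⁻¹ * γ * M.rotator γ c' i') :
    M.rotator γ c' i' * (M.rotator γ c i)⁻¹ ∈ TreeAction.axisCentralizer 𝒯 γ := by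
  obtain ⟨k, a, ha, hk⟩ := hgen _ (rotate_eq_iff.1 h)
  have h1 := hγ.1.of_between M.isTree M.adj_smul (M.between_rotator γ c i)
  have h2 := smul_base_of_mem_axisCentralizer hγ.1 ha h1.1
  have h3 : M.rotator γ c' i' • M.base = γ ^ k • M.rotator γ c i • M.base := by
    have := congrArg (· • M.rotator γ c i • M.base) hk
    simp only [mul_smul, inv_smul_smul, h2] at this
    exact this
  have h4 := h1.2.dist_zpow M.isTree M.adj_smul k
  rw [← h3, h1.1, hγ.2] at h4
  -- both points lie strictly before `γ • base`, so that their distance is less than `m`.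
  have hlt : ∀ (c : Multiplicative (ZMod (q - 1))) (i : ℕ), i < (M.word γ).1.length →
      𝒯.dist M.base (M.rotator γ c i • M.base) < m := by
    intro c i hi
    rw [dist_rotator, ← hγ.2, M.dist_smul_base]
    conv_rhs => rw [← List.take_append_drop i (M.word γ).1, listLen_append]
    have := length_le_listLen ((M.word γ).1.drop i)
    rw [List.length_drop] at this
    omega
  have hd : 𝒯.dist (M.rotator γ c i • M.base) (M.rotator γ c' i' • M.base) < m := by
    have h5 := hlt c i hi
    have h6 := hlt c' i' hi'
    rcases le_total (𝒯.dist M.base (M.rotator γ c i • M.base))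
      (𝒯.dist M.base (M.rotator γ c' i' • M.base)) with hle | hle
    · have := (M.between_rotator γ c i).order M.isTree (M.between_rotator γ c' i') hle
      unfold Between at this
      omega
    · have := (M.between_rotator γ c' i').order M.isTree (M.between_rotator γ c i) hle
      unfold Between at this
      rw [𝒯.dist_comm]
      omega
  have hk0 : k = 0 := by
    by_contra hk0
    have h7 : 1 ≤ k.natAbs := Int.natAbs_pos.2 hk0
    have := Nat.mul_le_mul_right m h7
    omega
  rw [hk, hk0, zpow_zero, one_mul]
  exact ha

/-- For a generic translation, the number of indices that give the same rotation is the order of the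
axis centralizer. -/
theorem card_rotate_eq (hγ : γ ∈ M.translations m) (hgen : IsGeneric 𝒯 γ)
    (x : Multiplicative (ZMod (q - 1)) × Fin (M.word γ).1.length) :
    Nat.card {y : Multiplicative (ZMod (q - 1)) × Fin (M.word γ).1.length //
      (M.rotator γ y.1 y.2)⁻¹ * γ * M.rotator γ y.1 y.2 =
        (M.rotator γ x.1 x.2)⁻¹ * γ * M.rotator γ x.1 x.2} =
      Nat.card (TreeAction.axisCentralizer 𝒯 γ) := by
  refine Nat.card_congr (Equiv.ofBijective (fun y => ⟨M.rotator γ y.1.1 y.1.2 *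
    (M.rotator γ x.1 x.2)⁻¹, mul_inv_mem_axisCentralizer hγ hgen x.2.2 y.1.2.2 y.2.symm⟩)
    ⟨?_, ?_⟩)
  · intro y y' h
    have h1 := mul_right_cancel (congrArg Subtype.val h)
    obtain ⟨h2, h3⟩ := M.rotator_injective y.1.2.2.le y'.1.2.2.le h1
    exact Subtype.ext (Prod.ext h2 (Fin.ext h3))
  · rintro ⟨u, hu⟩
    have h1 := hγ.1.of_between M.isTree M.adj_smul (M.between_rotator γ x.1 x.2)
    have h2 := smul_base_of_mem_axisCentralizer hγ.1 hu h1.1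
    obtain ⟨c, hc⟩ := M.smul_base ((M.rotator γ x.1 x.2)⁻¹ * (u * M.rotator γ x.1 x.2)) (by
      rw [mul_smul, mul_smul, h2, inv_smul_smul])
    have h3 : M.rotator γ (x.1 * c) x.2 * (M.rotator γ x.1 x.2)⁻¹ = u := by
      have : M.rotator γ (x.1 * c) x.2 = M.rotator γ x.1 x.2 * M.κ c := by
        rw [rotator, map_mul, ← mul_assoc]
        rfl
      rw [this, ← hc]
      group
    refine ⟨⟨(x.1 * c, x.2), ?_⟩, Subtype.ext h3⟩
    rw [eq_comm, rotate_eq_iff, h3]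
    exact Subgroup.mem_centralizer_singleton_iff.1 (Subgroup.mem_inf.1 hu).1

end

/-- The finite set of the translations by the distance `m`. -/
def shell (m : ℕ) : Finset Γ := (M.finite_translations m).toFinset

theorem mem_shell {m : ℕ} {γ : Γ} : γ ∈ M.shell m ↔ γ ∈ M.translations m :=
  Set.Finite.mem_toFinset _

section

variable {M} {γ : Γ} {m : ℕ}

open Classical in
/-- The gaps of the translations in one conjugacy class sum to `(q - 1) * m`, divided by the
order of the axis centralizer, in the generic case; in general this is an upper bound. -/
theorem sum_gap_conj (hγ : γ ∈ M.translations m) :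
    ∑ γ' ∈ M.shell m with ConjClasses.mk γ' = ConjClasses.mk γ, M.gap γ' ≤ (q - 1) * m ∧
    (IsGeneric 𝒯 γ → Nat.card (TreeAction.axisCentralizer 𝒯 γ) *
      ∑ γ' ∈ M.shell m with ConjClasses.mk γ' = ConjClasses.mk γ, M.gap γ' = (q - 1) * m ∧
      0 < Nat.card (TreeAction.axisCentralizer 𝒯 γ)) := by
  have hne : NeZero (q - 1) := ⟨by have := M.two_le; omega⟩
  let f : Multiplicative (ZMod (q - 1)) × Fin (M.word γ).1.length → Γ := fun x =>
    (M.rotator γ x.1 x.2)⁻¹ * γ * M.rotator γ x.1 x.2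
  set t := {γ' ∈ M.shell m | ConjClasses.mk γ' = ConjClasses.mk γ} with ht
  have hmaps : ∀ x ∈ Finset.univ, f x ∈ t := by
    intro x _
    rw [ht, Finset.mem_filter, mem_shell]
    refine ⟨rotate_mem hγ _ _, ?_⟩
    rw [ConjClasses.mk_eq_mk_iff_isConj, isConj_iff]
    exact ⟨M.rotator γ x.1 x.2, by simp only [f]; group⟩
  have hsurj : ∀ γ' ∈ t, ∃ x, f x = γ' := by
    intro γ' h
    rw [ht, Finset.mem_filter, mem_shell, ConjClasses.mk_eq_mk_iff_isConj, isConj_comm,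
      isConj_iff] at h
    obtain ⟨h1, g, rfl⟩ := h
    obtain ⟨c, i, hi, h2⟩ := exists_eq_rotate hγ h1
    exact ⟨(c, ⟨i, hi⟩), h2⟩
  have hsum : ∑ x, M.gap (f x) = (q - 1) * m := by
    have h1 : ∀ x, M.gap (f x) = ((M.word γ).1[x.2]).len := fun x => gap_rotate hγ x.1 x.2.2
    have h2 : ∑ i : Fin (M.word γ).1.length, ((M.word γ).1[i]).len = m := by
      rw [← hγ.2, M.dist_smul_base]
      exact Fin.sum_univ_fun_getElem _ _
    rw [Finset.sum_congr rfl fun x _ => h1 x, Fintype.sum_prod_type]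
    simp only [h2]
    rw [Finset.sum_const, Finset.card_univ, smul_eq_mul, Fintype.card_multiplicative, ZMod.card]
  have hfib := Finset.sum_fiberwise_of_maps_to' hmaps M.gap
  simp_rw [Finset.sum_const, smul_eq_mul] at hfib
  rw [hsum] at hfib
  constructor
  · rw [← hfib]
    refine Finset.sum_le_sum fun γ' h => ?_
    obtain ⟨x, hx⟩ := hsurj γ' h
    refine Nat.le_mul_of_pos_left _ (Finset.card_pos.2 ⟨x, ?_⟩)
    simpa using hx
  · intro hgen
    have hcard : ∀ x, (Finset.univ.filter fun y => f y = f x).card =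
        Nat.card (TreeAction.axisCentralizer 𝒯 γ) := by
      intro x
      rw [← card_rotate_eq hγ hgen x, Nat.card_eq_fintype_card, Fintype.card_subtype]
    constructor
    · rw [← hfib, Finset.mul_sum]
      refine Finset.sum_congr rfl fun γ' h => ?_
      obtain ⟨x, rfl⟩ := hsurj γ' h
      rw [hcard]
    · rw [← hcard (1, ⟨0, length_word_pos hγ⟩)]
      exact Finset.card_pos.2 ⟨(1, ⟨0, length_word_pos hγ⟩), by simp⟩

theorem translates_pow {γ₀ : Γ} {x : V} {k : ℕ} (h1 : Translates 𝒯 γ₀ x) (hk : 1 ≤ k)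
    (M : LoopCuspTree q N Γ V 𝒯) : Translates 𝒯 (γ₀ ^ k) x := by
  have h3 := h1.dist_pow M.isTree M.adj_smul
  refine ⟨fun e => ?_, ?_⟩
  · have h4 := h3 k
    rw [e, SimpleGraph.dist_self] at h4
    have := Nat.mul_pos hk (h1.dist_pos M.isTree)
    omega
  · rw [← mul_smul, ← pow_add, h3, h3]
    ring

theorem primitiveLength_le (hγ : γ ∈ M.translations m) :
    TreeAction.primitiveLength 𝒯 γ ≤ m := by
  unfold TreeAction.primitiveLength
  by_cases hne : ({n | ∃ γ₀ : Γ, TreeAction.IsPrimitiveHyperbolic Γ V γ₀ ∧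
      (∃ k : ℕ, 1 ≤ k ∧ γ = γ₀ ^ k) ∧ TreeAction.translationLength 𝒯 γ₀ = n} : Set ℕ).Nonempty
  · obtain ⟨n, hn⟩ := hne
    refine (Nat.sInf_le hn).trans ?_
    obtain ⟨γ₀, h0, ⟨k, hk, rfl⟩, rfl⟩ := hn
    obtain ⟨g, hg⟩ := M.exists_conj_translates γ₀ h0.1
    have h1 := hg.conj M.adj_smul g⁻¹
    have e : g⁻¹ * (g * γ₀ * g⁻¹) * g⁻¹⁻¹ = γ₀ := by group
    rw [e] at h1
    have h2 := translates_pow h1 hk M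
    rw [← hγ.2, ← hγ.1.translationLength_eq M.isTree M.adj_smul,
      h2.translationLength_eq M.isTree M.adj_smul, h1.translationLength_eq M.isTree M.adj_smul,
      h1.dist_pow M.isTree M.adj_smul]
    exact Nat.le_mul_of_pos_left _ hk
  · rw [Set.not_nonempty_iff_eq_empty.1 hne]
    simp

theorem weight_mem_Icc (hγ : γ ∈ M.translations m) :
    TreeAction.weight 𝒯 γ ∈ Set.Icc (0 : ℝ) m := by
  unfold TreeAction.weight
  refine ⟨by positivity, ?_⟩
  have h1 : (TreeAction.primitiveLength 𝒯 γ : ℝ) ≤ m := by exact_mod_cast primitiveLength_le hγ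
  rcases Nat.eq_zero_or_pos (Nat.card (TreeAction.axisCentralizer 𝒯 γ)) with h0 | h0
  · rw [h0, Nat.cast_zero, div_zero]
    positivity
  · exact (div_le_self (by positivity) (by exact_mod_cast h0)).trans h1

theorem IsGeneric.primitiveLength_eq (hgen : IsGeneric 𝒯 γ) (hγ : γ ∈ M.translations m) :
    TreeAction.primitiveLength 𝒯 γ = m := by
  have hprim : ∀ (h : Γ) (r : ℕ), γ = h ^ r → r = 1 := by
    intro h r hr
    have hc : h * γ = γ * h := by
      rw [hr]
      exact (Commute.refl h).pow_right r
    obtain ⟨k, a, ha, rfl⟩ := hgen h hc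
    have hca : Commute (γ ^ k) a := by
      refine Commute.zpow_left (show γ * a = a * γ from ?_) k
      exact (Subgroup.mem_centralizer_singleton_iff.1 (Subgroup.mem_inf.1 ha).1).symm
    rw [hca.mul_pow, ← zpow_natCast, ← zpow_mul] at hr
    have h1 := smul_base_of_mem_axisCentralizer hγ.1 (Subgroup.pow_mem _ ha r) rfl
    have h2 := hγ.1.dist_zpow M.isTree M.adj_smul (k * r)
    have h3 : γ • M.base = γ ^ (k * r) • M.base := by
      conv_lhs => rw [hr]
      rw [mul_smul, h1]
    rw [← h3] at h2
    have hpos := hγ.1.dist_pos M.isTree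
    have h4 : (k * r).natAbs = 1 := Nat.eq_of_mul_eq_mul_right hpos (by rw [one_mul]; exact h2.symm)
    rw [Int.natAbs_mul, Int.natAbs_natCast] at h4
    exact Nat.eq_one_of_mul_eq_one_left h4
  have hlen : TreeAction.translationLength 𝒯 γ = m :=
    (hγ.1.translationLength_eq M.isTree M.adj_smul).trans hγ.2
  have hset : {n | ∃ γ₀ : Γ, TreeAction.IsPrimitiveHyperbolic Γ V γ₀ ∧
      (∃ k : ℕ, 1 ≤ k ∧ γ = γ₀ ^ k) ∧ TreeAction.translationLength 𝒯 γ₀ = n} = {m} := by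
    ext n
    constructor
    · rintro ⟨γ₀, _, ⟨k, _, hk⟩, rfl⟩
      rw [hprim γ₀ k hk, pow_one] at hk
      rw [← hk]
      exact hlen
    · rintro rfl
      refine ⟨γ, ⟨hγ.1.isHyperbolic M.isTree M.adj_smul, fun h r hr e => ?_⟩,
        ⟨1, le_rfl, (pow_one γ).symm⟩, hlen⟩
      exact hr.ne' (hprim h r e)
  unfold TreeAction.primitiveLength
  rw [hset, csInf_singleton]

end

/-- The translations that are proper powers up to an element of the group of the base vertex. -/
def powers (m : ℕ) : Set Γ :=
  {γ | γ ∈ M.translations m ∧ ∃ (z : Γ) (j : ℕ) (c : Multiplicative (ZMod (q - 1))), 2 ≤ j ∧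
    Translates 𝒯 z M.base ∧ γ = z ^ j * M.κ c ∧ j * 𝒯.dist M.base (z • M.base) = m}

theorem isGeneric_of_notMem_powers {γ : Γ} {m : ℕ} (hγ : γ ∈ M.translations m)
    (h : γ ∉ M.powers m) : IsGeneric 𝒯 γ := by
  obtain ⟨z, j, c, h1, h2, h3, h4⟩ := exists_root hγ.1
  have hpos := hγ.1.dist_pos M.isTree
  refine h4 ?_
  by_contra hj
  refine h ⟨hγ, z, j, c, ?_, h1, h2, h3.trans hγ.2⟩
  rcases Nat.eq_zero_or_pos j with rfl | hj0
  · omega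
  · omega

/-- The sum of the gaps of the translations by the distance `m`. -/
def gapSum (m : ℕ) : ℕ := ∑ γ ∈ M.shell m, M.gap γ

theorem finite_powers (m : ℕ) : (M.powers m).Finite :=
  (M.finite_translations m).subset fun _ h => h.1

open Classical in
/-- The sum of the weights of the classes of translation length `m` differs from the normalised sum
of the gaps only by the contributions of proper powers. -/
theorem abs_finsum_weight_sub_le (W : ConjClasses Γ → ℝ)
    (hW : ∀ γ, W (ConjClasses.mk γ) = TreeAction.weight 𝒯 γ) (m : ℕ) :
    {c : ConjClasses Γ | ∃ γ : Γ, ConjClasses.mk γ = c ∧ TreeAction.IsHyperbolic Γ V γ ∧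
      TreeAction.translationLength 𝒯 γ = m}.Finite ∧
    |(∑ᶠ c ∈ {c : ConjClasses Γ | ∃ γ : Γ, ConjClasses.mk γ = c ∧ TreeAction.IsHyperbolic Γ V γ ∧
      TreeAction.translationLength 𝒯 γ = m}, W c) - M.gapSum m / ((q - 1 : ℕ) : ℝ)| ≤
      m * (M.powers m).ncard := by
  have hq0 : (0 : ℝ) < ((q - 1 : ℕ) : ℝ) := by
    have := M.two_le
    exact_mod_cast (by omega : 0 < q - 1)
  have hcls : {c : ConjClasses Γ | ∃ γ : Γ, ConjClasses.mk γ = c ∧ TreeAction.IsHyperbolic Γ V γ ∧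
      TreeAction.translationLength 𝒯 γ = m} = ((M.shell m).image ConjClasses.mk : Finset _) := by
    ext c
    rw [Finset.mem_coe, Finset.mem_image]
    constructor
    · rintro ⟨γ, rfl, hγ, hl⟩
      obtain ⟨g, hg⟩ := M.exists_conj_translates γ hγ
      refine ⟨g * γ * g⁻¹, ?_, ?_⟩
      · rw [mem_shell]
        refine ⟨hg, ?_⟩
        rw [← hg.translationLength_eq M.isTree M.adj_smul, ← hl]
        exact TreeAction.translationLength_conj M.adj_smul g γ
      · rw [ConjClasses.mk_eq_mk_iff_isConj, isConj_comm, isConj_iff]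
        exact ⟨g, rfl⟩
    · rintro ⟨γ, hγ, rfl⟩
      rw [mem_shell] at hγ
      exact ⟨γ, rfl, hγ.1.isHyperbolic M.isTree M.adj_smul,
        (hγ.1.translationLength_eq M.isTree M.adj_smul).trans hγ.2⟩
  rw [hcls]
  refine ⟨Finset.finite_toSet _, ?_⟩
  rw [finsum_mem_coe_finset]
  have hmaps : ∀ γ ∈ M.shell m, ConjClasses.mk γ ∈ (M.shell m).image ConjClasses.mk :=
    fun γ h => Finset.mem_image_of_mem _ h
  have hF : (M.gapSum m / ((q - 1 : ℕ) : ℝ) : ℝ) = ∑ c ∈ (M.shell m).image ConjClasses.mk,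
      ((∑ γ ∈ M.shell m with ConjClasses.mk γ = c, M.gap γ : ℕ) : ℝ) / ((q - 1 : ℕ) : ℝ) := by
    rw [← Finset.sum_div, ← Nat.cast_sum, Finset.sum_fiberwise_of_maps_to hmaps]
    rfl
  set B := (M.finite_powers m).toFinset with hB
  have hBsub : ∀ γ ∈ B, ConjClasses.mk γ ∈ (M.shell m).image ConjClasses.mk := fun γ h =>
    hmaps γ (M.mem_shell.2 (((Set.Finite.mem_toFinset _).1 h).1))
  rw [hF, ← Finset.sum_sub_distrib, Set.ncard_eq_toFinset_card _ (M.finite_powers m), ← hB,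
    Finset.card_eq_sum_card_fiberwise hBsub, Nat.cast_sum, Finset.mul_sum]
  refine (Finset.abs_sum_le_sum_abs _ _).trans (Finset.sum_le_sum fun c hc => ?_)
  obtain ⟨γ, hγ, rfl⟩ := Finset.mem_image.1 hc
  rw [mem_shell] at hγ
  by_cases hbad : ∃ γ' ∈ B, ConjClasses.mk γ' = ConjClasses.mk γ
  · obtain ⟨γ', h1, h2⟩ := hbad
    have h3 : (1 : ℝ) ≤ (B.filter fun a => ConjClasses.mk a = ConjClasses.mk γ).card := by
      exact_mod_cast Finset.card_pos.2 ⟨γ', Finset.mem_filter.2 ⟨h1, h2⟩⟩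
    have h4 := weight_mem_Icc hγ
    have h5 : ((∑ γ' ∈ M.shell m with ConjClasses.mk γ' = ConjClasses.mk γ, M.gap γ' : ℕ) : ℝ) /
        ((q - 1 : ℕ) : ℝ) ≤ m := by
      rw [div_le_iff₀ hq0]
      have := (sum_gap_conj hγ).1
      rw [mul_comm] at this
      exact_mod_cast this
    have h6 : (0 : ℝ) ≤ ((∑ γ' ∈ M.shell m with ConjClasses.mk γ' = ConjClasses.mk γ,
        M.gap γ' : ℕ) : ℝ) / ((q - 1 : ℕ) : ℝ) := by positivity
    rw [hW]
    calc _ ≤ (m : ℝ) := abs_sub_le_iff.2 ⟨by linarith [h4.2], by linarith [h4.1]⟩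
      _ ≤ _ := le_mul_of_one_le_right (by positivity) h3
  · push Not at hbad
    have hgen := M.isGeneric_of_notMem_powers hγ fun h =>
      hbad γ ((Set.Finite.mem_toFinset _).2 h) rfl
    obtain ⟨h1, h2⟩ := (sum_gap_conj hγ).2 hgen
    have h3 : (0 : ℝ) < Nat.card (TreeAction.axisCentralizer 𝒯 γ) := by exact_mod_cast h2
    have h1' : (Nat.card (TreeAction.axisCentralizer 𝒯 γ) : ℝ) *
        ((∑ γ' ∈ M.shell m with ConjClasses.mk γ' = ConjClasses.mk γ, M.gap γ' : ℕ) : ℝ) =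
        ((q - 1 : ℕ) : ℝ) * m := by exact_mod_cast h1
    have h7 : W (ConjClasses.mk γ) = ((∑ γ' ∈ M.shell m with
        ConjClasses.mk γ' = ConjClasses.mk γ, M.gap γ' : ℕ) : ℝ) / ((q - 1 : ℕ) : ℝ) := by
      rw [hW, TreeAction.weight, hgen.primitiveLength_eq hγ, div_eq_div_iff h3.ne' hq0.ne']
      linarith
    rw [h7, sub_self, abs_zero]
    positivity

theorem card_shell_le_gapSum (m : ℕ) : (M.shell m).card ≤ M.gapSum m := by
  rw [Finset.card_eq_sum_ones]
  refine Finset.sum_le_sum fun γ h => ?_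
  rw [mem_shell] at h
  have := length_word_pos h
  unfold gap
  rcases hw : (M.word γ).1 with _ | ⟨s, l⟩
  · rw [hw] at this
    simp at this
  · exact s.len_pos

theorem ncard_powers_le (m : ℕ) :
    (M.powers m).ncard ≤ ∑ d ∈ Finset.Icc 1 (m / 2), (q - 1) * M.gapSum d := by
  have hne : NeZero (q - 1) := ⟨by have := M.two_le; omega⟩
  classical
  let X : Finset Γ := (Finset.Icc 1 (m / 2)).biUnion fun d =>
    ((Finset.univ : Finset (Multiplicative (ZMod (q - 1)))) ×ˢ M.shell d).image
      fun x => x.2 ^ (m / d) * M.κ x.1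
  have hsub : M.powers m ⊆ X := by
    rintro γ ⟨_, z, j, c, hj, hz, rfl, hm⟩
    have hpos := hz.dist_pos M.isTree
    simp only [X, Finset.coe_biUnion, Set.mem_iUnion, Finset.mem_coe, Finset.mem_image]
    refine ⟨𝒯.dist M.base (z • M.base), Finset.mem_Icc.2 ⟨hpos, ?_⟩, (c, z), ?_, ?_⟩
    · rw [Nat.le_div_iff_mul_le two_pos, ← hm, mul_comm]
      exact Nat.mul_le_mul_right _ hj
    · exact Finset.mem_product.2 ⟨Finset.mem_univ _, M.mem_shell.2 ⟨hz, rfl⟩⟩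
    · simp only
      rw [← hm, Nat.mul_div_cancel _ hpos]
  refine (Set.ncard_le_ncard hsub (Finset.finite_toSet _)).trans ?_
  rw [Set.ncard_coe_finset]
  refine Finset.card_biUnion_le.trans (Finset.sum_le_sum fun d _ => ?_)
  refine Finset.card_image_le.trans ?_
  rw [Finset.card_product, Finset.card_univ, Fintype.card_multiplicative, ZMod.card]
  exact Nat.mul_le_mul_left _ (M.card_shell_le_gapSum d)

end LoopCuspTree

end LoopWithCusp

/-! ### Generating functions -/

namespace LoopWithCusp

open PowerSeries Finset

variable {q : ℕ} (hq : 2 ≤ q) (N : ℕ)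

/-- The steps of a given length. -/
def stepsOfLen (m : ℕ) : Finset (Step q N) :=
  ((finite_step_len_le hq m).subset (fun _ h => le_of_eq h :
    {s : Step q N | s.len = m} ⊆ _)).toFinset

/-- The lists of steps of a given length. -/
def listsOfLen (m : ℕ) : Finset (List (Step q N)) :=
  ((finite_listLen_le hq m).subset
    (fun _ h => le_of_eq h : {l : List (Step q N) | listLen l = m} ⊆ _)).toFinset

variable {N}

theorem mem_stepsOfLen {m : ℕ} {s : Step q N} : s ∈ stepsOfLen hq N m ↔ s.len = m := by
  simp [stepsOfLen]

theorem mem_listsOfLen {m : ℕ} {l : List (Step q N)} :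
    l ∈ listsOfLen hq N m ↔ listLen l = m := by
  simp [listsOfLen]

/-- The generating function of the steps with weights `wt`. -/
def stepGf (wt : Step q N → ℂ) : ℂ⟦X⟧ := mk fun m => ∑ s ∈ stepsOfLen hq N m, wt s

/-- The generating function of the lists of steps with weights `wt`. -/
def listGf (wt : List (Step q N) → ℂ) : ℂ⟦X⟧ := mk fun m => ∑ l ∈ listsOfLen hq N m, wt l

theorem sum_listsOfLen (wt : List (Step q N) → ℂ) (m : ℕ) :
    ∑ l ∈ listsOfLen hq N m, wt l = (if m = 0 then wt [] else 0) +
      ∑ p ∈ antidiagonal m, ∑ s ∈ stepsOfLen hq N p.1, ∑ l ∈ listsOfLen hq N p.2, wt (s :: l) := by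
  classical
  rw [← sum_filter_add_sum_filter_not (listsOfLen hq N m) (· = [])]
  congr 1
  · split_ifs with h
    · have : (listsOfLen hq N m).filter (· = []) = {[]} := by
        ext l
        simp only [mem_filter, mem_singleton, mem_listsOfLen]
        constructor
        · exact fun h => h.2
        · rintro rfl
          exact ⟨by simp [h], rfl⟩
      rw [this, sum_singleton]
    · refine sum_eq_zero fun l hl => ?_
      simp only [mem_filter, mem_listsOfLen] at hl
      obtain ⟨h1, rfl⟩ := hl
      exact absurd h1.symm h
  · have h1 : ∀ p ∈ antidiagonal m, ∑ s ∈ stepsOfLen hq N p.1, ∑ l ∈ listsOfLen hq N p.2,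
        wt (s :: l) = ∑ x ∈ stepsOfLen hq N p.1 ×ˢ listsOfLen hq N p.2, wt (x.1 :: x.2) :=
      fun p _ => (sum_product' _ _ _).symm
    rw [sum_congr rfl h1, sum_sigma']
    symm
    refine sum_nbij (fun x => x.2.1 :: x.2.2) ?_ ?_ ?_ (fun _ _ => rfl)
    · rintro ⟨p, s, l⟩ h
      simp only [mem_sigma, HasAntidiagonal.mem_antidiagonal, mem_product, mem_stepsOfLen,
        mem_listsOfLen] at h
      simp only [mem_filter, mem_listsOfLen, listLen_cons]
      exact ⟨by omega, by simp⟩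
    · rintro ⟨p, s, l⟩ h ⟨p', s', l'⟩ h' e
      simp only [mem_coe, mem_sigma, HasAntidiagonal.mem_antidiagonal, mem_product, mem_stepsOfLen,
        mem_listsOfLen] at h h'
      simp only [List.cons.injEq] at e
      obtain ⟨rfl, rfl⟩ := e
      obtain rfl : p = p' := Prod.ext (h.2.1.symm.trans h'.2.1) (h.2.2.symm.trans h'.2.2)
      rfl
    · intro l h
      simp only [mem_coe, mem_filter, mem_listsOfLen] at h
      cases l with
      | nil => exact absurd rfl h.2
      | cons s l =>
        refine ⟨⟨(s.len, listLen l), s, l⟩, ?_, rfl⟩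
        simp only [mem_coe, mem_sigma, HasAntidiagonal.mem_antidiagonal, mem_product,
          mem_stepsOfLen,
          mem_listsOfLen, and_self, and_true]
        simpa using h.1

/-- A weight that splits over the first step gives a linear relation of generating functions. -/
theorem listGf_eq {ι : Type} [Fintype ι] (wt : List (Step q N) → ℂ) (a : ι → Step q N → ℂ)
    (b : ι → List (Step q N) → ℂ) (h : ∀ s l, wt (s :: l) = ∑ i, a i s * b i l) :
    listGf hq wt = C (wt []) + ∑ i, stepGf hq (a i) * listGf hq (b i) := by
  ext m
  rw [listGf, coeff_mk, sum_listsOfLen, map_add, coeff_C, map_sum]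
  congr 1
  simp_rw [coeff_mul, stepGf, listGf, coeff_mk, h]
  rw [sum_comm]
  refine sum_congr rfl fun p _ => ?_
  simp_rw [sum_mul_sum]
  rw [sum_comm (s := univ)]
  refine sum_congr rfl fun s _ => ?_
  rw [sum_comm]

/-- The operator `X d/dX`. -/
def eulerD (f : ℂ⟦X⟧) : ℂ⟦X⟧ := X * derivative ℂ f

theorem coeff_eulerD (f : ℂ⟦X⟧) (m : ℕ) : coeff m (eulerD f) = m * coeff m f := by
  unfold eulerD
  cases m with
  | zero => simp
  | succ m =>
    rw [coeff_succ_X_mul, coeff_derivative]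
    push_cast
    ring

theorem eulerD_add (f g : ℂ⟦X⟧) : eulerD (f + g) = eulerD f + eulerD g := by
  rw [eulerD, map_add, mul_add]
  rfl

theorem eulerD_sub (f g : ℂ⟦X⟧) : eulerD (f - g) = eulerD f - eulerD g := by
  rw [eulerD, map_sub, mul_sub]
  rfl

theorem eulerD_mul (f g : ℂ⟦X⟧) : eulerD (f * g) = eulerD f * g + f * eulerD g := by
  simp only [eulerD, Derivation.leibniz, smul_eq_mul]
  ring

theorem eulerD_C (c : ℂ) : eulerD (C c) = 0 := by
  rw [eulerD, derivative_C, mul_zero]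

theorem eulerD_one : eulerD 1 = 0 := by
  rw [eulerD, derivative_one, mul_zero]

theorem stepGf_len_mul (wt : Step q N → ℂ) :
    stepGf hq (fun s => s.len * wt s) = eulerD (stepGf hq wt) := by
  ext m
  rw [coeff_eulerD, stepGf, stepGf, coeff_mk, coeff_mk, mul_sum]
  refine sum_congr rfl fun s hs => ?_
  rw [(mem_stepsOfLen hq).1 hs]

/-! ### The generating functions of steps -/

open Classical in
/-- The generating function of the steps from direction `d` to direction `d'`. -/
def stepSeries (N : ℕ) (d d' : Dir q) : ℂ⟦X⟧ :=
  stepGf hq (N := N) fun s => if s.dep = d ∧ s.arr = d' then 1 else 0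

/-- The generating function of the steps with a return to the same side of the loop. -/
def loopSeries (q N : ℕ) : ℂ⟦X⟧ :=
  C (q - 1 : ℂ) * X ^ 2 * ∑ k ∈ range N, (C (q : ℂ) * X ^ 2) ^ k

/-- The generating function of the steps through the loop. -/
def crossSeries (q N : ℕ) : ℂ⟦X⟧ := X * (C (q : ℂ) * X ^ 2) ^ N

/-- The generating function of the steps into a cusp. -/
def cuspSeries (q : ℕ) : ℂ⟦X⟧ := mk fun m => coeff m (loopSeries q m)

open Classical in
theorem coeff_stepSeries (d d' : Dir q) (m : ℕ) :
    coeff m (stepSeries hq N d d') = ({b : GInf q | Joined N d d' b ∧ ¬ (d = d' ∧ b = 1) ∧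
      (if d = d' then 2 * level b else 2 * N + 1) = m}.ncard : ℂ) := by
  rw [stepSeries, stepGf, coeff_mk, sum_boole, ← Set.ncard_coe_finset]
  congr 1
  refine Set.ncard_congr (fun s _ => s.elt) ?_ ?_ ?_
  · intro s hs
    simp only [coe_filter, mem_stepsOfLen, Set.mem_ofPred_eq] at hs
    obtain ⟨hm, rfl, rfl⟩ := hs
    exact ⟨s.joined, s.ne, hm⟩
  · intro s s' hs hs' e
    simp only [coe_filter, mem_stepsOfLen, Set.mem_ofPred_eq] at hs hs'
    exact Step.ext (hs.2.1.trans hs'.2.1.symm) (hs.2.2.trans hs'.2.2.symm) e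
  · rintro b ⟨h1, h2, h3⟩
    refine ⟨⟨d, d', b, h1, h2⟩, ?_, rfl⟩
    simp only [coe_filter, mem_stepsOfLen, Set.mem_ofPred_eq]
    exact ⟨h3, trivial, trivial⟩

include hq in
theorem ncard_level_le (k : ℕ) : {b : GInf q | level b ≤ k}.ncard = q ^ k := by
  have h2 : NeZero q := ⟨by omega⟩
  have h1 : Nat.card {b : GInf q // level b ≤ k} = q ^ k := by
    rw [Nat.card_congr (levelLeEquiv q k), Nat.card_fun]
    simp
  exact h1

include hq in
theorem ncard_level_eq (k : ℕ) : ({b : GInf q | level b = k + 1}.ncard : ℂ) = (q - 1) * q ^ k := by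
  have h1 : {b : GInf q | level b = k + 1} = {b | level b ≤ k + 1} \ {b | level b ≤ k} := by
    ext b
    simp only [Set.mem_ofPred_eq, Set.mem_sdiff]
    omega
  have h2 : {b : GInf q | level b ≤ k} ⊆ {b | level b ≤ k + 1} := fun b hb => Nat.le_succ_of_le hb
  have h3 := Set.ncard_sdiff_add_ncard_of_subset h2 (finite_level_le hq _)
  rw [← h1, ncard_level_le hq, ncard_level_le hq] at h3
  have h4 : ({b : GInf q | level b = k + 1}.ncard : ℂ) + q ^ k = q ^ (k + 1) := by exact_mod_cast h3
  linear_combination h4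

include hq in
theorem ncard_level_eq_coeff_loopSeries (N m : ℕ) :
    ({b : GInf q | level b ≤ N ∧ b ≠ 1 ∧ 2 * level b = m}.ncard : ℂ) =
      coeff m (loopSeries q N) := by
  induction N with
  | zero =>
    have : {b : GInf q | level b ≤ 0 ∧ b ≠ 1 ∧ 2 * level b = m} = ∅ := by
      ext b
      simp only [Set.mem_ofPred_eq, Set.mem_empty_iff_false, iff_false]
      rintro ⟨h1, h2, _⟩
      exact h2 (level_eq_zero.1 (Nat.le_zero.1 h1))
    rw [this]
    simp [loopSeries]
  | succ N ih =>
    have e1 : loopSeries q (N + 1) = loopSeries q N +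
        C ((q - 1) * q ^ N : ℂ) * X ^ (2 * N + 2) := by
      unfold loopSeries
      rw [sum_range_succ, mul_add, map_mul, mul_pow, ← map_pow, ← pow_mul]
      ring
    rw [e1, map_add, ← ih, coeff_C_mul_X_pow]
    split_ifs with hm
    · have h1 : {b : GInf q | level b ≤ N ∧ b ≠ 1 ∧ 2 * level b = m} = ∅ := by
        ext b
        simp only [Set.mem_ofPred_eq, Set.mem_empty_iff_false, iff_false]
        omega
      have h2 : {b : GInf q | level b ≤ N + 1 ∧ b ≠ 1 ∧ 2 * level b = m} =
          {b | level b = N + 1} := by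
        ext b
        simp only [Set.mem_ofPred_eq]
        constructor
        · omega
        · intro h
          refine ⟨h.le, ?_, by omega⟩
          rintro rfl
          simp at h
      rw [h1, h2, ncard_level_eq hq]
      simp
    · rw [add_zero]
      congr 2
      ext b
      simp only [Set.mem_ofPred_eq]
      constructor
      · rintro ⟨h1, h2, h3⟩
        exact ⟨by omega, h2, h3⟩
      · rintro ⟨h1, h2, h3⟩
        exact ⟨by omega, h2, h3⟩

theorem stepSeries_loop_self (s : Bool) :
    stepSeries hq N (.loop s) (.loop s) = loopSeries q N := by
  ext m
  rw [coeff_stepSeries, ← ncard_level_eq_coeff_loopSeries hq]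
  congr 2
  ext b
  simp [Joined]

theorem stepSeries_loop_not (s : Bool) :
    stepSeries hq N (.loop s) (.loop !s) = crossSeries q N := by
  ext m
  have hne : (Dir.loop s : Dir q) ≠ .loop (!s) := by simp
  have e1 : crossSeries q N = C ((q : ℂ) ^ N) * X ^ (2 * N + 1) := by
    unfold crossSeries
    rw [mul_pow, ← map_pow, ← pow_mul]
    ring
  rw [coeff_stepSeries, e1, coeff_C_mul_X_pow]
  simp only [hne, if_false, false_and, not_false_eq_true, true_and]
  split_ifs with hm
  · have : {b : GInf q | Joined N (.loop s) (.loop !s) b ∧ 2 * N + 1 = m} = {b | level b ≤ N} := by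
      ext b
      simp only [Set.mem_ofPred_eq, Joined, hm, and_true]
    rw [this, ncard_level_le hq]
    simp
  · have : {b : GInf q | Joined N (.loop s) (.loop !s) b ∧ 2 * N + 1 = m} = ∅ := by
      ext b
      simp only [Set.mem_ofPred_eq, Set.mem_empty_iff_false, iff_false]
      rintro ⟨_, h⟩
      exact hm h.symm
    rw [this]
    simp

theorem stepSeries_cusp_self (h : Multiplicative (ZMod (q - 1))) :
    stepSeries hq N (.cusp h) (.cusp h) = cuspSeries q := by
  ext m
  rw [coeff_stepSeries, cuspSeries, coeff_mk, ← ncard_level_eq_coeff_loopSeries hq]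
  congr 2
  ext b
  simp only [Set.mem_ofPred_eq, Joined, true_and, if_true]
  constructor
  · rintro ⟨h1, h2⟩
    exact ⟨by omega, h1, h2⟩
  · rintro ⟨_, h1, h2⟩
    exact ⟨h1, h2⟩

theorem stepSeries_eq_zero {d d' : Dir q} (h : ∀ b, ¬ Joined N d d' b) :
    stepSeries hq N d d' = 0 := by
  ext m
  rw [coeff_stepSeries]
  simp [h]

theorem one_sub_mul_loopSeries (q N : ℕ) : (1 - C (q : ℂ) * X ^ 2) * loopSeries q N =
    C (q - 1 : ℂ) * X ^ 2 * (1 - (C (q : ℂ) * X ^ 2) ^ N) := by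
  rw [loopSeries, ← mul_neg_geom_sum]
  ring

theorem coeff_loopSeries_of_le (q : ℕ) {j n : ℕ} (h : j ≤ n) :
    coeff j (loopSeries q n) = coeff j (cuspSeries q) := by
  rw [cuspSeries, coeff_mk]
  induction n, h using Nat.le_induction with
  | base => rfl
  | succ n hn ih =>
    have e1 : loopSeries q (n + 1) = loopSeries q n +
        C ((q - 1) * q ^ n : ℂ) * X ^ (2 * n + 2) := by
      unfold loopSeries
      rw [sum_range_succ, mul_add, map_mul, mul_pow, ← map_pow, ← pow_mul]
      ring
    rw [e1, map_add, coeff_C_mul_X_pow, if_neg (by omega), add_zero, ih]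

theorem one_sub_mul_cuspSeries (q : ℕ) : (1 - C (q : ℂ) * X ^ 2) * cuspSeries q =
    C (q - 1 : ℂ) * X ^ 2 := by
  ext m
  have h1 : coeff m ((1 - C (q : ℂ) * X ^ 2) * cuspSeries q) =
      coeff m ((1 - C (q : ℂ) * X ^ 2) * loopSeries q m) := by
    rw [coeff_mul, coeff_mul]
    refine sum_congr rfl fun p hp => ?_
    rw [HasAntidiagonal.mem_antidiagonal] at hp
    rw [coeff_loopSeries_of_le q (by omega : p.2 ≤ m)]
  have h2 : C (q - 1 : ℂ) * X ^ 2 * (1 - (C (q : ℂ) * X ^ 2) ^ m) = C (q - 1 : ℂ) * X ^ 2 -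
      C ((q - 1) * q ^ m : ℂ) * X ^ (2 * m + 2) := by
    rw [mul_pow, map_mul, ← map_pow, ← pow_mul]
    ring
  rw [h1, one_sub_mul_loopSeries, h2, map_sub, coeff_C_mul_X_pow _ (2 * m + 2),
    if_neg (by omega), sub_zero]

theorem constantCoeff_loopSeries (q N : ℕ) : constantCoeff (loopSeries q N) = 0 := by
  simp [loopSeries]

theorem constantCoeff_crossSeries (q N : ℕ) : constantCoeff (crossSeries q N) = 0 := by
  simp [crossSeries]

theorem constantCoeff_cuspSeries (q : ℕ) : constantCoeff (cuspSeries q) = 0 := by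
  rw [← coeff_zero_eq_constantCoeff_apply, cuspSeries, coeff_mk]
  simp [loopSeries]

end LoopWithCusp

/-! ### The determinant -/

namespace LoopWithCusp

open PowerSeries Finset

section linear

variable {A B Cc D1 D2 qq : ℂ⟦X⟧}

/-- Elimination in the linear system for the word series, for the sum of the two loop directions. -/
theorem add_mul_det {x y S T : ℂ⟦X⟧} (hS : constantCoeff (A + B) = 0)
    (hD2 : D2 = 1 - (A + B) - (qq - 2) * Cc - qq * (A + B) * Cc)
    (e1 : (1 + (A + B)) * (x + y) = 1 + 2 * S) (e2 : (1 + Cc) * T = (qq - 1) * (1 + S))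
    (e3 : S = (A + B) * (x + y) + Cc * T) : (x + y) * D2 = 1 + qq * Cc := by
  have h1 : S * D2 = (A + B) * (1 + Cc) + (qq - 1) * Cc * (1 + (A + B)) := by
    rw [hD2]
    linear_combination (1 + (A + B)) * (1 + Cc) * e3 + (A + B) * (1 + Cc) * e1 +
      Cc * (1 + (A + B)) * e2
  have hne : (1 + (A + B) : ℂ⟦X⟧) ≠ 0 := by
    intro h
    have := congrArg constantCoeff h
    rw [map_add, hS, map_one, map_zero] at this
    norm_num at this
  refine mul_left_cancel₀ hne ?_
  rw [hD2] at h1 ⊢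
  linear_combination (1 - (A + B) - (qq - 2) * Cc - qq * (A + B) * Cc) * e1 + 2 * h1

/-- Elimination in the linear system for the word series, for the sum of the cusp directions. -/
theorem cusp_mul_det {x y S T : ℂ⟦X⟧} (hC : constantCoeff Cc = 0)
    (hD2 : D2 = 1 - (A + B) - (qq - 2) * Cc - qq * (A + B) * Cc)
    (e1 : (1 + (A + B)) * (x + y) = 2 + 2 * S) (e2 : (1 + Cc) * T = qq - 2 + (qq - 1) * S)
    (e3 : S = (A + B) * (x + y) + Cc * T) : T * D2 = qq - 2 + qq * (A + B) := by
  have h1 : S * D2 = 2 * (A + B) * (1 + Cc) + (qq - 2) * Cc * (1 + (A + B)) := by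
    rw [hD2]
    linear_combination (1 + (A + B)) * (1 + Cc) * e3 + (A + B) * (1 + Cc) * e1 +
      Cc * (1 + (A + B)) * e2
  have hne : (1 + Cc : ℂ⟦X⟧) ≠ 0 := by
    intro h
    have := congrArg constantCoeff h
    rw [map_add, hC, map_one, map_zero] at this
    norm_num at this
  refine mul_left_cancel₀ hne ?_
  rw [hD2] at h1 ⊢
  linear_combination (1 - (A + B) - (qq - 2) * Cc - qq * (A + B) * Cc) * e2 + (qq - 1) * h1

end linear

variable {q : ℕ} (hq : 2 ≤ q) {N : ℕ}

/-- The directions are the two sides of the loop and the cusps. -/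
def dirEquiv (q : ℕ) : Bool ⊕ Multiplicative (ZMod (q - 1)) ≃ Dir q where
  toFun x := x.elim Dir.loop Dir.cusp
  invFun d := match d with
    | .loop s => Sum.inl s
    | .cusp h => Sum.inr h
  left_inv x := by cases x <;> rfl
  right_inv d := by cases d <;> rfl

instance [NeZero (q - 1)] : Fintype (Dir q) := Fintype.ofEquiv _ (dirEquiv q)

theorem sum_dir [NeZero (q - 1)] (f : Dir q → ℂ⟦X⟧) :
    ∑ d, f d = f (.loop false) + f (.loop true) + ∑ h, f (.cusp h) := by
  rw [← (dirEquiv q).sum_comp, Fintype.sum_sum_type, Fintype.sum_bool, add_comm (f _)]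
  rfl

open Classical in
/-- The indicator function of the words that avoid the direction `d` and, when read from the
direction `d`, do not end in the direction `δ`. -/
def wordWt (δ d : Dir q) (l : List (Step q N)) : ℂ :=
  if l.IsChain (fun s s' => s.arr ≠ s'.dep) ∧ (∀ s ∈ l.head?, d ≠ s.dep) ∧ endDir d l ≠ δ
  then 1 else 0

open Classical in
theorem wordWt_cons (δ d : Dir q) (s : Step q N) (l : List (Step q N)) :
    wordWt δ d (s :: l) = if d ≠ s.dep then wordWt δ s.arr l else 0 := by
  unfold wordWt
  rw [← ite_and]
  refine if_congr ?_ rfl rfl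
  rw [List.isChain_cons]
  simp only [List.head?_cons, Option.mem_def, Option.some.injEq, forall_eq', endDir]
  tauto

/-- The generating function of the words that avoid `d` and do not end in the direction `δ`. -/
def wordSeries (N : ℕ) (δ d : Dir q) : ℂ⟦X⟧ := listGf hq (N := N) (wordWt δ d)

/-- The generating function of the words that start in the direction `d` and do not end in the
direction `δ`. -/
def departSeries [NeZero (q - 1)] (N : ℕ) (δ d : Dir q) : ℂ⟦X⟧ :=
  ∑ d', stepSeries hq N d d' * wordSeries hq N δ d'

open Classical in
theorem wordSeries_add [NeZero (q - 1)] (δ d : Dir q) :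
    wordSeries hq N δ d + departSeries hq N δ d =
      (if d = δ then 0 else 1) + ∑ d', departSeries hq N δ d' := by
  have h1 := listGf_eq hq (N := N) (wordWt δ d) (fun (i : Dir q × Dir q) s =>
      if d ≠ i.1 then (if s.dep = i.1 ∧ s.arr = i.2 then (1 : ℂ) else 0) else 0)
      (fun i => wordWt δ i.2) (by
    intro s l
    rw [wordWt_cons, sum_eq_single (s.dep, s.arr)]
    · simp
    · rintro ⟨d', d''⟩ _ hne
      have : ¬ (s.dep = d' ∧ s.arr = d'') := fun h => hne (Prod.ext h.1.symm h.2.symm)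
      simp [this]
    · simp)
  have h2 : C (wordWt (N := N) δ d []) = (if d = δ then 0 else 1 : ℂ⟦X⟧) := by
    unfold wordWt endDir
    by_cases h : d = δ <;> simp [h]
  have h3 : ∀ i : Dir q × Dir q, stepGf hq (N := N) (fun s => if d ≠ i.1 then
      (if s.dep = i.1 ∧ s.arr = i.2 then 1 else 0) else 0) * listGf hq (N := N) (wordWt δ i.2) =
      (if d = i.1 then 0 else stepSeries hq N i.1 i.2 * wordSeries hq N δ i.2) := by
    intro i
    by_cases h : d = i.1
    · simp only [h, ne_eq, not_true_eq_false, if_false, if_true]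
      have : stepGf hq (N := N) (fun _ => 0) = 0 := by
        ext m
        simp [stepGf]
      rw [this, zero_mul]
    · simp only [h, ne_eq, not_false_eq_true, if_true, if_false]
      rfl
  have h4 : ∑ i : Dir q × Dir q, (if d = i.1 then 0 else
      stepSeries hq N i.1 i.2 * wordSeries hq N δ i.2) =
      ∑ d', (if d = d' then 0 else departSeries hq N δ d') := by
    rw [Fintype.sum_prod_type]
    refine sum_congr rfl fun d' _ => ?_
    by_cases h : d = d' <;> simp [h, departSeries]
  have h5 : ∑ d', departSeries hq N δ d' =
      (∑ d', (if d = d' then 0 else departSeries hq N δ d')) + departSeries hq N δ d := by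
    have : departSeries hq N δ d = ∑ d', (if d = d' then departSeries hq N δ d' else 0) := by simp
    rw [this, ← sum_add_distrib]
    refine sum_congr rfl fun d' _ => ?_
    split_ifs <;> simp
  rw [sum_congr rfl fun i _ => h3 i, h2, h4] at h1
  rw [h5, ← add_assoc, ← h1]
  rfl

theorem not_joined_cusp {h h' : Multiplicative (ZMod (q - 1))} (hne : h' ≠ h) (b : GInf q) :
    ¬ Joined N (.cusp h) (.cusp h') b := fun hb => hne (Eq.symm hb)

section

variable [NeZero (q - 1)]

theorem departSeries_loop (δ : Dir q) (s : Bool) : departSeries hq N δ (.loop s) =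
    loopSeries q N * wordSeries hq N δ (.loop s) +
      crossSeries q N * wordSeries hq N δ (.loop !s) := by
  rw [departSeries, sum_dir]
  have h1 : ∀ h, stepSeries hq N (.loop s) (.cusp h) = 0 :=
    fun h => stepSeries_eq_zero hq fun b => not_false
  simp only [h1, zero_mul, sum_const_zero, add_zero]
  cases s
  · rw [stepSeries_loop_self, show Dir.loop true = Dir.loop (!false) from rfl,
      stepSeries_loop_not]
  · rw [stepSeries_loop_self, show Dir.loop false = Dir.loop (!true) from rfl,
      stepSeries_loop_not, add_comm]

theorem departSeries_cusp (δ : Dir q) (h : Multiplicative (ZMod (q - 1))) :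
    departSeries hq N δ (.cusp h) = cuspSeries q * wordSeries hq N δ (.cusp h) := by
  rw [departSeries, sum_dir]
  have h1 : ∀ s, stepSeries hq N (.cusp h) (.loop s) = 0 :=
    fun h => stepSeries_eq_zero hq fun b => not_false
  rw [h1, h1, zero_mul, zero_mul, add_zero, zero_add, sum_eq_single h]
  · rw [stepSeries_cusp_self]
  · intro h' _ hne
    rw [stepSeries_eq_zero hq (not_joined_cusp hne), zero_mul]
  · simp

/-- The sum of the word series over the cusps. -/
def cuspSum (N : ℕ) (δ : Dir q) : ℂ⟦X⟧ := ∑ h, wordSeries hq N δ (.cusp h)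

theorem sum_departSeries (δ : Dir q) : ∑ d, departSeries hq N δ d =
    (loopSeries q N + crossSeries q N) *
      (wordSeries hq N δ (.loop false) + wordSeries hq N δ (.loop true)) +
      cuspSeries q * cuspSum hq N δ := by
  rw [sum_dir, departSeries_loop, departSeries_loop, sum_congr rfl fun h _ =>
    departSeries_cusp hq δ h, ← mul_sum, cuspSum]
  simp only [Bool.not_false, Bool.not_true]
  ring

open Classical in
theorem wordSeries_loop (δ : Dir q) (s : Bool) :
    (1 + loopSeries q N) * wordSeries hq N δ (.loop s) +
      crossSeries q N * wordSeries hq N δ (.loop !s) =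
      (if .loop s = δ then 0 else 1) + ∑ d', departSeries hq N δ d' := by
  rw [← wordSeries_add, departSeries_loop]
  ring

open Classical in
theorem wordSeries_cuspSum (δ : Dir q) : (1 + cuspSeries q) * cuspSum hq N δ =
    (∑ h, if .cusp h = δ then 0 else 1) + (C (q : ℂ) - 1) * ∑ d', departSeries hq N δ d' := by
  have h1 : (C (q : ℂ) - 1 : ℂ⟦X⟧) = (Fintype.card (Multiplicative (ZMod (q - 1))) : ℂ⟦X⟧) := by
    rw [Fintype.card_multiplicative, ZMod.card, Nat.cast_sub (by omega)]
    simp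
  rw [h1, cuspSum, mul_sum, ← nsmul_eq_mul, ← card_univ, ← sum_const, ← sum_add_distrib]
  refine sum_congr rfl fun h _ => ?_
  rw [← wordSeries_add, departSeries_cusp]
  ring

variable (q N) in
/-- The determinant of the equations for words that change sign when the two sides of the loop are
exchanged. -/
def oddDet : ℂ⟦X⟧ := 1 + loopSeries q N - crossSeries q N

variable (q N) in
/-- The determinant of the equations for words that are symmetric in the two sides of the loop and
in the cusps. -/
def evenDet : ℂ⟦X⟧ := 1 - (loopSeries q N + crossSeries q N) - (C (q : ℂ) - 2) * cuspSeries q -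
  C (q : ℂ) * (loopSeries q N + crossSeries q N) * cuspSeries q

theorem constantCoeff_loop_add_cross (q N : ℕ) :
    constantCoeff (loopSeries q N + crossSeries q N) = 0 := by
  rw [map_add, constantCoeff_loopSeries, constantCoeff_crossSeries, add_zero]

theorem sum_one_cusp : (∑ _h : Multiplicative (ZMod (q - 1)), (1 : ℂ⟦X⟧)) = C (q : ℂ) - 1 := by
  rw [sum_const, card_univ, Fintype.card_multiplicative, ZMod.card, nsmul_eq_mul,
    Nat.cast_sub (by have := NeZero.ne (q - 1); omega)]
  simp

theorem wordSeries_add_mul_evenDet (s : Bool) :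
    (wordSeries hq N (.loop s) (.loop false) + wordSeries hq N (.loop s) (.loop true)) *
      evenDet q N = 1 + C (q : ℂ) * cuspSeries q := by
  classical
  have e1 := wordSeries_loop hq (N := N) (.loop s) false
  have e2 := wordSeries_loop hq (N := N) (.loop s) true
  have e3 := wordSeries_cuspSum hq (N := N) (.loop s)
  simp only [reduceCtorEq, if_false, sum_one_cusp] at e3
  refine add_mul_det (S := ∑ d', departSeries hq N (.loop s) d') (T := cuspSum hq N (.loop s))
    (constantCoeff_loop_add_cross q N) rfl ?_ ?_ (sum_departSeries hq _)
  · cases s <;> simp at e1 e2 <;> linear_combination e1 + e2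
  · rw [e3]
    ring

theorem oddDet_mul_wordSeries_false :
    oddDet q N * (wordSeries hq N (.loop false) (.loop false) -
      wordSeries hq N (.loop false) (.loop true)) = -1 := by
  classical
  have e1 := wordSeries_loop hq (N := N) (.loop false) false
  have e2 := wordSeries_loop hq (N := N) (.loop false) true
  simp at e1 e2
  unfold oddDet
  linear_combination e1 - e2

theorem oddDet_mul_wordSeries_true :
    oddDet q N * (wordSeries hq N (.loop true) (.loop false) -
      wordSeries hq N (.loop true) (.loop true)) = 1 := by
  classical
  have e1 := wordSeries_loop hq (N := N) (.loop true) false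
  have e2 := wordSeries_loop hq (N := N) (.loop true) true
  simp at e1 e2
  unfold oddDet
  linear_combination e1 - e2

theorem cuspSum_mul_evenDet (h : Multiplicative (ZMod (q - 1))) :
    cuspSum hq N (.cusp h) * evenDet q N =
      C (q : ℂ) - 2 + C (q : ℂ) * (loopSeries q N + crossSeries q N) := by
  classical
  have e1 := wordSeries_loop hq (N := N) (.cusp h) false
  have e2 := wordSeries_loop hq (N := N) (.cusp h) true
  have e3 := wordSeries_cuspSum hq (N := N) (.cusp h)
  have h1 : (∑ h', if (Dir.cusp h' : Dir q) = .cusp h then (0 : ℂ⟦X⟧) else 1) = C (q : ℂ) - 2 := by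
    have h2 : ∀ h' : Multiplicative (ZMod (q - 1)),
        (if (Dir.cusp h' : Dir q) = .cusp h then (0 : ℂ⟦X⟧) else 1) =
          1 - if h' = h then 1 else 0 := by
      intro h'
      by_cases e : h' = h <;> simp [e]
    rw [sum_congr rfl fun h' _ => h2 h', sum_sub_distrib, sum_one_cusp]
    simp
    ring
  rw [h1] at e3
  refine cusp_mul_det (S := ∑ d', departSeries hq N (.cusp h) d')
    (constantCoeff_cuspSeries q) rfl ?_ e3 (sum_departSeries hq _)
  simp at e1 e2
  linear_combination e1 + e2

end

/-! ### The generating function of the gaps -/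

/-- The weight of a list of steps as the word of a translation twisted by `h`. -/
def gapWt (h : Multiplicative (ZMod (q - 1))) : List (Step q N) → ℂ
  | [] => 0
  | s :: l => s.len * wordWt (h • s.dep) s.arr l

variable {Γ V : Type} [Group Γ] [MulAction Γ V] {𝒯 : SimpleGraph V}

open Classical in
/-- The gap sum over the translations by `m`, as a sum over lists of steps: translations correspond
to the pairs of an `h` and a reduced list that stays reduced when closed up by `h`. -/
theorem LoopCuspTree.gapSum_eq [NeZero (q - 1)] (M : LoopCuspTree q N Γ V 𝒯) (m : ℕ) :
    (M.gapSum m : ℂ) = ∑ h, ∑ l ∈ listsOfLen hq N m, gapWt h l := by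
  rw [← sum_product' univ (listsOfLen hq N m) gapWt]
  let P : Multiplicative (ZMod (q - 1)) × List (Step q N) → Prop := fun x =>
    ∃ s l, x.2 = s :: l ∧ (s :: l).IsChain (fun s s' => s.arr ≠ s'.dep) ∧
      endDir s.arr l ≠ x.1 • s.dep
  have hwt : ∀ (h : Multiplicative (ZMod (q - 1))) (s : Step q N) (l : List (Step q N)),
      (s :: l).IsChain (fun s s' => s.arr ≠ s'.dep) ∧ endDir s.arr l ≠ h • s.dep ↔
      (l.IsChain (fun s s' => s.arr ≠ s'.dep) ∧ (∀ s' ∈ l.head?, s.arr ≠ s'.dep) ∧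
        endDir s.arr l ≠ h • s.dep) := by
    intro h s l
    rw [List.isChain_cons]
    tauto
  have h1 : ∑ x ∈ univ ×ˢ listsOfLen hq N m, gapWt x.1 x.2 =
      ∑ x ∈ (univ ×ˢ listsOfLen hq N m).filter P, gapWt x.1 x.2 := by
    refine (sum_filter_of_ne ?_).symm
    rintro ⟨h, l⟩ _ hne
    cases l with
    | nil => exact absurd rfl hne
    | cons s l =>
      refine ⟨s, l, rfl, ?_⟩
      rw [hwt]
      by_contra hn
      refine hne ?_
      simp only [gapWt, wordWt]
      rw [if_neg hn, mul_zero]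
  rw [h1, LoopCuspTree.gapSum, Nat.cast_sum]
  symm
  refine sum_nbij (fun x => M.listElt x.2 * M.κ x.1) ?_ ?_ ?_ ?_
  · rintro ⟨h, l⟩ hx
    obtain ⟨hx, s, l, rfl, hc, he⟩ := mem_filter.1 hx
    have hl := (mem_listsOfLen hq).1 (mem_product.1 hx).2
    rw [M.mem_shell]
    have hc' := List.isChain_cons.1 hc
    refine ⟨(M.translates_iff s ⟨l, hc'.2⟩ hc'.1 h).2 he, ?_⟩
    rw [mul_smul, M.κ_smul_base, M.dist_listElt hc, hl]
  · rintro ⟨h, l⟩ hx ⟨h', l'⟩ hx' e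
    obtain ⟨_, s, r, h2, hc, _⟩ := mem_filter.1 (mem_coe.1 hx)
    obtain ⟨_, s', r', h2', hc', _⟩ := mem_filter.1 (mem_coe.1 hx')
    simp only at h2 h2' e
    rw [← h2] at hc
    rw [← h2'] at hc'
    have e1 := congrArg M.word e
    rw [M.word_listElt_mul hc, M.word_listElt_mul hc'] at e1
    obtain rfl : l = l' := congrArg Subtype.val e1
    rw [M.κ_injective (mul_left_cancel e)]
  · intro γ hγ
    rw [mem_coe, M.mem_shell] at hγ
    obtain ⟨h, hh⟩ := M.exists_eq_elt_mul γ
    rcases (M.word γ).nil_or_cons with hw | ⟨s, r, hr, hw⟩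
    · refine absurd ?_ hγ.1.1
      rw [hh, hw, M.elt_nil, one_mul, M.κ_smul_base]
    · refine ⟨(h, (M.word γ).1), mem_coe.2 (mem_filter.2 ⟨mem_product.2 ⟨mem_univ _, ?_⟩,
        s, r.1, ?_, ?_, ?_⟩), hh.symm⟩
      · rw [mem_listsOfLen, ← M.dist_smul_base]
        exact hγ.2
      · rw [hw]
        rfl
      · exact (Word.cons s r hr).2
      · rw [← M.translates_iff s r hr h, ← hw, ← hh]
        exact hγ.1
  · rintro ⟨h, l⟩ hx
    obtain ⟨_, s, l, rfl, hc, he⟩ := mem_filter.1 hx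
    have h2 := (hwt h s l).1 ⟨hc, he⟩
    simp only [LoopCuspTree.gap, M.word_listElt_mul hc, gapWt, wordWt, if_pos h2, headLen, mul_one]

theorem LoopCuspTree.gapSeries_eq [NeZero (q - 1)] (M : LoopCuspTree q N Γ V 𝒯) :
    (PowerSeries.mk fun m => (M.gapSum m : ℂ)) = ∑ h : Multiplicative (ZMod (q - 1)), ∑ d, ∑ d',
      eulerD (stepSeries hq N d d') * wordSeries hq N (h • d) d' := by
  classical
  have h1 : (PowerSeries.mk fun m => (M.gapSum m : ℂ)) = ∑ h, listGf hq (N := N) (gapWt h) := by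
    ext m
    rw [coeff_mk, map_sum, M.gapSum_eq hq]
    simp only [listGf, coeff_mk]
  rw [h1]
  refine sum_congr rfl fun h _ => ?_
  rw [listGf_eq hq (gapWt h) (fun (i : Dir q × Dir q) s =>
    s.len * if s.dep = i.1 ∧ s.arr = i.2 then 1 else 0) (fun i => wordWt (h • i.1) i.2) ?_]
  · rw [Fintype.sum_prod_type, gapWt, map_zero, zero_add]
    refine sum_congr rfl fun d _ => sum_congr rfl fun d' _ => ?_
    rw [stepGf_len_mul]
    rfl
  · intro s l
    rw [sum_eq_single (s.dep, s.arr)]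
    · simp [gapWt]
    · rintro ⟨d', d''⟩ _ hne
      have : ¬ (s.dep = d' ∧ s.arr = d'') := fun h => hne (Prod.ext h.1.symm h.2.symm)
      simp [this]
    · simp

theorem eulerD_zero : eulerD 0 = 0 := by
  rw [eulerD, map_zero, mul_zero]

/-- The generating function of the gaps is a multiple of the logarithmic derivative of the
determinant. -/
theorem LoopCuspTree.gapSeries_mul_det (M : LoopCuspTree q N Γ V 𝒯) :
    (PowerSeries.mk fun m => (M.gapSum m : ℂ)) * (oddDet q N * evenDet q N) =
      -((C (q : ℂ) - 1) * eulerD (oddDet q N * evenDet q N)) := by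
  have hq := M.two_le
  have hne : NeZero (q - 1) := ⟨by omega⟩
  set A := loopSeries q N with hA
  set B := crossSeries q N with hB
  set Cc := cuspSeries q with hCc
  obtain ⟨x, hx⟩ : ∃ x, x = wordSeries hq N (.loop false) (.loop false) := ⟨_, rfl⟩
  obtain ⟨y, hy⟩ : ∃ x, x = wordSeries hq N (.loop false) (.loop true) := ⟨_, rfl⟩
  obtain ⟨z, hz⟩ : ∃ x, x = wordSeries hq N (.loop true) (.loop false) := ⟨_, rfl⟩
  obtain ⟨w, hw⟩ : ∃ x, x = wordSeries hq N (.loop true) (.loop true) := ⟨_, rfl⟩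
  have hloop : ∀ s (δ : Dir q), ∑ d', eulerD (stepSeries hq N (.loop s) d') * wordSeries hq N δ d' =
      eulerD A * wordSeries hq N δ (.loop s) + eulerD B * wordSeries hq N δ (.loop !s) := by
    intro s δ
    rw [sum_dir]
    have h1 : ∀ h, stepSeries hq N (.loop s) (.cusp h) = 0 :=
      fun h => stepSeries_eq_zero hq fun b => not_false
    simp only [h1, eulerD_zero, zero_mul, sum_const_zero, add_zero]
    cases s
    · rw [stepSeries_loop_self, show Dir.loop true = Dir.loop (!false) from rfl,
        stepSeries_loop_not]
    · rw [stepSeries_loop_self, show Dir.loop false = Dir.loop (!true) from rfl,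
        stepSeries_loop_not, add_comm]
  have hcusp : ∀ h (δ : Dir q), ∑ d', eulerD (stepSeries hq N (.cusp h) d') *
      wordSeries hq N δ d' = eulerD Cc * wordSeries hq N δ (.cusp h) := by
    intro h δ
    rw [sum_dir]
    have h1 : ∀ s, stepSeries hq N (.cusp h) (.loop s) = 0 :=
      fun h => stepSeries_eq_zero hq fun b => not_false
    rw [h1, h1, eulerD_zero, zero_mul, zero_mul, add_zero, zero_add, sum_eq_single h]
    · rw [stepSeries_cusp_self]
    · intro h' _ hne
      rw [stepSeries_eq_zero hq (not_joined_cusp hne), eulerD_zero, zero_mul]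
    · simp
  have hG : (PowerSeries.mk fun m => (M.gapSum m : ℂ)) = (C (q : ℂ) - 1) *
      (eulerD A * (x + w) + eulerD B * (y + z)) +
      eulerD Cc * ∑ h : Multiplicative (ZMod (q - 1)), cuspSum hq N (.cusp h) := by
    rw [M.gapSeries_eq hq]
    have h1 : ∀ h : Multiplicative (ZMod (q - 1)), ∑ d, ∑ d',
        eulerD (stepSeries hq N d d') * wordSeries hq N (h • d) d' =
        (eulerD A * (x + w) + eulerD B * (y + z)) +
          eulerD Cc * ∑ h', wordSeries hq N (.cusp (h * h')) (.cusp h') := by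
      intro h
      rw [sum_dir, smul_loop, smul_loop, hloop, hloop, sum_congr rfl fun h' _ => hcusp h' _,
        ← mul_sum, hx, hy, hz, hw]
      simp only [smul_cusp, Bool.not_false, Bool.not_true]
      ring
    rw [sum_congr rfl fun h _ => h1 h, sum_add_distrib, sum_const, ← mul_sum, card_univ,
      Fintype.card_multiplicative, ZMod.card, nsmul_eq_mul, Nat.cast_sub (by omega)]
    congr 1
    · simp
    · congr 1
      unfold cuspSum
      rw [sum_comm, sum_comm (f := fun h h' => wordSeries hq N (.cusp h) (.cusp h'))]
      refine sum_congr rfl fun h' _ => ?_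
      exact Fintype.sum_equiv (Equiv.mulRight h') _ _ fun h => rfl
  have hS : (∑ h : Multiplicative (ZMod (q - 1)), cuspSum hq N (.cusp h)) * evenDet q N =
      (C (q : ℂ) - 1) * (C (q : ℂ) - 2 + C (q : ℂ) * (A + B)) := by
    rw [sum_mul, sum_congr rfl fun h _ => cuspSum_mul_evenDet hq h, ← sum_one_cusp, sum_mul,
      one_mul]
  have e1 := wordSeries_add_mul_evenDet hq (N := N) false
  have e2 := wordSeries_add_mul_evenDet hq (N := N) true
  have e3 := oddDet_mul_wordSeries_false hq (N := N)
  have e4 := oddDet_mul_wordSeries_true hq (N := N)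
  rw [← hx, ← hy] at e1 e3
  rw [← hz, ← hw] at e2 e4
  have d1 : eulerD (oddDet q N) = eulerD A - eulerD B := by
    rw [oddDet, eulerD_sub, eulerD_add, eulerD_one, zero_add]
  have d2 : eulerD (evenDet q N) = -((eulerD A + eulerD B) * (1 + C (q : ℂ) * Cc) +
      eulerD Cc * (C (q : ℂ) - 2 + C (q : ℂ) * (A + B))) := by
    have h2 : eulerD (C (q : ℂ) - 2) = 0 := by
      rw [show (C (q : ℂ) - 2 : ℂ⟦X⟧) = C (q - 2 : ℂ) by rw [map_sub, map_ofNat], eulerD_C]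
    rw [evenDet]
    simp only [eulerD_sub, eulerD_add, eulerD_one, eulerD_mul, h2, eulerD_C]
    ring
  have h2 : (2 : ℂ⟦X⟧) ≠ 0 := by
    intro h
    have := congrArg constantCoeff h
    rw [map_ofNat, map_zero] at this
    exact two_ne_zero this
  refine mul_left_cancel₀ h2 ?_
  rw [hG, eulerD_mul, d1, d2]
  linear_combination (C (q : ℂ) - 1) * (oddDet q N * (eulerD A + eulerD B) * (e1 + e2) +
    evenDet q N * (eulerD A - eulerD B) * (e3 - e4)) + 2 * eulerD Cc * oddDet q N * hS

end LoopWithCusp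

/-! ### Power sums of the zeros of the determinant -/

namespace LoopWithCusp

section

open Polynomial

/-- The essential factor of the odd determinant. -/
def oddPoly (q N : ℕ) : ℂ[X] :=
  1 + X - (C (q : ℂ) * X ^ 2) ^ N * X * (1 + C (q : ℂ) * X)

/-- The essential factor of the even determinant. -/
def evenPoly (q N : ℕ) : ℂ[X] :=
  (1 - X) * (1 + C (q : ℂ) * X) -
    (C (q : ℂ) * X ^ 2) ^ N * X * (1 + C (q : ℂ) * (C (q : ℂ) - 2) * X ^ 2)

theorem eval_oddPoly (q N : ℕ) (u : ℂ) : (oddPoly q N).eval u =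
    1 + u - (q * u ^ 2) ^ N * u * (1 + q * u) := by
  simp [oddPoly]

theorem eval_evenPoly (q N : ℕ) (u : ℂ) : (evenPoly q N).eval u =
    (1 - u) * (1 + q * u) - (q * u ^ 2) ^ N * u * (1 + q * (q - 2) * u ^ 2) := by
  simp [evenPoly]

end

open PowerSeries

/-- The negative logarithmic derivative `-X f' / f`. For a polynomial `f`, its coefficients are the
power sums of the inverses of the zeros of `f`. -/
def logSeries (f : ℂ⟦X⟧) : ℂ⟦X⟧ := -eulerD f * f⁻¹

theorem logSeries_mul {f g : ℂ⟦X⟧} (hf : constantCoeff f ≠ 0) (hg : constantCoeff g ≠ 0) :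
    logSeries (f * g) = logSeries f + logSeries g := by
  unfold logSeries
  rw [eulerD_mul, PowerSeries.mul_inv_rev]
  have h1 := PowerSeries.mul_inv_cancel f hf
  have h2 := PowerSeries.mul_inv_cancel g hg
  linear_combination -(eulerD f * f⁻¹) * h2 - eulerD g * g⁻¹ * h1

theorem eq_logSeries {f g h : ℂ⟦X⟧} (hf : constantCoeff f ≠ 0) (h1 : g * f = -(h * eulerD f)) :
    g = h * logSeries f := by
  have h2 := PowerSeries.mul_inv_cancel f hf
  unfold logSeries
  linear_combination f⁻¹ * h1 - g * h2

theorem logSeries_C (c : ℂ) : logSeries (C c) = 0 := by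
  rw [logSeries, eulerD_C, neg_zero, zero_mul]

theorem coeff_logSeries_one_sub (c : ℂ) {m : ℕ} (hm : m ≠ 0) :
    coeff m (logSeries (1 - C c * X)) = c ^ m := by
  have h1 : (PowerSeries.mk fun m => if m = 0 then 0 else c ^ m) = 1 * logSeries (1 - C c * X) := by
    refine eq_logSeries (by simp) ?_
    ext m
    have e1 : eulerD (1 - C c * X : ℂ⟦X⟧) = -(C c * X) := by
      rw [eulerD_sub, eulerD_one, eulerD_mul, eulerD_C]
      simp [eulerD]
    rw [e1, mul_sub, mul_one, ← mul_assoc]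
    cases m with
    | zero => simp
    | succ m =>
      rw [map_sub, coeff_succ_mul_X, coeff_mul_C, coeff_mk, coeff_mk]
      cases m with
      | zero => simp
      | succ m => simp [pow_succ]
  rw [one_mul] at h1
  rw [← h1, coeff_mk, if_neg hm]

theorem coeff_logSeries_polynomial {P : Polynomial ℂ} (hP : P.eval 0 ≠ 0) {m : ℕ} (hm : m ≠ 0) :
    coeff m (logSeries (P : ℂ⟦X⟧)) = (P.roots.map fun z => (z⁻¹) ^ m).sum := by
  have hP0 : P ≠ 0 := by
    rintro rfl
    simp at hP
  have hroot : (0 : ℂ) ∉ P.roots := fun h => hP (Polynomial.isRoot_of_mem_roots h)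
  have key : ∀ s : Multiset ℂ, (0 : ℂ) ∉ s →
      constantCoeff ((s.map fun z => Polynomial.X - Polynomial.C z).prod : Polynomial ℂ) ≠
        (0 : ℂ) ∧
      coeff m (logSeries ((s.map fun z => Polynomial.X - Polynomial.C z).prod : Polynomial ℂ)) =
        (s.map fun z => (z⁻¹) ^ m).sum := by
    intro s
    induction s using Multiset.induction with
    | empty =>
      intro _
      have : logSeries (1 : ℂ⟦X⟧) = 0 := by rw [← map_one (C (R := ℂ)), logSeries_C]
      simp [this]
    | cons z s ih =>
      intro h
      rw [Multiset.mem_cons, not_or] at h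
      obtain ⟨h1, h2⟩ := ih h.2
      have hz : z ≠ 0 := fun e => h.1 e.symm
      have e1 : ((Polynomial.X - Polynomial.C z : Polynomial ℂ) : ℂ⟦X⟧) =
          C (-z) * (1 - C z⁻¹ * X) := by
        have : (C z * C z⁻¹ : ℂ⟦X⟧) = 1 := by rw [← map_mul, mul_inv_cancel₀ hz, map_one]
        rw [Polynomial.coe_sub, Polynomial.coe_X, Polynomial.coe_C, map_neg]
        linear_combination -X * this
      have h3 : constantCoeff ((Polynomial.X - Polynomial.C z : Polynomial ℂ) : ℂ⟦X⟧) ≠ 0 := by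
        rw [e1]
        simpa using hz
      rw [Multiset.map_cons, Multiset.prod_cons, Polynomial.coe_mul, Multiset.map_cons,
        Multiset.sum_cons]
      refine ⟨by rw [map_mul]; exact mul_ne_zero h3 h1, ?_⟩
      rw [logSeries_mul h3 h1, map_add, h2, e1, logSeries_mul (by simpa using hz) (by simp),
        logSeries_C, zero_add, coeff_logSeries_one_sub _ hm]
  have h1 := (IsAlgClosed.splits P).eq_prod_roots
  have h2 := key P.roots hroot
  rw [← h2.2]
  conv_lhs => rw [h1]
  rw [Polynomial.coe_mul, Polynomial.coe_C, logSeries_mul (by simpa using hP0) h2.1, logSeries_C,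
    zero_add]

theorem coe_oddPoly (q N : ℕ) : (oddPoly q N : ℂ⟦X⟧) =
    1 + X - (C (q : ℂ) * X ^ 2) ^ N * X * (1 + C (q : ℂ) * X) := by
  simp only [oddPoly, Polynomial.coe_add, Polynomial.coe_sub, Polynomial.coe_mul,
    Polynomial.coe_pow,
    Polynomial.coe_one, Polynomial.coe_X, Polynomial.coe_C]

theorem coe_evenPoly (q N : ℕ) : (evenPoly q N : ℂ⟦X⟧) =
    (1 - X) * (1 + C (q : ℂ) * X) -
    (C (q : ℂ) * X ^ 2) ^ N * X * (1 + C (q : ℂ) * (C (q : ℂ) - 2) * X ^ 2) := by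
  have h2 : ((2 : Polynomial ℂ) : ℂ⟦X⟧) = 2 := by
    have := Polynomial.coe_C (R := ℂ) 2
    rwa [map_ofNat, map_ofNat] at this
  simp only [evenPoly, Polynomial.coe_add, Polynomial.coe_sub, Polynomial.coe_mul,
    Polynomial.coe_pow,
    Polynomial.coe_one, Polynomial.coe_X, Polynomial.coe_C, h2]

theorem oddDet_mul (q N : ℕ) : oddDet q N * (1 - C (q : ℂ) * X ^ 2) =
    (1 - X) * (oddPoly q N : ℂ⟦X⟧) := by
  have hA := one_sub_mul_loopSeries q N
  have hc : (C (q - 1 : ℂ) : ℂ⟦X⟧) = C (q : ℂ) - 1 := by rw [map_sub, map_one]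
  rw [hc] at hA
  rw [coe_oddPoly, oddDet, crossSeries]
  generalize (C (q : ℂ) * X ^ 2 : ℂ⟦X⟧) ^ N = y at *
  linear_combination hA

theorem evenDet_mul (q N : ℕ) : evenDet q N * (1 - C (q : ℂ) * X ^ 2) ^ 2 =
    (1 + X) * (1 - C (q : ℂ) * X) * (evenPoly q N : ℂ⟦X⟧) := by
  have hA := one_sub_mul_loopSeries q N
  have hC := one_sub_mul_cuspSeries q
  have hc : (C (q - 1 : ℂ) : ℂ⟦X⟧) = C (q : ℂ) - 1 := by rw [map_sub, map_one]
  rw [hc] at hA hC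
  rw [coe_evenPoly, evenDet, crossSeries]
  generalize (C (q : ℂ) * X ^ 2 : ℂ⟦X⟧) ^ N = y at *
  generalize (C (q : ℂ) : ℂ⟦X⟧) = k at *
  generalize loopSeries q N = A at *
  generalize cuspSeries q = D at *
  linear_combination -(1 - k * X ^ 2) * hA - (k - 2) * (1 - k * X ^ 2) * hC -
    k * ((1 - k * X ^ 2) * D * hA + ((k - 1) * X ^ 2 * (1 - y) + X * y * (1 - k * X ^ 2)) * hC)

variable {q N : ℕ} {Γ V : Type} [Group Γ] [MulAction Γ V] {𝒯 : SimpleGraph V}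

theorem eval_zero_mul_ne_zero (q N : ℕ) : (oddPoly q N * evenPoly q N).eval 0 ≠ 0 := by
  rw [Polynomial.eval_mul, eval_oddPoly, eval_evenPoly]
  simp

/-- The sum of the gaps as a sum of powers. -/
theorem LoopCuspTree.gapSum_eq_powerSum (M : LoopCuspTree q N Γ V 𝒯) {m : ℕ} (hm : m ≠ 0) :
    (M.gapSum m : ℂ) = (q - 1) * (q ^ m + 1 + (-1) ^ m -
      3 * ((Real.sqrt q : ℂ) ^ m + (-(Real.sqrt q : ℂ)) ^ m) +
      ((oddPoly q N * evenPoly q N).roots.map fun z => (z⁻¹) ^ m).sum) := by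
  have hD1 : constantCoeff (oddDet q N) = 1 := by
    simp [oddDet, constantCoeff_loopSeries, constantCoeff_crossSeries]
  have hD2 : constantCoeff (evenDet q N) = 1 := by
    simp [evenDet, constantCoeff_loopSeries, constantCoeff_crossSeries, constantCoeff_cuspSeries]
  have hD : constantCoeff (oddDet q N * evenDet q N) ≠ 0 := by
    rw [map_mul, hD1, hD2]
    simp
  have hsq : ((Real.sqrt q : ℝ) : ℂ) * (Real.sqrt q : ℝ) = q := by
    rw [← Complex.ofReal_mul, Real.mul_self_sqrt (Nat.cast_nonneg q)]
    simp
  set r : ℂ := ((Real.sqrt q : ℝ) : ℂ) with hr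
  have hQ : (1 - C (q : ℂ) * X ^ 2 : ℂ⟦X⟧) = (1 - C r * X) * (1 - C (-r) * X) := by
    rw [← hsq, map_mul, map_neg]
    ring
  have hPP : ((oddPoly q N * evenPoly q N : Polynomial ℂ) : ℂ⟦X⟧) =
      (oddPoly q N : ℂ⟦X⟧) * (evenPoly q N : ℂ⟦X⟧) := Polynomial.coe_mul _ _
  have hdet : (oddDet q N * evenDet q N) *
      (((1 - C r * X) * (1 - C (-r) * X)) * (((1 - C r * X) * (1 - C (-r) * X)) *
        ((1 - C r * X) * (1 - C (-r) * X)))) =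
      ((1 - C 1 * X) * ((1 - C (-1) * X) * (1 - C (q : ℂ) * X))) *
        ((oddPoly q N * evenPoly q N : Polynomial ℂ) : ℂ⟦X⟧) := by
    have h1 := oddDet_mul q N
    have h2 := evenDet_mul q N
    rw [← hQ, hPP, map_neg, map_one]
    linear_combination (evenDet q N * (1 - C (q : ℂ) * X ^ 2) ^ 2) * h1 +
      (1 - X) * (oddPoly q N : ℂ⟦X⟧) * h2
  have hconst : constantCoeff ((oddPoly q N * evenPoly q N : Polynomial ℂ) : ℂ⟦X⟧) ≠ 0 := by
    rw [hPP, coe_oddPoly, coe_evenPoly]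
    simp
  have hlog := congrArg (fun f => coeff m (logSeries f)) hdet
  have hne : ∀ c : ℂ, constantCoeff (1 - C c * X) ≠ 0 := fun c => by simp
  have hne2 : ∀ f g : ℂ⟦X⟧, constantCoeff f ≠ 0 → constantCoeff g ≠ 0 →
      constantCoeff (f * g) ≠ 0 := fun f g hf hg => by
    rw [map_mul]
    exact mul_ne_zero hf hg
  have h2 := hne2 _ _ (hne r) (hne (-r))
  have h3 := hne2 _ _ (hne (-1)) (hne q)
  simp only [logSeries_mul hD (hne2 _ _ h2 (hne2 _ _ h2 h2)), logSeries_mul h2 (hne2 _ _ h2 h2),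
    logSeries_mul h2 h2, logSeries_mul (hne r) (hne (-r)),
      logSeries_mul (hne2 _ _ (hne 1) h3) hconst,
    logSeries_mul (hne 1) h3, logSeries_mul (hne (-1)) (hne q), map_add,
    coeff_logSeries_one_sub _ hm, coeff_logSeries_polynomial (eval_zero_mul_ne_zero q N) hm] at hlog
  have hG := eq_logSeries hD M.gapSeries_mul_det
  have hG' := congrArg (coeff m) hG
  rw [coeff_mk, show (C (q : ℂ) - 1 : ℂ⟦X⟧) = C (q - 1 : ℂ) by rw [map_sub, map_one],
    coeff_C_mul] at hG'
  rw [hG', one_pow] at *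
  linear_combination (q - 1 : ℂ) * hlog

end LoopWithCusp

/-! ### Growth of power sums -/

namespace LoopWithCusp

/-- A power sum grows at least as fast as the powers of any of its terms. -/
theorem not_isBigO_powerSum {s : Multiset ℂ} {c : ℂ} (hc : c ∈ s) {ρ : ℝ} (hρ : 0 < ρ)
    (hρc : ρ < ‖c‖) :
    ¬ (fun m : ℕ => (s.map fun z => z ^ m).sum) =O[atTop] fun m : ℕ => ρ ^ m := by
  intro h
  -- A difference operator with characteristic polynomial `p` removes all terms but the powers of
  -- `c`.
  obtain ⟨p, hp⟩ : ∃ p : Polynomial ℂ, p = ∏ z ∈ s.toFinset.erase c,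
    (Polynomial.X - Polynomial.C z) := ⟨_, rfl⟩
  have hpz : ∀ z ∈ s.toFinset, z ≠ c → p.eval z = 0 := by
    intro z hz hne
    rw [hp, Polynomial.eval_prod]
    exact Finset.prod_eq_zero (Finset.mem_erase.2 ⟨hne, hz⟩) (by simp)
  have hpc : p.eval c ≠ 0 := by
    rw [hp, Polynomial.eval_prod, Finset.prod_ne_zero_iff]
    intro z hz
    rw [Polynomial.eval_sub, Polynomial.eval_X, Polynomial.eval_C, sub_ne_zero]
    exact (Finset.mem_erase.1 hz).1.symm
  have key : ∀ m : ℕ, ∑ j ∈ Finset.range (p.natDegree + 1),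
      p.coeff j * (s.map fun z => z ^ (m + j)).sum = (s.count c * p.eval c) * c ^ m := by
    intro m
    have h1 : ∀ j ∈ Finset.range (p.natDegree + 1), p.coeff j * (s.map fun z => z ^ (m + j)).sum =
        ∑ z ∈ s.toFinset, s.count z * (p.coeff j * z ^ (m + j)) := by
      intro j _
      rw [Finset.sum_multiset_map_count, Finset.mul_sum]
      refine Finset.sum_congr rfl fun z _ => ?_
      rw [nsmul_eq_mul]
      ring
    rw [Finset.sum_congr rfl h1, Finset.sum_comm]
    have h2 : ∀ z ∈ s.toFinset, ∑ j ∈ Finset.range (p.natDegree + 1),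
        (s.count z : ℂ) * (p.coeff j * z ^ (m + j)) = (s.count z * p.eval z) * z ^ m := by
      intro z _
      rw [Polynomial.eval_eq_sum_range, Finset.mul_sum, Finset.sum_mul]
      refine Finset.sum_congr rfl fun j _ => ?_
      rw [pow_add]
      ring
    rw [Finset.sum_congr rfl h2, Finset.sum_eq_single c]
    · intro z hz hne
      rw [hpz z hz hne, mul_zero, zero_mul]
    · intro hn
      exact absurd (Multiset.mem_toFinset.2 hc) hn
  have hO : (fun m : ℕ => (s.count c * p.eval c) * c ^ m) =O[atTop] fun m : ℕ => ρ ^ m := by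
    simp_rw [← key]
    refine IsBigO.fun_sum fun j _ => IsBigO.const_mul_left ?_ _
    have h1 := h.comp_tendsto (tendsto_add_atTop_nat j)
    have h2 : ((fun m : ℕ => ρ ^ m) ∘ fun m => m + j) = fun m : ℕ => ρ ^ j * ρ ^ m := by
      funext m
      simp only [Function.comp, pow_add]
      ring
    rw [h2] at h1
    exact h1.trans ((isBigO_refl _ _).const_mul_left _)
  have hK : (s.count c * p.eval c : ℂ) ≠ 0 :=
    mul_ne_zero (by exact_mod_cast (Multiset.count_pos.2 hc).ne') hpc
  have hO' : (fun m : ℕ => ‖c‖ ^ m) =O[atTop] fun m : ℕ => ρ ^ m := by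
    have h1 := (isBigO_const_mul_left_iff hK).1 hO
    have h2 := h1.norm_left
    simpa only [norm_pow] using h2
  have hlt := hO'.trans_isLittleO (isLittleO_pow_pow_of_lt_left hρ.le hρc)
  refine isLittleO_irrefl ?_ hlt
  exact Frequently.of_forall fun m => (pow_pos (hρ.trans hρc) m).ne'

theorem powerSum_isLittleO {s : Multiset ℂ} {r : ℝ} (hs : ∀ z ∈ s, ‖z‖ < r) :
    (fun m : ℕ => (s.map fun z => z ^ m).sum) =o[atTop] fun m : ℕ => r ^ m := by
  induction s using Multiset.induction with
  | empty => simp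
  | cons z s ih =>
    simp only [Multiset.map_cons, Multiset.sum_cons]
    refine IsLittleO.add ?_ (ih fun w hw => hs w (Multiset.mem_cons_of_mem hw))
    have h1 := isLittleO_pow_pow_of_lt_left (norm_nonneg z) (hs z (Multiset.mem_cons_self z s))
    refine IsLittleO.of_norm_left ?_
    simpa only [norm_pow] using h1

/-! ### The zeros of the determinant -/

section zeros

variable {q : ℕ} (hq : 2 ≤ q) {N : ℕ}

include hq

theorem norm_mul_sq_le {u : ℂ} (hu : ‖u‖ ≤ 1 / q) : ‖(q * u ^ 2) ^ N * u‖ ≤ (1 / 2) ^ (N + 1) := by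
  have hq2 : (2 : ℝ) ≤ q := by exact_mod_cast hq
  have hu2 : ‖u‖ ≤ 1 / 2 := hu.trans (one_div_le_one_div_of_le two_pos hq2)
  have h1 : ‖(q * u ^ 2 : ℂ)‖ ≤ 1 / 2 := by
    rw [norm_mul, norm_pow, Complex.norm_natCast]
    have h2 : (q : ℝ) * ‖u‖ ≤ 1 := by
      have := mul_le_mul_of_nonneg_left hu (by positivity : (0 : ℝ) ≤ q)
      rwa [mul_one_div_cancel (by positivity)] at this
    nlinarith [norm_nonneg u]
  rw [norm_mul, norm_pow, pow_succ]
  exact mul_le_mul (pow_le_pow_left₀ (norm_nonneg _) h1 N) hu2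
    (norm_nonneg _) (pow_nonneg (by norm_num) N)

theorem oddPoly_eval_ne_zero (hN : 5 ≤ N) {u : ℂ} (hu : ‖u‖ ≤ 1 / q) :
    (oddPoly q N).eval u ≠ 0 := by
  have hq2 : (2 : ℝ) ≤ q := by exact_mod_cast hq
  have hu2 : ‖u‖ ≤ 1 / 2 := hu.trans (one_div_le_one_div_of_le two_pos hq2)
  intro h
  rw [eval_oddPoly, sub_eq_zero] at h
  have h1 : ‖(1 + q * u : ℂ)‖ ≤ 2 := by
    refine (norm_add_le _ _).trans ?_
    rw [norm_mul, Complex.norm_natCast, norm_one]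
    have := mul_le_mul_of_nonneg_left hu (by positivity : (0 : ℝ) ≤ q)
    rw [mul_one_div_cancel (by positivity)] at this
    linarith
  have h2 : 1 - ‖u‖ ≤ ‖1 + u‖ := by
    have := norm_sub_norm_le (1 : ℂ) (-u)
    rwa [norm_one, norm_neg, sub_neg_eq_add] at this
  have h3 := norm_mul_sq_le hq (N := N) hu
  have h4 : ((1 : ℝ) / 2) ^ (N + 1) ≤ (1 / 2) ^ 6 :=
    pow_le_pow_of_le_one (by norm_num) (by norm_num) (by omega)
  rw [h, norm_mul] at h2
  have h5 := mul_le_mul h3 h1 (norm_nonneg _) (by positivity)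
  norm_num at h4
  linarith

/-- On the disc of radius `1 / q` the dominant part of the even polynomial has non-negative real
part; close to its zero `-1 / q` the other part has negative real part. -/
theorem evenPoly_eval_ne_zero (hN : 5 ≤ N) {u : ℂ} (hu : ‖u‖ ≤ 1 / q) :
    (evenPoly q N).eval u ≠ 0 := by
  have hq2 : (2 : ℝ) ≤ q := by exact_mod_cast hq
  have hq0 : (q : ℂ) ≠ 0 := by
    exact_mod_cast (by omega : q ≠ 0)
  have hqr : (q : ℝ) ≠ 0 := by positivity
  intro h
  rw [eval_evenPoly] at h
  obtain ⟨w, hw⟩ : ∃ w : ℂ, w = -(q * u) := ⟨_, rfl⟩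
  have hwu : u = -(w / q) := by
    rw [hw]
    field_simp
  have hw1 : ‖w‖ ≤ 1 := by
    rw [hw, norm_neg, norm_mul, Complex.norm_natCast]
    have := mul_le_mul_of_nonneg_left hu (by positivity : (0 : ℝ) ≤ q)
    rwa [mul_one_div_cancel (by positivity)] at this
  obtain ⟨c, hc⟩ : ∃ c : ℝ, c = (1 / q) ^ (N + 1) := ⟨_, rfl⟩
  have hc0 : 0 < c := by rw [hc]; positivity
  obtain ⟨t, ht⟩ : ∃ t : ℝ, t = (q - 2) / q := ⟨_, rfl⟩
  have ht0 : 0 ≤ t := by rw [ht]; exact div_nonneg (by linarith) (by positivity)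
  have ht1 : t ≤ 1 := by rw [ht, div_le_one (by positivity)]; linarith
  have heq : (1 - w) * (1 + w / q) = -(c * (w ^ (2 * N + 1) + t * w ^ (2 * N + 3))) := by
    have e1 : (q * u ^ 2 : ℂ) = w ^ 2 * (1 / q) := by
      rw [hw]
      field_simp
    rw [e1] at h
    rw [hc, ht]
    push_cast
    rw [mul_pow, ← pow_mul] at h
    rw [hwu] at h
    have e2 : (1 + (q : ℂ) * (q - 2) * (-(w / q)) ^ 2) = 1 + (q - 2) / q * w ^ 2 := by
      field_simp
    have e3 : (1 + (q : ℂ) * -(w / q)) = 1 - w := by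
      field_simp
      ring
    rw [e2, e3] at h
    rw [pow_succ (1 / (q : ℂ)), pow_add, pow_add]
    linear_combination h
  have hden : 1 / 2 ≤ ‖1 + w / q‖ := by
    have h1 := norm_sub_norm_le (1 : ℂ) (-(w / q))
    rw [norm_one, norm_neg, sub_neg_eq_add, norm_div, Complex.norm_natCast] at h1
    have h2 : ‖w‖ / q ≤ 1 / 2 := div_le_div₀ zero_le_one hw1 two_pos hq2
    linarith
  have hnum : ‖w ^ (2 * N + 1) + (t : ℂ) * w ^ (2 * N + 3)‖ ≤ 2 := by
    refine (norm_add_le _ _).trans ?_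
    rw [norm_mul, norm_pow, norm_pow, Complex.norm_real, Real.norm_of_nonneg ht0]
    have h1 : ‖w‖ ^ (2 * N + 1) ≤ 1 := pow_le_one₀ (norm_nonneg _) hw1
    have h2 : ‖w‖ ^ (2 * N + 3) ≤ 1 := pow_le_one₀ (norm_nonneg _) hw1
    nlinarith [pow_nonneg (norm_nonneg w) (2 * N + 3)]
  have hdist : ‖1 - w‖ ≤ 4 * c := by
    have h1 := congrArg norm heq
    rw [norm_neg, norm_mul, norm_mul, Complex.norm_real, Real.norm_of_nonneg hc0.le] at h1
    have h2 := mul_le_mul_of_nonneg_left hden (norm_nonneg (1 - w))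
    have h3 := mul_le_mul_of_nonneg_left hnum hc0.le
    linarith
  have hcN : (2 * N + 3 : ℝ) * (4 * c) < 1 := by
    have h1 : c ≤ (1 / 2) ^ (N + 1) := by
      rw [hc]
      exact pow_le_pow_left₀ (by positivity) (one_div_le_one_div_of_le two_pos hq2) _
    have h2 : (2 * N + 3) * 4 < 2 ^ (N + 1) := by
      clear * - hN
      induction N, hN using Nat.le_induction with
      | base => norm_num
      | succ n hn ih =>
        rw [pow_succ]
        omega
    have h3 : ((2 * N + 3) * 4 : ℝ) < 2 ^ (N + 1) := by exact_mod_cast h2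
    have h4 : (2 : ℝ) ^ (N + 1) * (1 / 2) ^ (N + 1) = 1 := by
      rw [← mul_pow]
      norm_num
    calc (2 * N + 3 : ℝ) * (4 * c) = (2 * N + 3) * 4 * c := by ring
      _ ≤ (2 * N + 3) * 4 * (1 / 2) ^ (N + 1) := by gcongr
      _ < 2 ^ (N + 1) * (1 / 2) ^ (N + 1) := by gcongr
      _ = 1 := h4
  have hre : ∀ k : ℕ, (k : ℝ) ≤ 2 * N + 3 → 0 < (w ^ k).re := by
    intro k hk
    have hpow : ∀ k : ℕ, ‖1 - w ^ k‖ ≤ k * ‖1 - w‖ := by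
      intro k
      induction k with
      | zero => simp
      | succ k ih =>
        have e : 1 - w ^ (k + 1) = (1 - w ^ k) + w ^ k * (1 - w) := by ring
        rw [e]
        refine (norm_add_le _ _).trans ?_
        rw [norm_mul, norm_pow]
        have h1 : ‖w‖ ^ k ≤ 1 := pow_le_one₀ (norm_nonneg _) hw1
        have h2 := mul_le_mul_of_nonneg_right h1 (norm_nonneg (1 - w))
        push_cast
        linarith
    have h1 : ‖1 - w ^ k‖ < 1 := by
      calc ‖1 - w ^ k‖ ≤ k * ‖1 - w‖ := hpow k
        _ ≤ (2 * N + 3) * (4 * c) := by gcongr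
        _ < 1 := hcN
    have h2 := (Complex.re_le_norm (1 - w ^ k)).trans_lt h1
    rw [Complex.sub_re, Complex.one_re] at h2
    linarith
  have h1 := congrArg Complex.re heq
  have hre1 := hre (2 * N + 1) (by push_cast; linarith)
  have hre2 := hre (2 * N + 3) (by push_cast; linarith)
  have e4 : (1 - w) * (1 + w / q) = 1 - ((1 - 1 / q : ℝ) : ℂ) * w - ((1 / q : ℝ) : ℂ) * w ^ 2 := by
    push_cast
    ring
  rw [e4] at h1
  simp only [Complex.sub_re, Complex.one_re, Complex.re_ofReal_mul, Complex.neg_re,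
    Complex.add_re] at h1
  have h2 : w.re ≤ 1 := (Complex.re_le_norm w).trans hw1
  have h3 : (w ^ 2).re ≤ 1 := (Complex.re_le_norm _).trans (by
    rw [norm_pow]
    exact pow_le_one₀ (norm_nonneg _) hw1)
  have h4 : (0 : ℝ) < 1 / q := by positivity
  have h5 : (1 : ℝ) / q ≤ 1 := by
    rw [div_le_one (by positivity)]
    linarith
  have h6 : 0 < c * ((w ^ (2 * N + 1)).re + t * (w ^ (2 * N + 3)).re) :=
    mul_pos hc0 (add_pos_of_pos_of_nonneg hre1 (mul_nonneg ht0 hre2.le))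
  have h7 := mul_le_mul_of_nonneg_left h2 (sub_nonneg.2 h5)
  have h8 := mul_le_mul_of_nonneg_left h3 h4.le
  linarith

theorem one_div_lt_norm_of_mem_roots (hN : 5 ≤ N) {u : ℂ}
    (hu : u ∈ (oddPoly q N * evenPoly q N).roots) : 1 / (q : ℝ) < ‖u‖ := by
  by_contra! hle
  have h1 := Polynomial.isRoot_of_mem_roots hu
  rw [Polynomial.IsRoot, Polynomial.eval_mul] at h1
  exact (mul_ne_zero (oddPoly_eval_ne_zero hq hN hle) (evenPoly_eval_ne_zero hq hN hle)) h1

/-- For long loops the even polynomial has a zero that is only slightly larger in modulus than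
`1 / q`. -/
theorem exists_root_evenPoly {ρ : ℝ} (h1 : Real.sqrt q < ρ) (h2 : ρ < q) :
    ∀ᶠ N in atTop, ∃ u ∈ (oddPoly q N * evenPoly q N).roots, ‖u‖ < 1 / ρ := by
  have hq2 : (2 : ℝ) ≤ q := by exact_mod_cast hq
  have hρ : 0 < ρ := (Real.sqrt_nonneg _).trans_lt h1
  have hρ2 : (q : ℝ) < ρ ^ 2 := (Real.sqrt_lt' hρ).1 h1
  let f : ℕ → ℝ → ℝ := fun N u => (1 - u) * (1 + q * u) -
    (q * u ^ 2) ^ N * u * (1 + q * (q - 2) * u ^ 2)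
  have hlim : Tendsto (fun N => f N (-(1 / ρ))) atTop (𝓝 ((1 + 1 / ρ) * (1 - q / ρ))) := by
    have h3 : Tendsto (fun N : ℕ => (q * (1 / ρ) ^ 2 : ℝ) ^ N) atTop (𝓝 0) := by
      refine tendsto_pow_atTop_nhds_zero_of_lt_one (by positivity) ?_
      rw [one_div, inv_pow, ← div_eq_mul_inv, div_lt_one (by positivity)]
      exact hρ2
    have h4 := ((h3.mul_const (-(1 / ρ))).mul_const (1 + q * (q - 2) * (1 / ρ) ^ 2)).const_sub
      ((1 + 1 / ρ) * (1 - q / ρ))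
    simp only [zero_mul, sub_zero] at h4
    refine h4.congr fun N => ?_
    simp only [f, neg_sq]
    ring
  have hneg : (1 + 1 / ρ) * (1 - q / ρ) < 0 := by
    refine mul_neg_of_pos_of_neg (by positivity) ?_
    rw [sub_neg, lt_div_iff₀ hρ]
    linarith
  filter_upwards [hlim.eventually (gt_mem_nhds hneg)] with N hN
  have hpos : 0 ≤ f N (-(1 / q)) := by
    have e : (1 - -(1 / (q : ℝ))) * (1 + q * -(1 / q)) = 0 := by
      have : (q : ℝ) * (1 / q) = 1 := by field_simp
      rw [mul_neg, this]
      ring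
    simp only [f]
    rw [e]
    have h5 : (0 : ℝ) ≤ (q * (-(1 / q)) ^ 2) ^ N := by positivity
    have h6 : (0 : ℝ) ≤ 1 + q * (q - 2) * (-(1 / q)) ^ 2 := by
      have : (0 : ℝ) ≤ q - 2 := by linarith
      positivity
    have h7 : (0 : ℝ) ≤ 1 / q := by positivity
    have := mul_nonneg (mul_nonneg h5 h7) h6
    linarith
  have hle : -(1 / ρ) ≤ -(1 / (q : ℝ)) :=
    neg_le_neg (one_div_le_one_div_of_le hρ h2.le)
  have hcont : ContinuousOn (f N) (Set.Icc (-(1 / ρ)) (-(1 / q))) := by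
    refine Continuous.continuousOn ?_
    simp only [f]
    fun_prop
  obtain ⟨u, hu, hu0⟩ := intermediate_value_Icc hle hcont ⟨hN.le, hpos⟩
  have hune : u ≠ -(1 / ρ) := by
    rintro rfl
    exact hN.ne hu0
  have hlt : -(1 / ρ) < u := lt_of_le_of_ne hu.1 hune.symm
  have hneg' : u < 0 := hu.2.trans_lt (by rw [neg_neg_iff_pos]; positivity)
  refine ⟨(u : ℂ), ?_, ?_⟩
  · rw [Polynomial.mem_roots]
    · rw [Polynomial.IsRoot, Polynomial.eval_mul, eval_evenPoly]
      have : (f N u : ℂ) = 0 := by rw [hu0, Complex.ofReal_zero]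
      simp only [f] at this
      push_cast at this
      rw [this, mul_zero]
    · intro h
      have := eval_zero_mul_ne_zero q N
      rw [h] at this
      simp at this
  · rw [Complex.norm_real, Real.norm_eq_abs, abs_of_neg hneg']
    linarith

end zeros

end LoopWithCusp

/-! ### The asymptotic behaviour of the class sums -/

namespace LoopWithCusp

variable {q N : ℕ} {Γ V : Type} [Group Γ] [MulAction Γ V] {𝒯 : SimpleGraph V}

theorem one_lt_sqrt (hq : 2 ≤ q) : 1 < Real.sqrt q := by
  rw [Real.lt_sqrt zero_le_one]
  have : (2 : ℝ) ≤ q := by exact_mod_cast hq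
  linarith

namespace LoopCuspTree

variable (M : LoopCuspTree q N Γ V 𝒯)

/-- The inverses of the zeros of the determinant that depend on `N`. -/
def zeros (q N : ℕ) : Multiset ℂ := (oddPoly q N * evenPoly q N).roots.map (·⁻¹)

theorem norm_lt_of_mem_zeros (hq : 2 ≤ q) (hN : 5 ≤ N) {z : ℂ} (hz : z ∈ zeros q N) :
    ‖z‖ < q := by
  obtain ⟨u, hu, rfl⟩ := Multiset.mem_map.1 hz
  have h1 := one_div_lt_norm_of_mem_roots hq hN hu
  have h0 : (0 : ℝ) < q := by exact_mod_cast (by omega : 0 < q)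
  rw [norm_inv]
  rw [one_div] at h1
  exact inv_lt_of_inv_lt₀ h0 h1

theorem gapSum_div_eq {m : ℕ} (hm : m ≠ 0) : ((M.gapSum m / ((q - 1 : ℕ) : ℝ) : ℝ) : ℂ) =
    q ^ m + 1 + (-1) ^ m - 3 * ((Real.sqrt q : ℂ) ^ m + (-(Real.sqrt q : ℂ)) ^ m) +
      ((zeros q N).map fun z => z ^ m).sum := by
  have hq := M.two_le
  have h0 : ((q - 1 : ℕ) : ℂ) ≠ 0 := by exact_mod_cast (by omega : q - 1 ≠ 0)
  push_cast
  rw [M.gapSum_eq_powerSum hm, zeros, Multiset.map_map]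
  have h1 : ((q - 1 : ℕ) : ℂ) = q - 1 := by rw [Nat.cast_sub (by omega), Nat.cast_one]
  rw [div_eq_iff h0, h1, mul_comm]
  rfl

theorem powers_isBigO (hq : 2 ≤ q) {ρ : ℝ} (hρ : Real.sqrt q < ρ) :
    (fun m : ℕ => (1 : ℂ) + (-1) ^ m -
      3 * ((Real.sqrt q : ℂ) ^ m + (-(Real.sqrt q : ℂ)) ^ m)) =O[atTop] fun m : ℕ => ρ ^ m := by
  have h1 : ∀ c : ℂ, ‖c‖ ≤ Real.sqrt q → (fun m : ℕ => c ^ m) =O[atTop] fun m : ℕ => ρ ^ m := by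
    intro c hc
    have h2 := (isLittleO_pow_pow_of_lt_left (norm_nonneg c) (hc.trans_lt hρ)).isBigO
    refine IsBigO.of_norm_left ?_
    simpa only [norm_pow] using h2
  have hs := (one_lt_sqrt hq).le
  have hr : ‖(Real.sqrt q : ℂ)‖ ≤ Real.sqrt q := by
    rw [Complex.norm_real, Real.norm_of_nonneg (Real.sqrt_nonneg _)]
  have e1 := h1 1 (by rwa [norm_one])
  simp only [one_pow] at e1
  exact (e1.add (h1 (-1) (by rwa [norm_neg, norm_one]))).sub
    (((h1 _ hr).add (h1 _ (by rwa [norm_neg]))).const_mul_left 3)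

theorem exists_gapSum_le (hN : 5 ≤ N) : ∃ K : ℝ, 0 < K ∧ ∀ m, (M.gapSum m : ℝ) ≤ K * q ^ m := by
  have hq := M.two_le
  have hq1 : (1 : ℝ) < q := by exact_mod_cast (by omega : 1 < q)
  have h0 : (0 : ℝ) < ((q - 1 : ℕ) : ℝ) := by exact_mod_cast (by omega : 0 < q - 1)
  have hsq : Real.sqrt q < q := by
    rw [Real.sqrt_lt' (by linarith)]
    nlinarith
  have h1 : (fun m : ℕ => ((M.gapSum m / ((q - 1 : ℕ) : ℝ) : ℝ) : ℂ)) =O[atTop]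
      fun m : ℕ => (q : ℝ) ^ m := by
    have h2 : (fun m : ℕ => (q : ℂ) ^ m) =O[atTop] fun m : ℕ => (q : ℝ) ^ m := by
      refine IsBigO.of_norm_left ?_
      simpa only [norm_pow, Complex.norm_natCast] using isBigO_refl _ _
    have h3 := (h2.add (powers_isBigO hq hsq)).add
      (powerSum_isLittleO fun z hz => norm_lt_of_mem_zeros hq hN hz).isBigO
    refine h3.congr' ?_ (EventuallyEq.refl _ _)
    filter_upwards [eventually_ne_atTop 0] with m hm
    rw [M.gapSum_div_eq hm]
    ring
  obtain ⟨K, hK, h⟩ := bound_of_isBigO_nat_atTop h1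
  refine ⟨K * ((q - 1 : ℕ) : ℝ), by positivity, fun m => ?_⟩
  have h4 := h (x := m) (by positivity)
  rw [Complex.norm_real, Real.norm_of_nonneg (by positivity), Real.norm_of_nonneg (by positivity),
    div_le_iff₀ h0] at h4
  linarith

theorem ncard_powers_isBigO (hN : 5 ≤ N) :
    (fun m : ℕ => (m : ℝ) * (M.powers m).ncard) =O[atTop]
      fun m : ℕ => (m : ℝ) ^ 2 * Real.sqrt q ^ m := by
  have hq := M.two_le
  obtain ⟨K, hK, h⟩ := M.exists_gapSum_le hN
  have hq1 : (1 : ℝ) ≤ q := by exact_mod_cast (by omega : 1 ≤ q)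
  refine IsBigO.of_bound (((q - 1 : ℕ) : ℝ) * K) (Eventually.of_forall fun m => ?_)
  rw [Real.norm_of_nonneg (by positivity), Real.norm_of_nonneg (by positivity)]
  have h1 : ((M.powers m).ncard : ℝ) ≤ ∑ d ∈ Finset.Icc 1 (m / 2),
      ((q - 1 : ℕ) : ℝ) * M.gapSum d := by
    exact_mod_cast M.ncard_powers_le m
  have hs : (q : ℝ) ^ (m / 2) ≤ Real.sqrt q ^ m := by
    calc (q : ℝ) ^ (m / 2) = (Real.sqrt q ^ 2) ^ (m / 2) := by rw [Real.sq_sqrt (by positivity)]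
      _ = Real.sqrt q ^ (2 * (m / 2)) := (pow_mul _ _ _).symm
      _ ≤ Real.sqrt q ^ m := pow_le_pow_right₀ (one_lt_sqrt hq).le (by omega)
  have h2 : ∀ d ∈ Finset.Icc 1 (m / 2), ((q - 1 : ℕ) : ℝ) * M.gapSum d ≤
      ((q - 1 : ℕ) : ℝ) * (K * Real.sqrt q ^ m) := by
    intro d hd
    refine mul_le_mul_of_nonneg_left ((h d).trans ?_) (by positivity)
    refine mul_le_mul_of_nonneg_left (le_trans ?_ hs) hK.le
    exact pow_le_pow_right₀ hq1 (Finset.mem_Icc.1 hd).2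
  have h3 := h1.trans (Finset.sum_le_card_nsmul _ _ _ h2)
  rw [Nat.card_Icc, Nat.add_sub_cancel, nsmul_eq_mul] at h3
  have h4 : ((m / 2 : ℕ) : ℝ) ≤ m := by exact_mod_cast Nat.div_le_self m 2
  calc (m : ℝ) * (M.powers m).ncard
      ≤ m * ((m / 2 : ℕ) * (((q - 1 : ℕ) : ℝ) * (K * Real.sqrt q ^ m))) := by gcongr
    _ ≤ m * (m * (((q - 1 : ℕ) : ℝ) * (K * Real.sqrt q ^ m))) := by gcongr
    _ = ((q - 1 : ℕ) : ℝ) * K * (m ^ 2 * Real.sqrt q ^ m) := by ring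

/-- A sequence that differs from the normalised sums of the gaps by the contributions of the proper
powers is `q ^ m` plus a power sum over the zeros of the determinant, up to a smaller error. -/
theorem sub_powerSum_isBigO (hN : 5 ≤ N) {w : ℕ → ℝ}
    (hw : ∀ m, |w m - M.gapSum m / ((q - 1 : ℕ) : ℝ)| ≤ m * (M.powers m).ncard) {ρ : ℝ}
    (hρ : Real.sqrt q < ρ) :
    (fun m : ℕ => ((w m - q ^ m : ℝ) : ℂ) - ((zeros q N).map fun z => z ^ m).sum) =O[atTop]
      fun m : ℕ => ρ ^ m := by
  have hq := M.two_le
  have h1 : (fun m : ℕ => ((w m - M.gapSum m / ((q - 1 : ℕ) : ℝ) : ℝ) : ℂ)) =O[atTop]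
      fun m : ℕ => ρ ^ m := by
    have h2 : (fun m : ℕ => ((w m - M.gapSum m / ((q - 1 : ℕ) : ℝ) : ℝ) : ℂ)) =O[atTop]
        fun m : ℕ => (m : ℝ) * (M.powers m).ncard := by
      refine IsBigO.of_bound 1 (Eventually.of_forall fun m => ?_)
      rw [Complex.norm_real, one_mul, Real.norm_eq_abs]
      exact (hw m).trans (le_abs_self _)
    have h3 := isLittleO_pow_const_mul_const_pow_const_pow_of_norm_lt (R := ℝ) 2
      (r₁ := Real.sqrt q) (r₂ := ρ) (by rwa [Real.norm_of_nonneg (Real.sqrt_nonneg _)])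
    exact (h2.trans (M.ncard_powers_isBigO hN)).trans h3.isBigO
  refine (h1.add (powers_isBigO hq hρ)).congr' ?_ (EventuallyEq.refl _ _)
  filter_upwards [eventually_ne_atTop 0] with m hm
  have h4 := M.gapSum_div_eq hm
  push_cast at h4 ⊢
  linear_combination -h4

end LoopCuspTree

/-- For a suitable length of the loop, the class sums are asymptotic to `q ^ m`, but the error is
not bounded by the powers of `q - ε`. -/
theorem exists_asymptotics (hq : 2 ≤ q) {ε : ℝ} (hε : 0 < ε) (hεq : ε ≤ q) :
    ∃ n : ℕ, ∀ {Γ V : Type} [Group Γ] [MulAction Γ V] {𝒯 : SimpleGraph V}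
      (M : LoopCuspTree q (n + 1) Γ V 𝒯) (w : ℕ → ℝ),
      (∀ m, |w m - M.gapSum m / ((q - 1 : ℕ) : ℝ)| ≤ m * (M.powers m).ncard) →
      Tendsto (fun m : ℕ => w m / (q : ℝ) ^ m) atTop (𝓝 1) ∧
      ¬ ((fun m : ℕ => |w m - (q : ℝ) ^ m|) =O[atTop] fun m : ℕ => ((q : ℝ) - ε) ^ m) ∧
      ∃ᶠ m : ℕ in atTop, ((q : ℝ) - ε) ^ m < |w m - (q : ℝ) ^ m| := by
  have hq1 : (1 : ℝ) < q := by exact_mod_cast (by omega : 1 < q)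
  have hsq : Real.sqrt q < q := by
    rw [Real.sqrt_lt' (by linarith)]
    nlinarith
  obtain ⟨ρ, hρ1, hρ2⟩ := exists_between (max_lt hsq (by linarith : (q : ℝ) - ε < q))
  rw [max_lt_iff] at hρ1
  have hρ0 : 0 < ρ := (Real.sqrt_nonneg _).trans_lt hρ1.1
  obtain ⟨N, ⟨u, hu, hu1⟩, hN⟩ :=
    ((exists_root_evenPoly hq hρ1.1 hρ2).and (eventually_ge_atTop 5)).exists
  obtain ⟨n, rfl⟩ : ∃ n, N = n + 1 := ⟨N - 1, by omega⟩
  refine ⟨n, fun {Γ V} _ _ {𝒯} M w hw => ?_⟩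
  have hmain := M.sub_powerSum_isBigO hN hw hρ1.1
  have hnot : ¬ ((fun m : ℕ => |w m - (q : ℝ) ^ m|) =O[atTop]
      fun m : ℕ => ((q : ℝ) - ε) ^ m) := by
    intro h
    have h1 : (fun m : ℕ => ((q : ℝ) - ε) ^ m) =O[atTop] fun m : ℕ => ρ ^ m :=
      (isLittleO_pow_pow_of_lt_left (by linarith) hρ1.2).isBigO
    have h2 : (fun m : ℕ => ((w m - q ^ m : ℝ) : ℂ)) =O[atTop] fun m : ℕ => ρ ^ m := by
      refine IsBigO.of_norm_left ?_
      simpa only [Complex.norm_real, Real.norm_eq_abs] using h.trans h1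
    have h3 := (h2.sub hmain)
    simp only [sub_sub_cancel] at h3
    refine not_isBigO_powerSum (c := u⁻¹) (Multiset.mem_map_of_mem _ hu) hρ0 ?_ h3
    have hu0 : 0 < ‖u‖ :=
      (by positivity : (0 : ℝ) < 1 / q).trans (one_div_lt_norm_of_mem_roots hq hN hu)
    rw [norm_inv]
    rw [one_div] at hu1
    exact lt_inv_of_lt_inv₀ hu0 hu1
  refine ⟨?_, hnot, ?_⟩
  · have h1 := (hmain.trans_isLittleO (isLittleO_pow_pow_of_lt_left hρ0.le hρ2)).add
      (powerSum_isLittleO fun z hz => LoopCuspTree.norm_lt_of_mem_zeros hq hN hz)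
    simp only [sub_add_cancel] at h1
    have h2 : (fun m : ℕ => w m - (q : ℝ) ^ m) =o[atTop] fun m : ℕ => (q : ℝ) ^ m := by
      refine IsLittleO.of_norm_left ?_
      simpa only [Complex.norm_real] using h1.norm_left
    have h3 := (h2.tendsto_div_nhds_zero).add_const 1
    rw [zero_add] at h3
    refine h3.congr fun m => ?_
    have : (q : ℝ) ^ m ≠ 0 := by positivity
    rw [sub_div, div_self this, sub_add_cancel]
  · by_contra hfreq
    rw [not_frequently] at hfreq
    refine hnot (IsBigO.of_bound 1 ?_)
    filter_upwards [hfreq] with m hm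
    rw [Real.norm_of_nonneg (abs_nonneg _), one_mul]
    exact (not_lt.1 hm).trans (le_abs_self _)

end LoopWithCusp

/-! ### Fundamental groups of graphs of groups -/

namespace GraphOfGroups

variable (X : GraphOfGroups) (T : Set X.E)

theorem edgeElt_mul_vertexHom_mul (e : X.E) (a : X.eGrp e) :
    X.edgeElt T e * X.vertexHom T (X.tgt e) (X.toTgt e a) * (X.edgeElt T e)⁻¹ =
      X.vertexHom T (X.src e) (X.toSrc e a) := by
  have h := PresentedGroup.one_of_mem (rels := {r | X.IsRelator T r})
    (IsRelator.edge (X := X) (T := T) e a)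
  rwa [map_mul, map_mul, map_mul, map_inv, map_inv, mul_inv_eq_one] at h

theorem edgeElt_eq_one {e : X.E} (he : e ∈ T) : X.edgeElt T e = 1 :=
  PresentedGroup.one_of_mem (rels := {r | X.IsRelator T r}) (IsRelator.tree (X := X) e he)

/-- The universal property of the fundamental group. -/
theorem exists_hom {Q : Type*} [Group Q] (f : ∀ v, X.vGrp v →* Q) (p : X.E → Q)
    (h1 : ∀ e a, p e * f (X.tgt e) (X.toTgt e a) * (p e)⁻¹ = f (X.src e) (X.toSrc e a))
    (h2 : ∀ e ∈ T, p e = 1) :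
    ∃ φ : X.Pi1 T →* Q, (∀ v a, φ (X.vertexHom T v a) = f v a) ∧ ∀ e, φ (X.edgeElt T e) = p e := by
  let F : X.Gen → Q := Sum.elim (fun x => f x.1 x.2) p
  have hrel : ∀ r ∈ {r | X.IsRelator T r}, FreeGroup.lift F r = 1 := by
    rintro r (⟨v, a, b⟩ | ⟨e, a⟩ | ⟨e, he⟩)
    · simp [F]
    · rw [map_mul, map_mul, map_mul, map_inv, map_inv, mul_inv_eq_one]
      simp only [FreeGroup.lift_apply_of]
      exact h1 e a
    · rw [FreeGroup.lift_apply_of]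
      exact h2 e he
  exact ⟨PresentedGroup.toGroup hrel, fun v a => PresentedGroup.toGroup.of hrel,
    fun e => PresentedGroup.toGroup.of hrel⟩

theorem treeVertex_eq_iff (v : X.V) (g h : X.Pi1 T) :
    (⟨v, (g : X.Pi1 T ⧸ (X.vertexHom T v).range)⟩ : X.TreeVertex T) = ⟨v, (h : _)⟩ ↔
      ∃ x, h = g * X.vertexHom T v x := by
  have h1 : (⟨v, (g : X.Pi1 T ⧸ (X.vertexHom T v).range)⟩ : X.TreeVertex T) = ⟨v, (h : _)⟩ ↔
      (g : X.Pi1 T ⧸ (X.vertexHom T v).range) = (h : _) :=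
    ⟨fun e => eq_of_heq (Sigma.ext_iff.1 e).2, fun e => Sigma.ext rfl (heq_of_eq e)⟩
  rw [h1, QuotientGroup.eq]
  constructor
  · rintro ⟨x, hx⟩
    exact ⟨x, by rw [hx, mul_inv_cancel_left]⟩
  · rintro ⟨x, rfl⟩
    exact ⟨x, by rw [inv_mul_cancel_left]⟩

variable {X T}

theorem IsMaximalSubtree.adj (hT : X.IsMaximalSubtree T) {e : X.E} (he : e ∈ T) :
    (SimpleGraph.fromEdgeSet ((fun e => s(X.src e, X.tgt e)) '' T)).Adj (X.src e) (X.tgt e) := by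
  rw [SimpleGraph.fromEdgeSet_adj]
  exact ⟨⟨e, he, rfl⟩, hT.no_loop e he⟩

/-- A property that is preserved along the edges of a maximal subtree holds everywhere. -/
theorem IsMaximalSubtree.forall_of_iff (hT : X.IsMaximalSubtree T) {S : X.V → Prop} {v₀ : X.V}
    (h0 : S v₀) (h : ∀ e ∈ T, S (X.src e) ↔ S (X.tgt e)) (v : X.V) : S v := by
  obtain ⟨w⟩ := hT.isTree.connected v₀ v
  induction w with
  | nil => exact h0
  | cons hadj _ ih =>
    rw [SimpleGraph.fromEdgeSet_adj] at hadj
    obtain ⟨⟨e, he, hs⟩, _⟩ := hadj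
    refine ih ?_
    rcases Sym2.eq_iff.1 hs with ⟨h1, h2⟩ | ⟨h1, h2⟩
    · rw [← h2, ← h e he, h1]
      exact h0
    · rw [← h1, h e he, h2]
      exact h0

/-- Without one of its edges, a maximal subtree falls into two pieces. -/
theorem IsMaximalSubtree.exists_separation (hT : X.IsMaximalSubtree T) {e₀ : X.E} (he₀ : e₀ ∈ T) :
    ∃ S : X.V → Prop, S (X.src e₀) ∧ ¬ S (X.tgt e₀) ∧
      ∀ e ∈ T, e ≠ e₀ → (S (X.src e) ↔ S (X.tgt e)) := by
  set 𝒢 := SimpleGraph.fromEdgeSet ((fun e => s(X.src e, X.tgt e)) '' T) with h𝒢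
  have hbridge : 𝒢.IsBridge s(X.src e₀, X.tgt e₀) :=
    SimpleGraph.isAcyclic_iff_forall_isBridge.1 hT.isTree.isAcyclic (hT.adj he₀)
  refine ⟨(𝒢.deleteEdges {s(X.src e₀, X.tgt e₀)}).Reachable (X.src e₀),
    SimpleGraph.Reachable.refl _, SimpleGraph.isBridge_iff.1 hbridge, fun e he hne => ?_⟩
  have hadj : (𝒢.deleteEdges {s(X.src e₀, X.tgt e₀)}).Adj (X.src e) (X.tgt e) := by
    rw [SimpleGraph.deleteEdges_adj]
    exact ⟨hT.adj he, fun h => hne (hT.no_parallel he he₀ h)⟩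
  exact ⟨fun h => h.trans hadj.reachable, fun h => h.trans hadj.symm.reachable⟩

end GraphOfGroups

/-! ### The vertex groups of `X_N` in the fundamental group -/

namespace LoopWithCusp

section vertexMap

variable {q n : ℕ} {Q : Type} [Group Q] (κ : Multiplicative (ZMod (q - 1)) →* Q)
  (α β : GInf q →* Q) (t : Q) (hα : ∀ c b, Commute (κ c) (α b)) (ht : ∀ c, Commute (κ c) t)

/-- The homomorphisms from the vertex groups that are determined by the images of the group of the
base vertex, of the groups `G_N` and `G_∞`, and of the loop. -/
def vertexMap : ∀ v : Vertex n, vGrp q n v →* Q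
  | .base => (κ.comp (MonoidHom.fst _ _) : H q 0 →* Q)
  | .a i => (κ.noncommCoprod (α.comp (emb q (i + 1))) (fun c _ => hα c _) : H q (i + 1) →* Q)
  | .b i => (κ.noncommCoprod ((MulAut.conj t⁻¹).toMonoidHom.comp (α.comp (emb q (i + 1))))
      (fun c f => by
        change Commute (κ c) (t⁻¹ * α (emb q (i + 1) f) * t⁻¹⁻¹)
        rw [inv_inv]
        exact ((ht c).inv_right.mul_right (hα c _)).mul_right (ht c)) : H q (i + 1) →* Q)
  | .c k => (β.comp (emb q (k + 1)) : G q (k + 1) →* Q)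

theorem vertexMap_a (i : Fin (n + 1)) (x : H q (i + 1)) :
    vertexMap κ α β t hα ht (.a i) x = κ x.1 * α (emb q (i + 1) x.2) := rfl

theorem vertexMap_b (i : Fin (n + 1)) (x : H q (i + 1)) :
    vertexMap κ α β t hα ht (.b i) x = κ x.1 * (t⁻¹ * α (emb q (i + 1) x.2) * t) := by
  conv_rhs => rw [← inv_inv t]
  simp only [inv_inv]
  change κ x.1 * (t⁻¹ * α (emb q (i + 1) x.2) * t⁻¹⁻¹) = _
  rw [inv_inv]

theorem vertexMap_c (k : ℕ) (x : G q (k + 1)) :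
    vertexMap (n := n) κ α β t hα ht (.c k) x = β (emb q (k + 1) x) := rfl

theorem emb_zero (f : G q 0) : emb q 0 f = 1 := by
  rw [Subsingleton.elim f 1, map_one]

theorem vertexMap_toTgt {e : Edge n} (he : e ≠ .top) (x : eGrp q n e) :
    vertexMap κ α β t hα ht (tgt n e) (toTgt q n e x) =
      vertexMap κ α β t hα ht (src n e) (toSrc q n e x) := by
  cases e with
  | baseA =>
    change κ x.1 * α (emb q 1 (inclG q (Nat.zero_le 1) x.2)) = κ x.1
    rw [emb_inclG, emb_zero, map_one, mul_one]
  | baseB =>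
    refine (vertexMap_b κ α β t hα ht 0 _).trans ?_
    change κ x.1 * (t⁻¹ * α (emb q 1 (inclG q (Nat.zero_le 1) x.2)) * t) = κ x.1
    rw [emb_inclG, emb_zero, map_one, mul_one, inv_mul_cancel, mul_one]
  | segA i =>
    change κ x.1 * α (emb q _ (inclG q (Nat.le_succ ((i : ℕ) + 1)) x.2)) = κ x.1 * α (emb q _ x.2)
    rw [emb_inclG]
  | segB i =>
    refine (vertexMap_b κ α β t hα ht i.succ _).trans
      (Eq.trans ?_ (vertexMap_b κ α β t hα ht i.castSucc _).symm)
    change κ x.1 * (t⁻¹ * α (emb q _ (inclG q (Nat.le_succ ((i : ℕ) + 1)) x.2)) * t) =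
      κ x.1 * (t⁻¹ * α (emb q _ x.2) * t)
    rw [emb_inclG]
  | top => exact absurd rfl he
  | baseC =>
    have key : ∀ x : G q 0, β (emb q 1 (inclG q (Nat.zero_le 1) x)) = κ 1 := fun x => by
      rw [emb_inclG, emb_zero, map_one, map_one]
    exact key x
  | segC k =>
    have key : ∀ x : G q (k + 1), β (emb q _ (inclG q (Nat.le_succ (k + 1)) x)) = β (emb q _ x) :=
      fun x => by rw [emb_inclG]
    exact key x

theorem vertexMap_top (x : H q (n + 1)) :
    t * vertexMap κ α β t hα ht (.b (Fin.last n)) x * t⁻¹ =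
      vertexMap κ α β t hα ht (.a (Fin.last n)) x := by
  refine (congrArg (fun y => t * y * t⁻¹) (vertexMap_b κ α β t hα ht (Fin.last n) x)).trans ?_
  refine Eq.trans ?_ (vertexMap_a κ α β t hα ht (Fin.last n) x).symm
  rw [← mul_assoc t (κ x.1), ← (ht x.1).eq]
  group

end vertexMap

theorem vertex_induction {n : ℕ} {S : Vertex n → Prop} (h0 : S .base)
    (h : ∀ e : Edge n, e ≠ .top → S (src n e) → S (tgt n e)) (v : Vertex n) : S v := by
  cases v with
  | base => exact h0
  | a i =>
    induction i using Fin.induction with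
    | zero => exact h .baseA (by simp) h0
    | succ i ih => exact h (.segA i) (by simp) ih
  | b i =>
    induction i using Fin.induction with
    | zero => exact h .baseB (by simp) h0
    | succ i ih => exact h (.segB i) (by simp) ih
  | c k =>
    induction k with
    | zero => exact h .baseC (by simp) h0
    | succ k ih => exact h (.segC k) (by simp) ih

section Pi1

variable (q n : ℕ) (T : Set (graphOfGroups q n).E)

/-- The fundamental group of `X_N`. -/
abbrev FundGroup : Type := (graphOfGroups q n).Pi1 T

/-- The element of an edge in the fundamental group. -/
abbrev edgeG (e : Edge n) : FundGroup q n T := (graphOfGroups q n).edgeElt T e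

/-- The product of the elements of the edges along one side of the loop or along the cusp, starting
at the base. -/
def rayElt (x : ℕ → FundGroup q n T) : ℕ → FundGroup q n T
  | 0 => x 0
  | k + 1 => rayElt x k * x (k + 1)

/-- The elements of the edges of the upper side. -/
def edgesA : ℕ → FundGroup q n T
  | 0 => edgeG q n T .baseA
  | k + 1 => if h : k < n then edgeG q n T (.segA ⟨k, h⟩) else 1

/-- The elements of the edges of the lower side. -/
def edgesB : ℕ → FundGroup q n T
  | 0 => edgeG q n T .baseB
  | k + 1 => if h : k < n then edgeG q n T (.segB ⟨k, h⟩) else 1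

/-- The elements of the edges of the cusp. -/
def edgesC : ℕ → FundGroup q n T
  | 0 => edgeG q n T .baseC
  | k + 1 => edgeG q n T (.segC k)

/-- The product of the elements of the edges on the way from the base to a vertex that does not pass
the edge at the top. -/
def pathElt : Vertex n → FundGroup q n T
  | .base => 1
  | .a i => rayElt q n T (edgesA q n T) i
  | .b i => rayElt q n T (edgesB q n T) i
  | .c k => rayElt q n T (edgesC q n T) k

theorem pathElt_tgt {e : Edge n} (he : e ≠ .top) :
    pathElt q n T (tgt n e) = pathElt q n T (src n e) * edgeG q n T e := by
  cases e with
  | baseA => exact (one_mul _).symm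
  | baseB => exact (one_mul _).symm
  | segA i =>
    change rayElt q n T _ i * edgesA q n T (i + 1) = rayElt q n T _ i * _
    simp [edgesA]
  | segB i =>
    change rayElt q n T _ i * edgesB q n T (i + 1) = rayElt q n T _ i * _
    simp [edgesB]
  | top => exact absurd rfl he
  | baseC => exact (one_mul _).symm
  | segC k => rfl

/-- The element that runs once around the loop. -/
def loopElt : FundGroup q n T :=
  pathElt q n T (.a (Fin.last n)) * edgeG q n T .top * (pathElt q n T (.b (Fin.last n)))⁻¹

/-- The vertex group at `v`, conjugated to the base along the path to `v`. -/
def rho (v : Vertex n) : vGrp q n v →* FundGroup q n T :=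
  (MulAut.conj (pathElt q n T v)).toMonoidHom.comp ((graphOfGroups q n).vertexHom T v)

theorem rho_apply (v : Vertex n) (x : vGrp q n v) : rho q n T v x =
    pathElt q n T v * (graphOfGroups q n).vertexHom T v x * (pathElt q n T v)⁻¹ := rfl

theorem rho_toTgt {e : Edge n} (he : e ≠ .top) (x : eGrp q n e) :
    rho q n T (tgt n e) (toTgt q n e x) = rho q n T (src n e) (toSrc q n e x) := by
  have key : ∀ P P' g y z : FundGroup q n T, P' = P * g → g * y * g⁻¹ = z →
      P' * y * P'⁻¹ = P * z * P⁻¹ := by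
    rintro P P' g y z rfl rfl
    group
  exact key _ _ _ _ _ (pathElt_tgt q n T he)
    ((graphOfGroups q n).edgeElt_mul_vertexHom_mul T e x)

/-- The group `H_0` at the base in the fundamental group. -/
def rhoBase : H q 0 →* FundGroup q n T := rho q n T .base

/-- The group at `a i`, conjugated to the base. -/
def rhoA (i : Fin (n + 1)) : H q (i + 1) →* FundGroup q n T := rho q n T (.a i)

/-- The group at `b i`, conjugated to the base. -/
def rhoB (i : Fin (n + 1)) : H q (i + 1) →* FundGroup q n T := rho q n T (.b i)

/-- The group at `c k`, conjugated to the base. -/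
def rhoC (k : ℕ) : G q (k + 1) →* FundGroup q n T := rho q n T (.c k)

theorem rhoA_zero (x : H q 0) :
    rhoA q n T 0 (inclH q (Nat.zero_le 1) x) = rhoBase q n T x :=
  rho_toTgt q n T (e := .baseA) (by simp) x

theorem rhoB_zero (x : H q 0) :
    rhoB q n T 0 (inclH q (Nat.zero_le 1) x) = rhoBase q n T x :=
  rho_toTgt q n T (e := .baseB) (by simp) x

theorem rhoA_succ (i : Fin n) (x : H q (i + 1)) :
    rhoA q n T i.succ (inclH q (Nat.le_succ ((i : ℕ) + 1)) x) = rhoA q n T i.castSucc x :=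
  rho_toTgt q n T (e := .segA i) (by simp) x

theorem rhoB_succ (i : Fin n) (x : H q (i + 1)) :
    rhoB q n T i.succ (inclH q (Nat.le_succ ((i : ℕ) + 1)) x) = rhoB q n T i.castSucc x :=
  rho_toTgt q n T (e := .segB i) (by simp) x

theorem rhoC_succ (k : ℕ) (x : G q (k + 1)) :
    rhoC q n T (k + 1) (inclG q (Nat.le_succ (k + 1)) x) = rhoC q n T k x :=
  rho_toTgt q n T (e := .segC k) (by simp) x

theorem loopElt_mul_rhoB (x : H q (n + 1)) : loopElt q n T * rhoB q n T (Fin.last n) x *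
    (loopElt q n T)⁻¹ = rhoA q n T (Fin.last n) x := by
  have key : ∀ P P' g y z : FundGroup q n T, g * y * g⁻¹ = z →
      P * g * P'⁻¹ * (P' * y * P'⁻¹) * (P * g * P'⁻¹)⁻¹ = P * z * P⁻¹ := by
    rintro P P' g y z rfl
    group
  exact key _ _ _ _ _ ((graphOfGroups q n).edgeElt_mul_vertexHom_mul T Edge.top x)

/-- The group of the base vertex. -/
def kappa : Multiplicative (ZMod (q - 1)) →* FundGroup q n T :=
  (rhoBase q n T).comp (MonoidHom.inl _ _)

/-- The group `G_N` at the top of the upper side, indexed by `GInf q` through truncation. -/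
def alpha : GInf q →* FundGroup q n T :=
  ((rhoA q n T (Fin.last n)).comp (MonoidHom.inr _ _)).comp (res q (n + 1))

theorem rhoC_res {b : GInf q} {k : ℕ} (h : level b ≤ k) :
    rhoC q n T k (res q (k + 1) b) = rhoC q n T (level b) (res q (level b + 1) b) := by
  induction k, h using Nat.le_induction with
  | base => rfl
  | succ k hk ih =>
    rw [← ih, ← inclG_res (Nat.le_succ (k + 1)) (hk.trans (Nat.le_succ k)), rhoC_succ]

/-- The union of the groups of the cusp. -/
def beta : GInf q →* FundGroup q n T :=
  MonoidHom.mk' (fun b => rhoC q n T (level b) (res q (level b + 1) b)) (by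
    intro b b'
    have h1 : level b ≤ max (level b) (level b') := le_max_left _ _
    have h2 : level b' ≤ max (level b) (level b') := le_max_right _ _
    rw [← rhoC_res q n T (level_mul_le h1 h2), ← rhoC_res q n T h1, ← rhoC_res q n T h2,
      map_mul, map_mul])

theorem rhoC_eq (k : ℕ) (f : G q (k + 1)) : rhoC q n T k f = beta q n T (emb q (k + 1) f) := by
  rw [← rhoC_succ]
  have h : level (emb q (k + 1) f) ≤ k + 1 := level_emb_le _ _
  refine Eq.trans ?_ (rhoC_res q n T h)
  rw [← inclG_res (Nat.le_succ (k + 1)) h, res_emb]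

theorem rhoA_eq_last (i : Fin (n + 1)) (x : H q (i + 1)) :
    rhoA q n T i x = rhoA q n T (Fin.last n) (x.1, res q (n + 1) (emb q (i + 1) x.2)) := by
  induction i using Fin.reverseInduction with
  | last =>
    have h : res q (n + 1) (emb q (n + 1) x.2) = x.2 := res_emb _ _
    have h' : (x.1, res q (n + 1) (emb q (n + 1) x.2)) = x := Prod.ext rfl h
    exact (congrArg (rhoA q n T (Fin.last n)) h').symm
  | cast i ih =>
    refine (rhoA_succ q n T i x).symm.trans
      ((ih (inclH q (Nat.le_succ ((i : ℕ) + 1)) x)).trans ?_)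
    have h : (x.1, res q (n + 1) (emb q (i + 1 + 1) (inclG q (Nat.le_succ ((i : ℕ) + 1)) x.2))) =
        (x.1, res q (n + 1) (emb q (i + 1) x.2)) := by rw [emb_inclG]
    exact congrArg (rhoA q n T (Fin.last n)) h

theorem rhoB_eq_last (i : Fin (n + 1)) (x : H q (i + 1)) :
    rhoB q n T i x = rhoB q n T (Fin.last n) (x.1, res q (n + 1) (emb q (i + 1) x.2)) := by
  induction i using Fin.reverseInduction with
  | last =>
    have h : res q (n + 1) (emb q (n + 1) x.2) = x.2 := res_emb _ _
    have h' : (x.1, res q (n + 1) (emb q (n + 1) x.2)) = x := Prod.ext rfl h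
    exact (congrArg (rhoB q n T (Fin.last n)) h').symm
  | cast i ih =>
    refine (rhoB_succ q n T i x).symm.trans
      ((ih (inclH q (Nat.le_succ ((i : ℕ) + 1)) x)).trans ?_)
    have h : (x.1, res q (n + 1) (emb q (i + 1 + 1) (inclG q (Nat.le_succ ((i : ℕ) + 1)) x.2))) =
        (x.1, res q (n + 1) (emb q (i + 1) x.2)) := by rw [emb_inclG]
    exact congrArg (rhoB q n T (Fin.last n)) h

theorem kappa_eq_rhoA (c : Multiplicative (ZMod (q - 1))) :
    kappa q n T c = rhoA q n T (Fin.last n) (c, 1) := by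
  refine (rhoA_zero q n T (c, 1)).symm.trans ((rhoA_eq_last q n T 0 _).trans ?_)
  have h : (c, res q (n + 1) (emb q 1 (inclG q (Nat.zero_le 1) 1))) = (c, 1) := by
    rw [map_one, map_one, map_one]
  exact congrArg (rhoA q n T (Fin.last n)) h

theorem kappa_eq_rhoB (c : Multiplicative (ZMod (q - 1))) :
    kappa q n T c = rhoB q n T (Fin.last n) (c, 1) := by
  refine (rhoB_zero q n T (c, 1)).symm.trans ((rhoB_eq_last q n T 0 _).trans ?_)
  have h : (c, res q (n + 1) (emb q 1 (inclG q (Nat.zero_le 1) 1))) = (c, 1) := by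
    rw [map_one, map_one, map_one]
  exact congrArg (rhoB q n T (Fin.last n)) h

theorem commute_kappa_alpha (c : Multiplicative (ZMod (q - 1))) (b : GInf q) :
    Commute (kappa q n T c) (alpha q n T b) := by
  have h : Commute ((c, 1) : H q (n + 1)) (1, res q (n + 1) b) := by
    change _ * _ = _ * _
    rw [Prod.mk_mul_mk, Prod.mk_mul_mk, one_mul, mul_one, one_mul, mul_one]
  rw [kappa_eq_rhoA]
  exact h.map (rhoA q n T (Fin.last n))

theorem commute_kappa_loopElt (c : Multiplicative (ZMod (q - 1))) :
    Commute (kappa q n T c) (loopElt q n T) := by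
  have h := loopElt_mul_rhoB q n T (c, 1)
  have h1 : loopElt q n T * kappa q n T c * (loopElt q n T)⁻¹ = kappa q n T c := by
    conv_lhs => rw [kappa_eq_rhoB]
    rw [kappa_eq_rhoA]
    exact h
  rw [mul_inv_eq_iff_eq_mul] at h1
  exact h1.symm

theorem rhoA_eq (i : Fin (n + 1)) (x : H q (i + 1)) :
    rhoA q n T i x = kappa q n T x.1 * alpha q n T (emb q (i + 1) x.2) := by
  rw [rhoA_eq_last, kappa_eq_rhoA]
  change _ = _ * rhoA q n T (Fin.last n) (1, res q (n + 1) (emb q (i + 1) x.2))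
  refine Eq.trans ?_ (map_mul (rhoA q n T (Fin.last n)) _ _)
  rw [Prod.mk_mul_mk, one_mul, mul_one]

theorem rhoB_eq (i : Fin (n + 1)) (x : H q (i + 1)) :
    rhoB q n T i x = kappa q n T x.1 *
      ((loopElt q n T)⁻¹ * alpha q n T (emb q (i + 1) x.2) * loopElt q n T) := by
  have key : ∀ k a t y z : FundGroup q n T, Commute k t → t * y * t⁻¹ = z → z = k * a →
      y = k * (t⁻¹ * a * t) := by
    rintro k a t y z hc rfl h
    have h1 : y = t⁻¹ * (k * a) * t := by
      rw [← h]
      group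
    rw [h1, ← mul_assoc t⁻¹, ← hc.inv_right.eq, mul_assoc, mul_assoc, mul_assoc]
  rw [rhoB_eq_last]
  refine key _ _ _ _ _ (commute_kappa_loopElt q n T x.1) (loopElt_mul_rhoB q n T _) ?_
  exact (rhoA_eq_last q n T i x).symm.trans (rhoA_eq q n T i x)

/-- The homomorphisms `rho q n T v` are determined by the groups at the base, at the top and in the
cusp, and by the loop. -/
theorem rho_eq_vertexMap (v : Vertex n) (x : vGrp q n v) : rho q n T v x =
    vertexMap (kappa q n T) (alpha q n T) (beta q n T) (loopElt q n T)
      (commute_kappa_alpha q n T) (commute_kappa_loopElt q n T) v x := by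
  cases v with
  | base =>
    have key : ∀ x : H q 0, rhoBase q n T x = kappa q n T x.1 := fun x =>
      congrArg (rhoBase q n T) (Prod.ext rfl (Subsingleton.elim _ _) : x = (x.1, (1 : G q 0)))
    exact key x
  | a i => exact rhoA_eq q n T i x
  | b i => exact (rhoB_eq q n T i x).trans (vertexMap_b _ _ _ _ _ _ i x).symm
  | c k => exact rhoC_eq q n T k x

end Pi1

end LoopWithCusp

/-! ### The action of the fundamental group on words -/

namespace LoopWithCusp

section action

variable {q n : ℕ} {T : Set (graphOfGroups q n).E}

/-- The homomorphisms from the vertex groups to the permutations of words. -/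
abbrev permMap (q n : ℕ) (v : Vertex n) : vGrp q n v →* Equiv.Perm (Word q (n + 1)) :=
  vertexMap (basePerm q (n + 1)) (upperPerm q (n + 1)) (cuspPerm q (n + 1)) (loopPerm q (n + 1))
    commute_basePerm_upperPerm commute_basePerm_loopPerm v

/-- If `T` is a maximal subtree, then the permutation of the loop can be distributed over the edges
outside of `T`. -/
theorem exists_potential (hT : (graphOfGroups q n).IsMaximalSubtree T) {Q : Type} [Group Q]
    (l : Q) : ∃ pot : Vertex n → Q, pot .base = 1 ∧
      (∀ e ∈ T, e ≠ Edge.top → pot (src n e) = pot (tgt n e)) ∧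
      (Edge.top ∈ T → pot (.a (Fin.last n)) = l * pot (.b (Fin.last n))) := by
  classical
  by_cases htop : (Edge.top : Edge n) ∈ T
  · obtain ⟨S, h1, h2, h3⟩ := hT.exists_separation htop
    have h1' : S (.a (Fin.last n)) := h1
    have h2' : ¬ S (.b (Fin.last n)) := h2
    let pot₀ : Vertex n → Q := fun v => if S v then 1 else l⁻¹
    refine ⟨fun v => pot₀ v * (pot₀ .base)⁻¹, mul_inv_cancel _, fun e he hne => ?_, fun _ => ?_⟩
    · have h : S (src n e) ↔ S (tgt n e) := h3 e he hne
      simp only [pot₀, h]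
    · have ha : pot₀ (.a (Fin.last n)) = 1 := if_pos h1'
      have hb : pot₀ (.b (Fin.last n)) = l⁻¹ := if_neg h2'
      simp only [ha, hb]
      group
  · exact ⟨fun _ => 1, rfl, fun _ _ _ => rfl, fun h => absurd h htop⟩

/-- The fundamental group acts on the words. -/
theorem exists_wordHom (hT : (graphOfGroups q n).IsMaximalSubtree T) :
    ∃ φ : FundGroup q n T →* Equiv.Perm (Word q (n + 1)),
      (∀ v x, φ (rho q n T v x) = permMap q n v x) ∧ φ (loopElt q n T) = loopPerm q (n + 1) := by
  obtain ⟨pot, h0, h1, h2⟩ := exists_potential hT (loopPerm q (n + 1))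
  let l : Edge n → Equiv.Perm (Word q (n + 1)) := fun e =>
    match e with
    | .top => loopPerm q (n + 1)
    | _ => 1
  have hl : ∀ e, e ≠ Edge.top → l e = 1 := by
    intro e he
    cases e <;> first | rfl | exact absurd rfl he
  have hrel : ∀ (e : Edge n) (x : eGrp q n e), l e * permMap q n (tgt n e) (toTgt q n e x) *
      (l e)⁻¹ = permMap q n (src n e) (toSrc q n e x) := by
    intro e x
    by_cases he : e = .top
    · subst he
      exact vertexMap_top _ _ _ _ _ _ x
    · rw [hl e he, one_mul, inv_one, mul_one]
      exact vertexMap_toTgt _ _ _ _ _ _ he x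
  obtain ⟨φ, hv, he⟩ := GraphOfGroups.exists_hom (graphOfGroups q n) T
    (fun v => (MulAut.conj (pot v)⁻¹).toMonoidHom.comp (permMap q n v))
    (fun e => (pot (src n e))⁻¹ * l e * pot (tgt n e))
    (by
      have key : ∀ a b m y z : Equiv.Perm (Word q (n + 1)), m * y * m⁻¹ = z →
          a⁻¹ * m * b * (b⁻¹ * y * b⁻¹⁻¹) * (a⁻¹ * m * b)⁻¹ = a⁻¹ * z * a⁻¹⁻¹ := by
        rintro a b m y z rfl
        group
      exact fun e x => key _ _ _ _ _ (hrel e x))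
    (by
      intro e he
      change (pot (src n e))⁻¹ * l e * pot (tgt n e) = 1
      by_cases htop : e = Edge.top
      · subst htop
        have h := h2 he
        change (pot (.a (Fin.last n)))⁻¹ * loopPerm q (n + 1) * pot (.b (Fin.last n)) = 1
        rw [h]
        group
      · rw [hl e htop, h1 e he htop]
        group)
  have hpath : ∀ v, φ (pathElt q n T v) = pot v := by
    refine vertex_induction ?_ fun e hne ih => ?_
    · exact (map_one φ).trans h0.symm
    · have h : φ (edgeG q n T e) = (pot (src n e))⁻¹ * l e * pot (tgt n e) := he e
      rw [pathElt_tgt q n T hne, map_mul, ih, h, hl e hne]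
      group
  refine ⟨φ, fun v x => ?_, ?_⟩
  · have h : φ ((graphOfGroups q n).vertexHom T v x) =
      (pot v)⁻¹ * permMap q n v x * (pot v)⁻¹⁻¹ := hv v x
    have h' : φ (rho q n T v x) = φ (pathElt q n T v) * φ ((graphOfGroups q n).vertexHom T v x) *
        (φ (pathElt q n T v))⁻¹ := by
      rw [rho_apply, map_mul, map_mul, map_inv]
    rw [h', h, hpath]
    group
  · have h : φ (edgeG q n T .top) = (pot (.a (Fin.last n)))⁻¹ * loopPerm q (n + 1) *
      pot (.b (Fin.last n)) := he .top
    rw [loopElt, map_mul, map_mul, map_inv, hpath, hpath, h]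
    group

theorem map_kappa {φ : FundGroup q n T →* Equiv.Perm (Word q (n + 1))}
    (h : ∀ v x, φ (rho q n T v x) = permMap q n v x) (c : Multiplicative (ZMod (q - 1))) :
    φ (kappa q n T c) = basePerm q (n + 1) c :=
  h .base ((c, 1) : H q 0)

theorem map_alpha {φ : FundGroup q n T →* Equiv.Perm (Word q (n + 1))}
    (h : ∀ v x, φ (rho q n T v x) = permMap q n v x) (b : GInf q) :
    φ (alpha q n T b) = upperPerm q (n + 1) b := by
  refine (h (.a (Fin.last n)) ((1, res q (n + 1) b) : H q (n + 1))).trans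
    ((vertexMap_a _ _ _ _ _ _ _ _).trans ?_)
  change basePerm q (n + 1) 1 * upperPerm q (n + 1) (trunc q (n + 1) b) = _
  rw [map_one, one_mul]
  ext w : 1
  rw [upperPerm_apply, upperPerm_apply]
  congr 1
  refine Frame.ext ?_ rfl rfl
  change trunc q (n + 1) (trunc q (n + 1) b) * _ = trunc q (n + 1) b * _
  rw [trunc_of_level_le (b := trunc q (n + 1) b) (level_emb_le _ _)]

theorem map_beta {φ : FundGroup q n T →* Equiv.Perm (Word q (n + 1))}
    (h : ∀ v x, φ (rho q n T v x) = permMap q n v x) (b : GInf q) :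
    φ (beta q n T b) = cuspPerm q (n + 1) b := by
  refine (h (.c (level b)) (res q (level b + 1) b : G q (level b + 1))).trans
    ((vertexMap_c _ _ _ _ _ _ _ _).trans ?_)
  rw [emb_res (Nat.le_succ (level b))]

theorem alpha_trunc (b : GInf q) : alpha q n T (trunc q (n + 1) b) = alpha q n T b := by
  change rhoA q n T (Fin.last n) (1, res q (n + 1) (emb q (n + 1) (res q (n + 1) b))) = _
  rw [res_emb]
  rfl

/-- The fundamental group is generated by the groups at the base, at the top and in the cusp
together with the loop: the elements of the paths lie in the subgroup `K` that they generate since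
this property propagates along `T`. -/
theorem closure_generators (hT : (graphOfGroups q n).IsMaximalSubtree T) :
    Subgroup.closure (Set.range (kappa q n T) ∪ Set.range (alpha q n T) ∪
      Set.range (beta q n T) ∪ {loopElt q n T}) = ⊤ := by
  set K := Subgroup.closure (Set.range (kappa q n T) ∪ Set.range (alpha q n T) ∪
      Set.range (beta q n T) ∪ {loopElt q n T}) with hK
  have hκ : ∀ c, kappa q n T c ∈ K := fun c =>
    Subgroup.subset_closure (Or.inl (Or.inl (Or.inl ⟨c, rfl⟩)))
  have hα : ∀ c, alpha q n T c ∈ K := fun c =>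
    Subgroup.subset_closure (Or.inl (Or.inl (Or.inr ⟨c, rfl⟩)))
  have hβ : ∀ c, beta q n T c ∈ K := fun c =>
    Subgroup.subset_closure (Or.inl (Or.inr ⟨c, rfl⟩))
  have hl : loopElt q n T ∈ K := Subgroup.subset_closure (Or.inr rfl)
  have hP : ∀ v : Vertex n, pathElt q n T v ∈ K := by
    refine hT.forall_of_iff (S := fun v => pathElt q n T v ∈ K) (v₀ := Vertex.base)
      (one_mem K) fun e he => ?_
    have h1 : edgeG q n T e = 1 := (graphOfGroups q n).edgeElt_eq_one T he
    change pathElt q n T (src n e) ∈ K ↔ pathElt q n T (tgt n e) ∈ K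
    by_cases htop : e = Edge.top
    · subst htop
      have h : pathElt q n T (.a (Fin.last n)) =
        loopElt q n T * pathElt q n T (.b (Fin.last n)) := by
        rw [loopElt, h1]
        group
      change pathElt q n T (.a (Fin.last n)) ∈ K ↔ pathElt q n T (.b (Fin.last n)) ∈ K
      rw [h]
      exact K.mul_mem_cancel_left hl
    · rw [pathElt_tgt q n T htop, h1, mul_one]
  have hrho : ∀ (v : Vertex n) (x : vGrp q n v), rho q n T v x ∈ K := by
    intro v x
    rw [rho_eq_vertexMap]
    cases v with
    | base => exact hκ _
    | a i =>
      have key : ∀ x : H q (i + 1), kappa q n T x.1 * alpha q n T (emb q (i + 1) x.2) ∈ K :=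
        fun x => mul_mem (hκ _) (hα _)
      exact key x
    | b i =>
      exact (congrArg (· ∈ K) (vertexMap_b _ _ _ _ _ _ i x)).mpr
        (mul_mem (hκ _) (mul_mem (mul_mem (inv_mem hl) (hα _)) hl))
    | c k => exact hβ _
  rw [eq_top_iff, ← PresentedGroup.closure_range_of, Subgroup.closure_le]
  rintro _ ⟨⟨v, x⟩ | e, rfl⟩
  · change (graphOfGroups q n).vertexHom T v x ∈ K
    have h := mul_mem (mul_mem (inv_mem (hP v)) (hrho v x)) (hP v)
    have key : ∀ P g : FundGroup q n T, P⁻¹ * (P * g * P⁻¹) * P = g := fun P g => by group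
    exact (congrArg (· ∈ K) (key (pathElt q n T v) _)).mp h
  · change edgeG q n T e ∈ K
    by_cases htop : e = Edge.top
    · subst htop
      have h := mul_mem (mul_mem (inv_mem (hP (.a (Fin.last n)))) hl) (hP (.b (Fin.last n)))
      rw [loopElt] at h
      convert h using 1
      group
    · have h := mul_mem (inv_mem (hP (src n e))) (hP (tgt n e))
      rwa [pathElt_tgt q n T htop, inv_mul_cancel_left] at h

end action

/-! ### The universal covering tree -/

section tree

variable (q n : ℕ) (T : Set (graphOfGroups q n).E)

/-- The lift of a vertex of `X_N` to the universal covering tree along the path from the base. -/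
def lift (v : Vertex n) : (graphOfGroups q n).TreeVertex T :=
  ⟨v, (pathElt q n T v : FundGroup q n T)⟩

/-- The neighbour of the lift of the source of an edge on the lift of this edge. -/
def liftTgt : Edge n → (graphOfGroups q n).TreeVertex T
  | .top => loopElt q n T • lift q n T (.b (Fin.last n))
  | e => lift q n T (tgt n e)

theorem liftTgt_of_ne {e : Edge n} (he : e ≠ .top) : liftTgt q n T e = lift q n T (tgt n e) := by
  cases e <;> first | rfl | exact absurd rfl he

theorem smul_lift_eq_iff (γ : FundGroup q n T) (v : Vertex n) :
    γ • lift q n T v = lift q n T v ↔ ∃ x : vGrp q n v, γ = rho q n T v x := by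
  have key : ∀ P g : FundGroup q n T, P = γ * P * g ↔ γ = (P * g * P⁻¹)⁻¹ := by
    intro P g
    rw [mul_inv_rev, mul_inv_rev, inv_inv, ← mul_assoc, eq_mul_inv_iff_mul_eq,
      eq_mul_inv_iff_mul_eq, eq_comm]
  have hinv : ∀ x : vGrp q n v, rho q n T v x⁻¹ = (rho q n T v x)⁻¹ := map_inv _
  refine ((graphOfGroups q n).treeVertex_eq_iff T v (γ * pathElt q n T v)
    (pathElt q n T v)).trans ?_
  constructor
  · rintro ⟨x, hx⟩
    exact ⟨(x⁻¹ : vGrp q n v), ((key _ _).1 hx).trans (hinv x).symm⟩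
  · rintro ⟨x, hx⟩
    exact ⟨(x⁻¹ : vGrp q n v), (key _ _).2 (hx.trans (inv_eq_iff_eq_inv.1 (hinv x).symm))⟩

theorem exists_eq_smul_lift (x : (graphOfGroups q n).TreeVertex T) :
    ∃ (γ : FundGroup q n T) (v : Vertex n), x = γ • lift q n T v := by
  obtain ⟨v, y⟩ := x
  induction y using QuotientGroup.induction_on with
  | H g =>
    refine ⟨g * (pathElt q n T v)⁻¹, v, ?_⟩
    have h : g = g * (pathElt q n T v)⁻¹ * pathElt q n T v := by group
    exact congrArg (fun g : FundGroup q n T =>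
      (⟨v, (g : _)⟩ : (graphOfGroups q n).TreeVertex T)) h

/-- Adjacency in the covering tree as translation of the chosen lifts of the edges. -/
theorem tree_adj_iff (x y : (graphOfGroups q n).TreeVertex T) :
    ((graphOfGroups q n).tree T).Adj x y ↔ ∃ (e : Edge n) (γ : FundGroup q n T),
      (x = γ • lift q n T (src n e) ∧ y = γ • liftTgt q n T e) ∨
      (y = γ • lift q n T (src n e) ∧ x = γ • liftTgt q n T e) := by
  have key : ∀ (e : Edge n) (γ : FundGroup q n T), γ • liftTgt q n T e =
      ⟨tgt n e, ((γ * pathElt q n T (src n e) * edgeG q n T e : FundGroup q n T) : _)⟩ := by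
    intro e γ
    by_cases he : e = .top
    · subst he
      have h : γ * pathElt q n T (.a (Fin.last n)) * edgeG q n T .top =
          γ * (loopElt q n T * pathElt q n T (.b (Fin.last n))) := by
        rw [loopElt]
        group
      refine Eq.trans ?_ (congrArg (fun g : FundGroup q n T =>
        (⟨tgt n .top, (g : _)⟩ : (graphOfGroups q n).TreeVertex T)) h.symm)
      rfl
    · rw [liftTgt_of_ne q n T he, mul_assoc, ← pathElt_tgt q n T he]
      rfl
  have rel : ∀ x y : (graphOfGroups q n).TreeVertex T, (∃ (e : Edge n) (γ : FundGroup q n T),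
      x = ⟨src n e, (γ : _)⟩ ∧ y = ⟨tgt n e, ((γ * edgeG q n T e : FundGroup q n T) : _)⟩) ↔
      ∃ (e : Edge n) (γ : FundGroup q n T),
        x = γ • lift q n T (src n e) ∧ y = γ • liftTgt q n T e := by
    intro x y
    constructor
    · rintro ⟨e, γ, rfl, rfl⟩
      have h : γ = γ * (pathElt q n T (src n e))⁻¹ * pathElt q n T (src n e) := by group
      refine ⟨e, γ * (pathElt q n T (src n e))⁻¹, ?_, ?_⟩
      · conv_lhs => rw [h]
        rfl
      · rw [key, ← h]
    · rintro ⟨e, γ, rfl, rfl⟩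
      exact ⟨e, γ * pathElt q n T (src n e), rfl, key e γ⟩
  have hne : ∀ (e : Edge n) (γ : FundGroup q n T),
      γ • lift q n T (src n e) ≠ γ • liftTgt q n T e := by
    intro e γ h
    rw [key] at h
    have h' : src n e = tgt n e := congrArg Sigma.fst h
    cases e <;> simp [src, tgt, Fin.ext_iff] at h'
  unfold GraphOfGroups.tree
  rw [SimpleGraph.fromRel_adj]
  refine (and_congr_right fun _ => or_congr (rel x y) (rel y x)).trans ?_
  constructor
  · rintro ⟨_, ⟨e, γ, h⟩ | ⟨e, γ, h⟩⟩
    · exact ⟨e, γ, Or.inl h⟩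
    · exact ⟨e, γ, Or.inr h⟩
  · rintro ⟨e, γ, ⟨rfl, rfl⟩ | ⟨rfl, rfl⟩⟩
    · exact ⟨hne e γ, Or.inl ⟨e, γ, rfl, rfl⟩⟩
    · exact ⟨(hne e γ).symm, Or.inr ⟨e, γ, rfl, rfl⟩⟩

end tree

end LoopWithCusp

/-! ### Rays in the universal covering tree -/

namespace LoopWithCusp

section rays

variable {q n : ℕ}

/-- The vertex of `X_N` below the vertex of level `k` on the ray in direction `d`. -/
def rayVertex (n : ℕ) : Dir q → ℕ → Vertex n
  | _, 0 => .base
  | .loop false, k + 1 => if h : k < n + 1 then .a ⟨k, h⟩ else .base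
  | .loop true, k + 1 => if h : k < n + 1 then .b ⟨k, h⟩ else .base
  | .cusp _, k + 1 => .c k

/-- The element of `C_{q-1}` that carries a standard direction to `d`. -/
def twist : Dir q → Multiplicative (ZMod (q - 1))
  | .loop _ => 1
  | .cusp h => h

theorem rayVertex_zero (d : Dir q) : rayVertex n d 0 = .base := by
  cases d with
  | loop s => cases s <;> rfl
  | cusp h => rfl

theorem rayVertex_smul (c : Multiplicative (ZMod (q - 1))) (d : Dir q) (k : ℕ) :
    rayVertex n (c • d) k = rayVertex n d k := by
  cases d with
  | loop s => rfl
  | cusp h => cases k <;> rfl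

theorem rayVertex_false {k : ℕ} (h : k < n + 1) :
    rayVertex n (.loop false : Dir q) (k + 1) = .a ⟨k, h⟩ := dif_pos h

theorem rayVertex_true {k : ℕ} (h : k < n + 1) :
    rayVertex n (.loop true : Dir q) (k + 1) = .b ⟨k, h⟩ := dif_pos h

theorem rayVertex_inj {d d' : Dir q} {k k' : ℕ} (hk : d.HasLevel (n + 1) k)
    (hk' : d'.HasLevel (n + 1) k') (h : rayVertex n d k = rayVertex n d' k') :
    k = k' ∧ (k = 0 ∨ ∃ c : Multiplicative (ZMod (q - 1)), d' = c • d) := by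
  have hbase : ∀ {d : Dir q} {k : ℕ}, d.HasLevel (n + 1) (k + 1) →
      rayVertex n d (k + 1) ≠ .base := by
    intro d k hk
    rcases d with (_ | _) | h
    · rw [rayVertex_false (Nat.lt_of_succ_le hk)]
      simp
    · rw [rayVertex_true (Nat.lt_of_succ_le hk)]
      simp
    · simp [rayVertex]
  rcases k with _ | k
  · rcases k' with _ | k'
    · exact ⟨rfl, Or.inl rfl⟩
    · rw [rayVertex_zero] at h
      exact absurd h.symm (hbase hk')
  · rcases k' with _ | k'
    · rw [rayVertex_zero] at h
      exact absurd h (hbase hk)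
    · rcases d with (_ | _) | c
      · rw [rayVertex_false (Nat.lt_of_succ_le hk)] at h
        rcases d' with (_ | _) | c'
        · rw [rayVertex_false (Nat.lt_of_succ_le hk')] at h
          injection h with h
          injection h with h
          exact ⟨congrArg _ h, Or.inr ⟨1, rfl⟩⟩
        · rw [rayVertex_true (Nat.lt_of_succ_le hk')] at h
          cases h
        · cases h
      · rw [rayVertex_true (Nat.lt_of_succ_le hk)] at h
        rcases d' with (_ | _) | c'
        · rw [rayVertex_false (Nat.lt_of_succ_le hk')] at h
          cases h
        · rw [rayVertex_true (Nat.lt_of_succ_le hk')] at h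
          injection h with h
          injection h with h
          exact ⟨congrArg _ h, Or.inr ⟨1, rfl⟩⟩
        · cases h
      · rcases d' with (_ | _) | c'
        · rw [rayVertex_false (Nat.lt_of_succ_le hk')] at h
          cases h
        · rw [rayVertex_true (Nat.lt_of_succ_le hk')] at h
          cases h
        · injection h with h
          exact ⟨congrArg _ h, Or.inr ⟨c' * c⁻¹, by rw [smul_cusp, inv_mul_cancel_right]⟩⟩

variable (q n) (T : Set (graphOfGroups q n).E)

/-- The vertex of level `k` on the ray in direction `d`. -/
def treePt (d : Dir q) (k : ℕ) : (graphOfGroups q n).TreeVertex T :=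
  kappa q n T (twist d) • lift q n T (rayVertex n d k)

variable {q n T}

theorem kappa_smul_base (c : Multiplicative (ZMod (q - 1))) :
    kappa q n T c • lift q n T .base = lift q n T .base :=
  (smul_lift_eq_iff q n T _ _).2 ⟨((c, 1) : H q 0), rfl⟩

theorem kappa_smul_a (c : Multiplicative (ZMod (q - 1))) (i : Fin (n + 1)) :
    kappa q n T c • lift q n T (.a i) = lift q n T (.a i) := by
  refine (smul_lift_eq_iff q n T _ _).2 ⟨((c, 1) : H q (i + 1)), Eq.symm ?_⟩
  refine (rhoA_eq q n T i (c, 1)).trans ?_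
  rw [map_one, map_one, mul_one]

theorem kappa_smul_b (c : Multiplicative (ZMod (q - 1))) (i : Fin (n + 1)) :
    kappa q n T c • lift q n T (.b i) = lift q n T (.b i) := by
  refine (smul_lift_eq_iff q n T _ _).2 ⟨((c, 1) : H q (i + 1)), Eq.symm ?_⟩
  refine (rhoB_eq q n T i (c, 1)).trans ?_
  rw [map_one, map_one, mul_one, inv_mul_cancel, mul_one]

theorem kappa_smul_rayVertex (c : Multiplicative (ZMod (q - 1))) (s : Bool) (k : ℕ) :
    kappa q n T c • lift q n T (rayVertex n (.loop s : Dir q) k) =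
      lift q n T (rayVertex n (.loop s : Dir q) k) := by
  rcases k with _ | k
  · rw [rayVertex_zero]
    exact kappa_smul_base c
  · by_cases hk : k < n + 1
    · cases s
      · rw [rayVertex_false hk]
        exact kappa_smul_a c _
      · rw [rayVertex_true hk]
        exact kappa_smul_b c _
    · have h : rayVertex n (.loop s : Dir q) (k + 1) = .base := by
        cases s <;> exact dif_neg hk
      rw [h]
      exact kappa_smul_base c

theorem treePt_loop (s : Bool) (k : ℕ) :
    treePt q n T (.loop s) k = lift q n T (rayVertex n (.loop s : Dir q) k) :=
  kappa_smul_rayVertex 1 s k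

theorem treePt_false {k : ℕ} (h : k < n + 1) :
    treePt q n T (.loop false) (k + 1) = lift q n T (.a ⟨k, h⟩) := by
  rw [treePt_loop, rayVertex_false h]

theorem treePt_true {k : ℕ} (h : k < n + 1) :
    treePt q n T (.loop true) (k + 1) = lift q n T (.b ⟨k, h⟩) := by
  rw [treePt_loop, rayVertex_true h]

theorem treePt_zero (d : Dir q) : treePt q n T d 0 = lift q n T .base := by
  rw [treePt, rayVertex_zero, kappa_smul_base]

theorem kappa_smul_treePt (c : Multiplicative (ZMod (q - 1))) (d : Dir q) (k : ℕ) :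
    kappa q n T c • treePt q n T d k = treePt q n T (c • d) k := by
  cases d with
  | loop s =>
    rw [treePt_loop]
    exact (kappa_smul_rayVertex c s k).trans (treePt_loop s k).symm
  | cusp h =>
    rw [treePt, treePt, smul_smul, ← map_mul, rayVertex_smul]
    rfl

theorem exists_eq_smul_treePt (v : (graphOfGroups q n).TreeVertex T) :
    ∃ (γ : FundGroup q n T) (d : Dir q) (k : ℕ), d.HasLevel (n + 1) k ∧ v =
      γ • treePt q n T d k := by
  obtain ⟨γ, v, rfl⟩ := exists_eq_smul_lift q n T v
  cases v with
  | base => exact ⟨γ, .loop false, 0, Nat.zero_le _, by rw [treePt_zero]⟩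
  | a i => exact ⟨γ, .loop false, i + 1, i.2, by rw [treePt_false i.2]⟩
  | b i => exact ⟨γ, .loop true, i + 1, i.2, by rw [treePt_true i.2]⟩
  | c k =>
    refine ⟨γ, .cusp 1, k + 1, trivial, ?_⟩
    rw [treePt, twist, map_one, one_smul]
    rfl

theorem treePt_type_eq (γ : FundGroup q n T) (d d' : Dir q) (k k' : ℕ)
    (hk : d.HasLevel (n + 1) k) (hk' : d'.HasLevel (n + 1) k')
    (h : γ • treePt q n T d k = treePt q n T d' k') :
    k = k' ∧ (k = 0 ∨ ∃ c : Multiplicative (ZMod (q - 1)), d' = c • d) :=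
  rayVertex_inj hk hk' (congrArg Sigma.fst h)

theorem smul_base_eq (γ : FundGroup q n T) (h : γ • lift q n T .base = lift q n T .base) :
    ∃ c, γ = kappa q n T c := by
  obtain ⟨x, hx⟩ := (smul_lift_eq_iff q n T _ _).1 h
  refine ⟨(show H q 0 from x).1, ?_⟩
  rw [hx, rho_eq_vertexMap]
  rfl

/-- The stabilizer of a point of positive height in the direction `d` consists of the labels of at
most that level, conjugated by the frame of `d`, and of the `κ c` that fix `d`. -/
theorem smul_treePt_eq_iff (γ : FundGroup q n T) (d : Dir q) (k : ℕ)
    (hk : d.HasLevel (n + 1) (k + 1)) :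
    γ • treePt q n T d (k + 1) = treePt q n T d (k + 1) ↔
      ∃ (b : GInf q) (c : Multiplicative (ZMod (q - 1))), level b ≤ k + 1 ∧ c • d = d ∧
        γ = (frameElt (kappa q n T) (loopElt q n T) d)⁻¹ * labelHom (alpha q n T) (beta q n T) d b *
          frameElt (kappa q n T) (loopElt q n T) d * kappa q n T c := by
  rcases d with (_ | _) | h
  · have hk' : k < n + 1 := Nat.lt_of_succ_le hk
    rw [treePt_false hk', smul_lift_eq_iff]
    change (∃ x : H q (k + 1), γ = rhoA q n T ⟨k, hk'⟩ x) ↔ _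
    have key : ∀ c b, (1 : FundGroup q n T)⁻¹ * alpha q n T b * 1 * kappa q n T c =
        kappa q n T c * alpha q n T b := fun c b => by
      rw [inv_one, one_mul, mul_one, (commute_kappa_alpha q n T c b).eq]
    constructor
    · rintro ⟨x, rfl⟩
      exact ⟨emb q (k + 1) x.2, x.1, level_emb_le _ _, rfl,
        (rhoA_eq q n T ⟨k, hk'⟩ x).trans (key _ _).symm⟩
    · rintro ⟨b, c, hb, -, rfl⟩
      refine ⟨(c, res q (k + 1) b), (key c b).trans (Eq.symm ?_)⟩
      refine (rhoA_eq q n T ⟨k, hk'⟩ _).trans ?_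
      rw [emb_res hb]
  · have hk' : k < n + 1 := Nat.lt_of_succ_le hk
    rw [treePt_true hk', smul_lift_eq_iff]
    change (∃ x : H q (k + 1), γ = rhoB q n T ⟨k, hk'⟩ x) ↔ _
    have key : ∀ c b, (loopElt q n T)⁻¹ * alpha q n T b * loopElt q n T * kappa q n T c =
        kappa q n T c * ((loopElt q n T)⁻¹ * alpha q n T b * loopElt q n T) := fun c b =>
      ((((commute_kappa_loopElt q n T c).inv_right.mul_right
        (commute_kappa_alpha q n T c b)).mul_right
        (commute_kappa_loopElt q n T c)).eq).symm
    constructor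
    · rintro ⟨x, rfl⟩
      exact ⟨emb q (k + 1) x.2, x.1, level_emb_le _ _, rfl,
        (rhoB_eq q n T ⟨k, hk'⟩ x).trans (key _ _).symm⟩
    · rintro ⟨b, c, hb, -, rfl⟩
      refine ⟨(c, res q (k + 1) b), (key c b).trans (Eq.symm ?_)⟩
      refine (rhoB_eq q n T ⟨k, hk'⟩ _).trans ?_
      rw [emb_res hb]
  · have h1 : γ • treePt q n T (.cusp h) (k + 1) = treePt q n T (.cusp h) (k + 1) ↔
        ∃ x : G q (k + 1), (kappa q n T h)⁻¹ * γ * kappa q n T h = rhoC q n T k x := by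
      refine Iff.trans ?_ (smul_lift_eq_iff q n T ((kappa q n T h)⁻¹ * γ * kappa q n T h) (.c k))
      rw [mul_smul, mul_smul, inv_smul_eq_iff]
      rfl
    have key : ∀ g x : FundGroup q n T, g⁻¹ * γ * g = x ↔ γ = g * x * g⁻¹ := fun g x => by
      rw [mul_assoc, inv_mul_eq_iff_eq_mul, eq_mul_inv_iff_mul_eq]
    rw [h1]
    constructor
    · rintro ⟨x, hx⟩
      refine ⟨emb q (k + 1) x, 1, level_emb_le _ _, one_smul _ _, ?_⟩
      rw [(key _ _).1 hx, rhoC_eq, map_one, mul_one]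
      change _ = (kappa q n T h)⁻¹⁻¹ * _ * (kappa q n T h)⁻¹
      rw [inv_inv]
      rfl
    · rintro ⟨b, c, hb, hc, hγ⟩
      have hc1 : c = 1 := by
        rw [smul_cusp] at hc
        injection hc with hc
        exact mul_eq_right.1 hc
      refine ⟨res q (k + 1) b, (key _ _).2 ?_⟩
      rw [rhoC_eq, emb_res hb, hγ, hc1, map_one, mul_one]
      change (kappa q n T h)⁻¹⁻¹ * _ * (kappa q n T h)⁻¹ = _
      rw [inv_inv]
      rfl

/-- The neighbour away from the base. -/
abbrev treeUp (q n : ℕ) (T : Set (graphOfGroups q n).E) (d : Dir q) (k : ℕ) :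
    (graphOfGroups q n).TreeVertex T :=
  upPoint (n + 1) (kappa q n T) (loopElt q n T) (treePt q n T) d k

theorem treeUp_loop {s : Bool} {k : ℕ} (h : k < n + 1) :
    treeUp q n T (.loop s) k = treePt q n T (.loop s) (k + 1) := if_pos h

theorem treeUp_cusp (h : Multiplicative (ZMod (q - 1))) (k : ℕ) :
    treeUp q n T (.cusp h) k = treePt q n T (.cusp h) (k + 1) := if_pos trivial

theorem treeUp_top (s : Bool) : treeUp q n T (.loop s) (n + 1) =
    ((frameElt (kappa q n T) (loopElt q n T) (.loop s))⁻¹ *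
      frameElt (kappa q n T) (loopElt q n T) (.loop (!s))) • treePt q n T (.loop (!s)) (n + 1) :=
  if_neg (by simp [Dir.HasLevel])

/-- Every edge of `X_N` lifts to an edge on a ray. -/
theorem exists_ray_of_edge (e : Edge n) : ∃ (d : Dir q) (k : ℕ), d.HasLevel (n + 1) k ∧
    lift q n T (src n e) = treePt q n T d k ∧ liftTgt q n T e = treeUp q n T d k := by
  have h1 : ∀ k, treePt q n T (.cusp 1) (k + 1) = lift q n T (.c k) := fun k => by
    rw [treePt, twist, map_one, one_smul]
    rfl
  cases e with
  | baseA =>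
    refine ⟨.loop false, 0, Nat.zero_le _, (treePt_zero _).symm, ?_⟩
    rw [treeUp_loop (Nat.succ_pos n), treePt_false (Nat.succ_pos n)]
    rfl
  | baseB =>
    refine ⟨.loop true, 0, Nat.zero_le _, (treePt_zero _).symm, ?_⟩
    rw [treeUp_loop (Nat.succ_pos n), treePt_true (Nat.succ_pos n)]
    rfl
  | segA i =>
    refine ⟨.loop false, i + 1, Nat.succ_le_succ i.2.le, ?_, ?_⟩
    · rw [treePt_false (i.2.trans (Nat.lt_succ_self n))]
      rfl
    · rw [treeUp_loop (Nat.succ_lt_succ i.2), treePt_false (Nat.succ_lt_succ i.2)]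
      rfl
  | segB i =>
    refine ⟨.loop true, i + 1, Nat.succ_le_succ i.2.le, ?_, ?_⟩
    · rw [treePt_true (i.2.trans (Nat.lt_succ_self n))]
      rfl
    · rw [treeUp_loop (Nat.succ_lt_succ i.2), treePt_true (Nat.succ_lt_succ i.2)]
      rfl
  | top =>
    refine ⟨.loop false, n + 1, le_rfl, ?_, ?_⟩
    · rw [treePt_false (Nat.lt_succ_self n)]
      rfl
    · rw [treeUp_top]
      change _ = ((1 : FundGroup q n T)⁻¹ * loopElt q n T) • treePt q n T (.loop true) (n + 1)
      rw [inv_one, one_mul, treePt_true (Nat.lt_succ_self n)]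
      rfl
  | baseC =>
    refine ⟨.cusp 1, 0, trivial, (treePt_zero _).symm, ?_⟩
    rw [treeUp_cusp, h1]
    rfl
  | segC k =>
    refine ⟨.cusp 1, k + 1, trivial, (h1 k).symm, ?_⟩
    rw [treeUp_cusp, h1]
    rfl

/-- Every edge on a ray is a translate of the lift of an edge of `X_N`; the edge at the top of the
lower side is one with the opposite orientation. -/
theorem exists_edge_of_ray (d : Dir q) (k : ℕ) (hk : d.HasLevel (n + 1) k) :
    ∃ (e : Edge n) (γ : FundGroup q n T),
      (treePt q n T d k = γ • lift q n T (src n e) ∧ treeUp q n T d k = γ • liftTgt q n T e) ∨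
      (treeUp q n T d k = γ • lift q n T (src n e) ∧ treePt q n T d k = γ • liftTgt q n T e) := by
  rcases d with (_ | _) | h
  · rcases k with _ | k
    · refine ⟨.baseA, 1, Or.inl ?_⟩
      rw [one_smul, one_smul, treeUp_loop (Nat.succ_pos n),
        treePt_false (Nat.succ_pos n), treePt_zero]
      exact ⟨rfl, rfl⟩
    · rcases (Nat.le_of_succ_le_succ hk).lt_or_eq with hlt | rfl
      · refine ⟨.segA ⟨k, hlt⟩, 1, Or.inl ?_⟩
        rw [one_smul, one_smul, treeUp_loop (Nat.succ_lt_succ hlt),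
          treePt_false (Nat.succ_lt_succ hlt), treePt_false (hlt.trans (Nat.lt_succ_self n))]
        exact ⟨rfl, rfl⟩
      · refine ⟨.top, 1, Or.inl ?_⟩
        rw [one_smul, one_smul, treeUp_top, treePt_false (Nat.lt_succ_self k)]
        refine ⟨rfl, ?_⟩
        change ((1 : FundGroup q k T)⁻¹ * loopElt q k T) • treePt q k T (.loop true) (k + 1) = _
        rw [inv_one, one_mul, treePt_true (Nat.lt_succ_self k)]
        rfl
  · rcases k with _ | k
    · refine ⟨.baseB, 1, Or.inl ?_⟩
      rw [one_smul, one_smul, treeUp_loop (Nat.succ_pos n),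
        treePt_true (Nat.succ_pos n), treePt_zero]
      exact ⟨rfl, rfl⟩
    · rcases (Nat.le_of_succ_le_succ hk).lt_or_eq with hlt | rfl
      · refine ⟨.segB ⟨k, hlt⟩, 1, Or.inl ?_⟩
        rw [one_smul, one_smul, treeUp_loop (Nat.succ_lt_succ hlt),
          treePt_true (Nat.succ_lt_succ hlt), treePt_true (hlt.trans (Nat.lt_succ_self n))]
        exact ⟨rfl, rfl⟩
      · refine ⟨.top, (loopElt q k T)⁻¹, Or.inr ?_⟩
        rw [treeUp_top, treePt_true (Nat.lt_succ_self k)]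
        constructor
        · change ((loopElt q k T)⁻¹ * (1 : FundGroup q k T)) •
            treePt q k T (.loop false) (k + 1) = _
          rw [mul_one, treePt_false (Nat.lt_succ_self k)]
          rfl
        · change _ = (loopElt q k T)⁻¹ • loopElt q k T • _
          rw [inv_smul_smul]
          rfl
  · rw [treeUp_cusp]
    cases k with
    | zero => exact ⟨.baseC, kappa q n T h, Or.inl ⟨rfl, rfl⟩⟩
    | succ k => exact ⟨.segC k, kappa q n T h, Or.inl ⟨rfl, rfl⟩⟩

theorem tree_adj_iff_ray (x y : (graphOfGroups q n).TreeVertex T) :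
    ((graphOfGroups q n).tree T).Adj x y ↔ ∃ (γ : FundGroup q n T) (d : Dir q) (k : ℕ),
      d.HasLevel (n + 1) k ∧
      ((x = γ • treePt q n T d k ∧ y = γ • treeUp q n T d k) ∨
        (y = γ • treePt q n T d k ∧ x = γ • treeUp q n T d k)) := by
  rw [tree_adj_iff]
  constructor
  · rintro ⟨e, γ, h⟩
    obtain ⟨d, k, hk, h1, h2⟩ := exists_ray_of_edge (q := q) (T := T) e
    rw [h1, h2] at h
    exact ⟨γ, d, k, hk, h⟩
  · rintro ⟨γ, d, k, hk, h⟩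
    obtain ⟨e, g, h'⟩ := exists_edge_of_ray (q := q) (T := T) d k hk
    refine ⟨e, γ * g, ?_⟩
    rw [mul_smul, mul_smul]
    rcases h' with ⟨h1, h2⟩ | ⟨h1, h2⟩
    · rwa [← h1, ← h2]
    · rw [← h1, ← h2]
      exact h.symm.imp And.symm And.symm

/-- The fundamental group of `X_N` with its action on the universal covering tree. -/
theorem exists_loopCuspTree (hq : 2 ≤ q) (hT : (graphOfGroups q n).IsMaximalSubtree T) :
    Nonempty (LoopCuspTree q (n + 1) (FundGroup q n T) ((graphOfGroups q n).TreeVertex T)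
      ((graphOfGroups q n).tree T)) := by
  obtain ⟨φ, hφ, hl⟩ := exists_wordHom hT
  exact ⟨{
    two_le := hq
    one_le := Nat.le_add_left 1 n
    κ := kappa q n T
    α := alpha q n T
    β := beta q n T
    t := loopElt q n T
    commute_α := commute_kappa_alpha q n T
    commute_t := commute_kappa_loopElt q n T
    α_trunc := alpha_trunc
    closure_eq_top := closure_generators hT
    φ := φ
    φ_κ := map_kappa hφ
    φ_α := map_alpha hφ
    φ_β := map_beta hφ
    φ_t := hl
    base := lift q n T .base
    pt := treePt q n T
    pt_zero := treePt_zero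
    κ_smul_pt := kappa_smul_treePt
    exists_eq_smul_pt := exists_eq_smul_treePt
    smul_base := smul_base_eq
    smul_pt := smul_treePt_eq_iff
    type_eq := treePt_type_eq
    adj_iff := tree_adj_iff_ray }⟩

end rays

end LoopWithCusp

end

theorem mainTheorem5 (q : ℕ) (hq : 2 ≤ q) (ε : ℝ) (hε : 0 < ε) (hεq : ε ≤ q) :
    ∃ n : ℕ, ∀ T : Set (LoopWithCusp.graphOfGroups q n).E,
      (LoopWithCusp.graphOfGroups q n).IsMaximalSubtree T →
        (∀ m : ℕ, ((LoopWithCusp.graphOfGroups q n).hyperbolicClasses T m).Finite) ∧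
        Tendsto (fun m : ℕ =>
          (LoopWithCusp.graphOfGroups q n).weightedCount T m / (q : ℝ) ^ m) atTop (𝓝 1) ∧
        ¬ ((fun m : ℕ => |(LoopWithCusp.graphOfGroups q n).weightedCount T m - (q : ℝ) ^ m|)
          =O[atTop] (fun m : ℕ => ((q : ℝ) - ε) ^ m)) ∧
        ∃ᶠ m : ℕ in atTop, ((q : ℝ) - ε) ^ m <
          |(LoopWithCusp.graphOfGroups q n).weightedCount T m - (q : ℝ) ^ m| := by
  obtain ⟨n, hn⟩ := LoopWithCusp.exists_asymptotics hq hε hεq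
  refine ⟨n, fun T hT => ?_⟩
  obtain ⟨M⟩ := LoopWithCusp.exists_loopCuspTree hq hT
  have key := M.abs_finsum_weight_sub_le
    ((LoopWithCusp.graphOfGroups q n).classWeight T) (fun _ => rfl)
  exact ⟨fun m => (key m).1, hn M _ fun m => (key m).2⟩
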